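/- Let $d\in\mathbb N$. Let $\mathcal P_1(\mathbb R^d)$ be the set of Borel probability measures on $\mathbb R^d$ with finite first moment, with the $1$-Wasserstein metric $W_1$. Let $m_0\in\mathcal P_1(\mathbb R^d)$, let $U\subseteq\mathbb R^d$ be a linear subspace, and assume the following. * (State cost) $L:\mathbb R^d\times\mathcal P_1(\mathbb R^d)\to[0,+\infty]$ is either (a) finite everywhere and jointly uniformly continuous, or (b) independent of its second variable, with $\{L=+\infty\}$ open and $L$ continuous on $\{L<+\infty\}$. * (Control cost) $\psi:U\to[0,+\infty)$ is convex and lower semicontinuous with $\psi(0)=0$, and there are a function $\phi:[0,+\infty)\to[0,+\infty)$ that is strictly convex, continuously differentiable and superlinear at $+\infty$, with $\phi(0)=\phi'(0)=0$, and constants $K,C>0$ such that $\phi(2r)\le K(1+\phi(r))$ for all $r\ge0$ and $\phi(|x|)-1\le\psi(x)\le C(1+\phi(|x|))$ for all $x\in U$. (For example $\psi(u)=\frac1p|u|^p$ with $p>1$.) * (Drift) $\mathbf F:\mathbb R^d\times\mathcal P_1(\mathbb R^d)\to\mathbb R^d$ is jointly uniformly continuous and there are $C_F,C_F'\ge0$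 with $|\mathbf F(y,\mu)|\le C_F+C_F'\big(|y|+\int|z|\,d\mu(z)\big)$ for all $y,\mu$. Let $C([0,1];\mathcal P_1(\mathbb R^d))$ be the set of $W_1$-continuous curves, with uniform convergence in $W_1$, and $AC([0,1];\mathcal P_1(\mathbb R^d))$ the subset of absolutely continuous curves, i.e. those for which there is $g\in L^1(0,1)$ with $W_1(\mu_s,\mu_t)\le\int_s^t g(r)\,dr$ for all $0\le s\le t\le 1$. Let $\mathcal M(\mathbb R^d\times[0,1];U)$ be the set of finite $U$-valued Borel vector measures, with narrow convergence, i.e. convergence in duality with bounded continuous functions $f:\mathbb R^d\times[0,1]\to U$. Let $\mathcal C(m_0)$ be the set of $(\mu,\boldsymbol\nu)\in AC([0,1];\mathcal P_1(\mathbb R^d))\times\mathcal M(\mathbb R^d\times[0,1];U)$ with $\mu_0=m_0$ that solve $\partial_t\mu_t+\nabla\cdot(\mathbf F(\cdot,\mu_t)\mu_t+\boldsymbol\nu_t)=0$ in the sense that, for all $\varphi\in C_c^\infty(\mathbb R^d\times(0,1))$, $$\int_0^1\!\int_{\mathbb R^d}\big(\partial_t\varphi(y,t)+\nabla\varphi(y,t)\cdot\mathbf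 F(y,\mu_t)\big)\,d\mu_t(y)\,dt+\int_{\mathbb R^d\times[0,1]}\nabla\varphi(y,t)\cdot d\boldsymbol\nu(y,t)=0 .$$ For $\mu\in C([0,1];\mathcal P_1(\mathbb R^d))$ and $\boldsymbol\nu\in\mathcal M(\mathbb R^d\times[0,1];U)$ put $$\mathcal G(\mu,\boldsymbol\nu)=\Psi(\boldsymbol\nu|\mu)+\int_0^1\!\int_{\mathbb R^d}L(y,\mu_t)\,d\mu_t(y)\,dt,$$ where $\Psi(\boldsymbol\nu|\mu)=\int_0^1\int_{\mathbb R^d}\psi(\mathbf u(y,t))\,d\mu_t(y)\,dt$ if $d\boldsymbol\nu(y,t)=\mathbf u(y,t)\,d\mu_t(y)\,dt$ for some $\mathbf u\in L^1(d\mu_t\otimes dt;U)$, and $\Psi(\boldsymbol\nu|\mu)=+\infty$ otherwise. **Lemma.** Let $(\mu_n,\boldsymbol\nu_n)\in\mathcal C(m_0)$ for all $n\in\mathbb N$, with $\sup_n\mathcal G(\mu_n,\boldsymbol\nu_n)<+\infty$. Then there are $(\mu,\boldsymbol\nu)\in\mathcal C(m_0)$ and a subsequence along which $\mu_n\to\mu$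 in $C([0,1];\mathcal P_1(\mathbb R^d))$ and $\boldsymbol\nu_n\to\boldsymbol\nu$ narrowly in $\mathcal M(\mathbb R^d\times[0,1];U)$, and moreover $\mathcal G(\mu,\boldsymbol\nu)\le\sup_n\mathcal G(\mu_n,\boldsymbol\nu_n)$. -/

import Mathlib

open MeasureTheory Set Filter Topology
open scoped ENNReal RealInnerProductSpace

namespace MFC

noncomputable section

/-- The state space `ℝ^d` with its Euclidean norm. -/
abbrev E (d : ℕ) : Type := EuclideanSpace ℝ (Fin d)

/-- The space-time domain `ℝ^d × [0,1]`. -/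
abbrev X (d : ℕ) : Type := E d × unitInterval

/-- `𝒫₁(ℝ^d)`: Borel probability measures with finite first moment. -/
@[ext]
structure P1 (d : ℕ) where
  toMeasure : Measure (E d)
  isProbabilityMeasure : IsProbabilityMeasure toMeasure
  lintegral_enorm_lt_top : ∫⁻ x, ‖x‖ₑ ∂toMeasure < ∞

attribute [instance] P1.isProbabilityMeasure

/-- The first moment `M₁(μ) = ∫ |x| dμ(x)`. -/
def P1.moment {d : ℕ} (μ : P1 d) : ℝ := ∫ x, ‖x‖ ∂μ.toMeasure

/-- The `1`-Wasserstein distance: the infimum of `∫ |x - y| dπ(x,y)` over all transport plans `π`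
with marginals `μ` and `ν`. -/
def W1 {d : ℕ} (μ ν : P1 d) : ℝ≥0∞ :=
  ⨅ (π : Measure (E d × E d)) (_ : π.map Prod.fst = μ.toMeasure ∧ π.map Prod.snd = ν.toMeasure),
    ∫⁻ z, edist z.1 z.2 ∂π

/-- `C([0,1]; 𝒫₁(ℝ^d))`: curves that are continuous for `W₁`. -/
structure Curve (d : ℕ) where
  toFun : unitInterval → P1 d
  continuous_W1 : ∀ t, Tendsto (fun s => W1 (toFun s) (toFun t)) (𝓝 t) (𝓝 0)

instance (d : ℕ) : CoeFun (Curve d) (fun _ => unitInterval → P1 d) := ⟨Curve.toFun⟩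

/-- `μ ∈ AC([0,1]; 𝒫₁(ℝ^d))`: there is `g ∈ L¹(0,1)` with `W₁(μ_s, μ_t) ≤ ∫_s^t g(r) dr`
for all `s ≤ t`. -/
def Curve.IsAC {d : ℕ} (μ : Curve d) : Prop :=
  ∃ g : ℝ → ℝ, IntervalIntegrable g volume 0 1 ∧
    ∀ s t : unitInterval, s ≤ t → W1 (μ s) (μ t) ≤ ENNReal.ofReal (∫ r in (s : ℝ)..t, g r)

/-- The measure `dμ_t ⊗ dt` on `ℝ^d × [0,1]`, characterized by
`∫ f d(dμ_t ⊗ dt) = ∫₀¹ ∫ f(y,t) dμ_t(y) dt`. -/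
def Curve.spaceTime {d : ℕ} (μ : Curve d) : Measure (X d) :=
  (volume : Measure unitInterval).bind (fun t => (μ t).toMeasure.map (fun y => (y, t)))

/-- Integrals of Lipschitz functions against measures that are close in `W₁` are close. -/
theorem lintegral_le_add_of_W1_lt {d : ℕ} (μ ν : P1 d) {K : NNReal} {f : E d → NNReal}
    (hf : LipschitzWith K f) {ε : ℝ≥0∞} (h : W1 μ ν < ε) :
    ∫⁻ x, f x ∂μ.toMeasure ≤ ∫⁻ x, f x ∂ν.toMeasure + K * ε ∧
    ∫⁻ x, f x ∂ν.toMeasure ≤ ∫⁻ x, f x ∂μ.toMeasure + K * ε := by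
  have hm : Measurable (fun x => (f x : ℝ≥0∞)) := hf.continuous.measurable.coe_nnreal_ennreal
  have key : ∀ x y, (f x : ℝ≥0∞) ≤ f y + K * edist x y := fun x y => by
    have h1 := hf.edist_le_mul x y
    refine le_trans ?_ (add_le_add_right h1 _)
    rw [edist_nndist]
    norm_cast
    exact_mod_cast NNReal.coe_le_coe.1 (by
      have := le_abs_self ((f x : ℝ) - f y)
      push_cast
      rw [NNReal.dist_eq]; linarith)
  simp only [W1, iInf_lt_iff] at h
  obtain ⟨π, ⟨h1, h2⟩, hlt⟩ := h
  rw [← h1, ← h2, lintegral_map hm measurable_fst, lintegral_map hm measurable_snd]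
  constructor
  · calc _ ≤ ∫⁻ z, ((f z.2 : ℝ≥0∞) + K * edist z.1 z.2) ∂π := lintegral_mono fun z => key _ _
      _ = _ := by
        rw [lintegral_add_right _ (by fun_prop), lintegral_const_mul _ (by fun_prop)]
      _ ≤ _ := by gcongr
  · calc _ ≤ ∫⁻ z, ((f z.1 : ℝ≥0∞) + K * edist z.1 z.2) ∂π :=
          lintegral_mono fun z => by rw [edist_comm]; exact key _ _
      _ = _ := by
        rw [lintegral_add_right _ (by fun_prop), lintegral_const_mul _ (by fun_prop)]
      _ ≤ _ := by gcongr

theorem Curve.continuous_lintegral {d : ℕ} (μ : Curve d) {K : NNReal} {f : E d → NNReal}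
    (hf : LipschitzWith K f) (hb : ∀ x, f x ≤ 1) :
    Continuous fun t => ∫⁻ x, f x ∂(μ t).toMeasure := by
  rw [continuous_iff_continuousAt]
  intro t
  have hfin : ∫⁻ x, f x ∂(μ t).toMeasure ≠ ∞ := by
    refine ne_top_of_le_ne_top (b := 1) (by simp) ?_
    calc _ ≤ ∫⁻ x, 1 ∂(μ t).toMeasure := lintegral_mono fun x => ENNReal.coe_le_coe.2 (hb x)
      _ = 1 := by simp
  rw [ContinuousAt, ENNReal.tendsto_nhds hfin]
  intro ε hε
  have hpos : 0 < ε / (K + 1) := ENNReal.div_pos hε.ne' (by simp)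
  filter_upwards [(μ.continuous_W1 t).eventually (gt_mem_nhds hpos)] with s hs
  have h := lintegral_le_add_of_W1_lt (μ s) (μ t) hf hs
  have hK : (K : ℝ≥0∞) * (ε / (K + 1)) ≤ ε := by
    rw [← mul_div_assoc, mul_comm, mul_div_assoc]
    refine mul_le_of_le_one_right' (ENNReal.div_le_of_le_mul ?_)
    simp
  exact ⟨tsub_le_iff_right.2 (h.2.trans (by gcongr)), h.1.trans (by gcongr)⟩

theorem Curve.measurable_toMeasure {d : ℕ} (μ : Curve d) :
    Measurable fun t => (μ t).toMeasure := by
  refine Measurable.measure_of_isPiSystem_of_isProbabilityMeasure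
    (S := {s | IsClosed s}) (BorelSpace.measurable_eq.trans borel_eq_generateFrom_isClosed)
    isPiSystem_isClosed fun C hC => ?_
  have hpos : ∀ n : ℕ, 0 < 1 / ((n : ℝ) + 1) := fun n => Nat.one_div_pos_of_nat
  refine measurable_of_tendsto_metrizable (f := fun (n : ℕ) t =>
    ∫⁻ x, thickenedIndicator (hpos n) C x ∂(μ t).toMeasure) (fun n =>
      (μ.continuous_lintegral (lipschitzWith_thickenedIndicator (hpos n) C)
        (thickenedIndicator_le_one (hpos n) C)).measurable) ?_
  rw [tendsto_pi_nhds]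
  intro t
  exact tendsto_lintegral_thickenedIndicator_of_isClosed _ hC hpos
    tendsto_one_div_add_atTop_nhds_zero_nat

/-- `dμ_t ⊗ dt` integrates as it should; in particular `t ↦ μ_t` is measurable for every `W₁`-continuous
curve, so that the definition of `Curve.spaceTime` involves no junk value. -/
theorem Curve.lintegral_spaceTime {d : ℕ} (μ : Curve d) {f : X d → ℝ≥0∞} (hf : Measurable f) :
    ∫⁻ z, f z ∂μ.spaceTime = ∫⁻ t : unitInterval, ∫⁻ y, f (y, t) ∂(μ t).toMeasure := by
  have hm : Measurable fun t : unitInterval => (μ t).toMeasure.map (fun y => (y, t)) := by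
    refine Measure.measurable_of_measurable_coe _ fun s hs => ?_
    let κ : ProbabilityTheory.Kernel unitInterval (E d) := ⟨_, μ.measurable_toMeasure⟩
    have : ProbabilityTheory.IsMarkovKernel κ := ⟨fun t => (μ t).isProbabilityMeasure⟩
    have h := ProbabilityTheory.Kernel.measurable_kernel_prodMk_left (κ := κ)
      (measurable_swap hs)
    convert h using 2 with t
    rw [Measure.map_apply (by fun_prop) hs]
    rfl
  rw [Curve.spaceTime, Measure.lintegral_bind hm.aemeasurable hf.aemeasurable]
  exact lintegral_congr fun t => lintegral_map hf (by fun_prop)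

/-- The Euclidean inner product as a bilinear map, the second variable being
restricted to the subspace `U`. -/
def pairing {d : ℕ} (U : Submodule ℝ (E d)) : E d →L[ℝ] U →L[ℝ] ℝ :=
  (innerSL ℝ : E d →L[ℝ] E d →L[ℝ] ℝ).bilinearComp (ContinuousLinearMap.id ℝ (E d)) U.subtypeL

/-- `∫ f · dν` for `f : ℝ^d × [0,1] → ℝ^d` and `ν` a finite `U`-valued Borel vector measure.
Since `U` is finite dimensional, every such `ν` has finite variation, so that this is a genuine
integral for every bounded Borel function `f`. -/
def dotIntegral {d : ℕ} {U : Submodule ℝ (E d)} (ν : VectorMeasure (X d) U) (f : X d → E d) : ℝ :=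
  ν.integral f (pairing U)

/-- Narrow convergence in `ℳ(ℝ^d × [0,1]; U)`: convergence in duality with bounded continuous
functions `f : ℝ^d × [0,1] → U`. -/
def NarrowTendsto {d : ℕ} {U : Submodule ℝ (E d)} (νn : ℕ → VectorMeasure (X d) U)
    (ν : VectorMeasure (X d) U) : Prop :=
  ∀ f : X d → U, Continuous f → (∃ B : ℝ, ∀ z, ‖f z‖ ≤ B) →
    Tendsto (fun n => dotIntegral (νn n) (fun z => (f z : E d))) atTop
      (𝓝 (dotIntegral ν (fun z => (f z : E d))))

/-- Convergence in `C([0,1]; 𝒫₁(ℝ^d))`: uniform convergence in `W₁`. -/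
def CurveTendsto {d : ℕ} (μn : ℕ → Curve d) (μ : Curve d) : Prop :=
  Tendsto (fun n => ⨆ t, W1 (μn n t) (μ t)) atTop (𝓝 0)

/-- The hypotheses on the control cost `ψ : U → [0,∞)`, in terms of a moderating function `φ`
(of which only the values on `[0,∞)` matter). -/
structure IsControlCost {d : ℕ} (U : Submodule ℝ (E d)) (ψ : U → ℝ) : Prop where
  nonneg : ∀ x, 0 ≤ ψ x
  convex : ConvexOn ℝ univ ψ
  lowerSemicontinuous : LowerSemicontinuous ψ
  map_zero : ψ 0 = 0
  exists_moderating : ∃ φ : ℝ → ℝ,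
    (∀ r, 0 ≤ r → 0 ≤ φ r) ∧ StrictConvexOn ℝ (Ici 0) φ ∧ ContDiffOn ℝ 1 φ (Ici 0) ∧
    φ 0 = 0 ∧ derivWithin φ (Ici 0) 0 = 0 ∧ Tendsto (fun r => φ r / r) atTop atTop ∧
    (∃ K : ℝ, 0 < K ∧ ∀ r, 0 ≤ r → φ (2 * r) ≤ K * (1 + φ r)) ∧
    (∃ C : ℝ, 0 < C ∧ ∀ x : U, φ ‖x‖ - 1 ≤ ψ x ∧ ψ x ≤ C * (1 + φ ‖x‖))

/-- The hypotheses on the state and measure cost `L : ℝ^d × 𝒫₁(ℝ^d) → [0,∞]`: either it is finite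
and jointly uniformly continuous, or it does not depend on the measure, is infinite on an open
set, and is continuous on the complement of this set. -/
def IsStateCost {d : ℕ} (L : E d → P1 d → ℝ≥0∞) : Prop :=
  ((∀ y μ, L y μ ≠ ∞) ∧
    ∀ ε : ℝ, 0 < ε → ∃ δ : ℝ, 0 < δ ∧ ∀ (y y' : E d) (μ μ' : P1 d),
      dist y y' < δ → W1 μ μ' < ENNReal.ofReal δ → |(L y μ).toReal - (L y' μ').toReal| < ε) ∨
  ((∀ y μ μ', L y μ = L y μ') ∧
    ∀ μ, IsOpen {y | L y μ = ∞} ∧ ContinuousOn (fun y => L y μ) {y | L y μ < ∞})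

/-- The hypotheses on the vector field `F : ℝ^d × 𝒫₁(ℝ^d) → ℝ^d`: joint uniform continuity and
linear growth. -/
structure IsDrift {d : ℕ} (F : E d → P1 d → E d) : Prop where
  uniformContinuous : ∀ ε : ℝ, 0 < ε → ∃ δ : ℝ, 0 < δ ∧ ∀ (y y' : E d) (μ μ' : P1 d),
    dist y y' < δ → W1 μ μ' < ENNReal.ofReal δ → dist (F y μ) (F y' μ') < ε
  growth : ∃ C C' : ℝ, 0 ≤ C ∧ 0 ≤ C' ∧ ∀ y μ, ‖F y μ‖ ≤ C + C' * (‖y‖ + μ.moment)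

/-- `(μ, ν)` solves `∂_t μ_t + ∇ · (F(·, μ_t) μ_t + ν_t) = 0` in the sense of distributions: the
weak formulation holds for all `φ ∈ C_c^∞(ℝ^d × (0,1))`. -/
def SolvesContinuityEquation {d : ℕ} {U : Submodule ℝ (E d)} (F : E d → P1 d → E d)
    (μ : Curve d) (ν : VectorMeasure (X d) U) : Prop :=
  ∀ φ : E d × ℝ → ℝ, ContDiff ℝ (⊤ : ℕ∞) φ → HasCompactSupport φ → tsupport φ ⊆ univ ×ˢ Ioo 0 1 →
    (∫ t : unitInterval, ∫ y, (deriv (fun s : ℝ => φ (y, s)) t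
        + ⟪gradient (fun x => φ (x, (t : ℝ))) y, F y (μ t)⟫) ∂(μ t).toMeasure)
      + dotIntegral ν (fun z => gradient (fun x => φ (x, (z.2 : ℝ))) z.1) = 0

/-- The constraint set `𝒞(m₀)`. -/
structure Admissible {d : ℕ} {U : Submodule ℝ (E d)} (F : E d → P1 d → E d) (m₀ : P1 d)
    (μ : Curve d) (ν : VectorMeasure (X d) U) : Prop where
  isAC : μ.IsAC
  solves : SolvesContinuityEquation F μ ν
  initial : μ 0 = m₀

/-- `dν = u dμ_t dt` with `u ∈ L¹(dμ_t ⊗ dt; U)`. -/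
def IsDensity {d : ℕ} {U : Submodule ℝ (E d)} (ν : VectorMeasure (X d) U) (μ : Curve d)
    (u : X d → U) : Prop :=
  Integrable u μ.spaceTime ∧ ν = μ.spaceTime.withDensityᵥ u

/-- The control cost functional `Ψ(ν|μ)`: it equals `∫₀¹ ∫ ψ(u(y,t)) dμ_t(y) dt` if
`dν = u dμ_t dt` (see `Psi_eq`; the density is unique almost everywhere), and `∞` if `ν` has no
density. -/
def Psi {d : ℕ} {U : Submodule ℝ (E d)} (ψ : U → ℝ) (ν : VectorMeasure (X d) U)
    (μ : Curve d) : ℝ≥0∞ :=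
  ⨅ (u : X d → U) (_ : IsDensity ν μ u), ∫⁻ z, ENNReal.ofReal (ψ (u z)) ∂μ.spaceTime

theorem Psi_eq {d : ℕ} {U : Submodule ℝ (E d)} (ψ : U → ℝ) (ν : VectorMeasure (X d) U)
    (μ : Curve d) (u : X d → U) (hu : IsDensity ν μ u) :
    Psi ψ ν μ = ∫⁻ z, ENNReal.ofReal (ψ (u z)) ∂μ.spaceTime := by
  refine le_antisymm (iInf₂_le u hu) (le_iInf₂ fun v hv => le_of_eq ?_)
  have h : u =ᵐ[μ.spaceTime] v :=
    hu.1.ae_eq_of_withDensityᵥ_eq hv.1 (hu.2.symm.trans hv.2)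
  refine lintegral_congr_ae ?_
  filter_upwards [h] with z hz
  rw [hz]

theorem Psi_eq_top {d : ℕ} {U : Submodule ℝ (E d)} (ψ : U → ℝ) (ν : VectorMeasure (X d) U)
    (μ : Curve d) (h : ¬ ∃ u, IsDensity ν μ u) : Psi ψ ν μ = ∞ := by
  simp only [Psi, iInf_eq_top]
  exact fun u hu => (h ⟨u, hu⟩).elim

/-- The functional `𝒢(μ, ν) = Ψ(ν|μ) + ∫₀¹ ∫ L(y, μ_t) dμ_t(y) dt`. -/
def G {d : ℕ} {U : Submodule ℝ (E d)} (ψ : U → ℝ) (L : E d → P1 d → ℝ≥0∞) (μ : Curve d)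
    (ν : VectorMeasure (X d) U) : ℝ≥0∞ :=
  Psi ψ ν μ + ∫⁻ t : unitInterval, ∫⁻ y, L y (μ t) ∂(μ t).toMeasure

end

end MFC

/-!
A superlinear control cost gives `‖u‖ ≤ C + ε ψ(u)` for every `ε > 0`. Together with the linear
growth of the drift, testing the continuity equation against smooth weights and applying Gronwall's
inequality bounds the first moments and their tails uniformly along the sequence. Testing it against
1-Lipschitz functions and using Kantorovich duality gives a common `W₁`-modulus of continuity, so
Arzelà–Ascoli yields a limit curve. The controls are regarded as relaxed controls, the laws of
`(y, t, u)`, which are tight. The barycentre of a weak limit is the limit control: its cost is at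
most the liminf of the costs by Jensen's inequality, and superlinearity makes the controls uniformly
integrable, so that linear functionals of them pass to the limit. The drift and the state cost are
integrals over the lift of `dμ_t ⊗ dt` under `(y, t) ↦ (y, t, μ_t)`, which converges weakly.
-/

namespace MFC

section FiniteDuality

variable {ι κ : Type*} [Fintype ι] [Fintype κ]

theorem exists_forall_apply_eq_dotProduct (Λ : (ι → ℝ) × (κ → ℝ) × ℝ →L[ℝ] ℝ) :
    ∃ (f : ι → ℝ) (g : κ → ℝ) (l : ℝ), ∀ x y r, Λ (x, y, r) = f ⬝ᵥ x + g ⬝ᵥ y + l * r := by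
  classical
  obtain ⟨f, hf⟩ := (dotProductEquiv ℝ ι).surjective
    (Λ.toLinearMap ∘ₗ LinearMap.inl ℝ (ι → ℝ) ((κ → ℝ) × ℝ))
  obtain ⟨g, hg⟩ := (dotProductEquiv ℝ κ).surjective
    (Λ.toLinearMap ∘ₗ LinearMap.inr ℝ (ι → ℝ) ((κ → ℝ) × ℝ) ∘ₗ LinearMap.inl ℝ (κ → ℝ) ℝ)
  refine ⟨f, g, Λ (0, 0, 1), fun x y r => ?_⟩
  have hx : f ⬝ᵥ x = Λ (x, 0, 0) := LinearMap.congr_fun hf x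
  have hy : g ⬝ᵥ y = Λ (0, y, 0) := LinearMap.congr_fun hg y
  have hr : Λ (0, 0, 1) * r = Λ (0, 0, r) := by
    rw [mul_comm, ← smul_eq_mul, ← map_smul]; simp
  rw [hx, hy, hr, ← map_add, ← map_add]
  simp

/-- The marginals of a plan on `ι × κ` together with its cost. -/
def marginalsAndCost (c : ι → κ → ℝ) : (ι × κ → ℝ) →ₗ[ℝ] (ι → ℝ) × (κ → ℝ) × ℝ where
  toFun p := (fun i => ∑ j, p (i, j), fun j => ∑ i, p (i, j), ∑ z, p z * c z.1 z.2)
  map_add' p q := by ext <;> simp [Finset.sum_add_distrib, add_mul]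
  map_smul' r p := by ext <;> simp [Finset.mul_sum, mul_assoc]

theorem marginalsAndCost_mul {a : ι → ℝ} {b : κ → ℝ} (ha : a ∈ stdSimplex ℝ ι)
    (hb : b ∈ stdSimplex ℝ κ) (c : ι → κ → ℝ) :
    marginalsAndCost c (fun z => a z.1 * b z.2) =
      (a, b, ∑ z : ι × κ, a z.1 * b z.2 * c z.1 z.2) := by
  ext <;> simp [marginalsAndCost, ← Finset.mul_sum, ← Finset.sum_mul, ha.2, hb.2]

theorem dotProduct_marginalsAndCost (c : ι → κ → ℝ) (f : ι → ℝ) (g : κ → ℝ) (l : ℝ)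
    (p : ι × κ → ℝ) :
    f ⬝ᵥ (marginalsAndCost c p).1 + g ⬝ᵥ (marginalsAndCost c p).2.1
      + l * (marginalsAndCost c p).2.2 = ∑ z, p z * (f z.1 + g z.2 + l * c z.1 z.2) := by
  simp only [marginalsAndCost, LinearMap.coe_mk, AddHom.coe_mk, dotProduct, Finset.mul_sum]
  rw [Finset.sum_comm (s := (Finset.univ : Finset κ)), ← Fintype.sum_prod_type',
    ← Fintype.sum_prod_type', ← Finset.sum_add_distrib, ← Finset.sum_add_distrib]
  exact Finset.sum_congr rfl fun z _ => by ring

theorem exists_plan_of_forall_potentials {a : ι → ℝ} {b : κ → ℝ} (ha : a ∈ stdSimplex ℝ ι)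
    (hb : b ∈ stdSimplex ℝ κ) (c : ι → κ → ℝ) {w : ℝ}
    (h : ∀ (f : ι → ℝ) (g : κ → ℝ), (∀ i j, f i + g j ≤ c i j) → f ⬝ᵥ a + g ⬝ᵥ b ≤ w) :
    ∃ p ∈ stdSimplex ℝ (ι × κ), (∀ i, ∑ j, p (i, j) = a i) ∧ (∀ j, ∑ i, p (i, j) = b j) ∧
      ∑ z, p z * c z.1 z.2 ≤ w := by
  classical
  by_contra! hcon
  have hdisj : Disjoint (marginalsAndCost c '' stdSimplex ℝ (ι × κ))
      ({a} ×ˢ ({b} ×ˢ Iic w)) := by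
    rw [Set.disjoint_left]
    rintro _ ⟨p, hp, rfl⟩ ⟨hpa, hpb, hpc⟩
    exact (hcon p hp (congrFun hpa) (congrFun hpb)).not_ge hpc
  obtain ⟨Λ, u, v, hΛu, huv, hΛv⟩ := geometric_hahn_banach_compact_closed
    ((convex_stdSimplex ℝ (ι × κ)).linear_image (marginalsAndCost c))
    ((isCompact_stdSimplex ℝ (ι × κ)).image (marginalsAndCost c).continuous_of_finiteDimensional)
    ((convex_singleton a).prod ((convex_singleton b).prod (convex_Iic w)))
    (isClosed_singleton.prod (isClosed_singleton.prod isClosed_Iic)) hdisj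
  obtain ⟨f, g, l, hΛ⟩ := exists_forall_apply_eq_dotProduct Λ
  have hplan : ∀ i j, f i + g j + l * c i j < u := fun i j => by
    simpa [hΛ, dotProduct_marginalsAndCost, Pi.single_apply] using
      hΛu _ (mem_image_of_mem _ (single_mem_stdSimplex ℝ (i, j)))
  have htarget : ∀ r ≤ w, v < f ⬝ᵥ a + g ⬝ᵥ b + l * r := fun r hr =>
    (hΛv (a, b, r) ⟨rfl, rfl, hr⟩).trans_eq (hΛ a b r)
  have hl : l < 0 := by
    set s := ∑ z : ι × κ, a z.1 * b z.2 * c z.1 z.2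
    have hprod : f ⬝ᵥ a + g ⬝ᵥ b + l * s < u := by
      rw [← hΛ, ← marginalsAndCost_mul ha hb c]
      refine hΛu _ (mem_image_of_mem _ ⟨fun z => mul_nonneg (ha.1 _) (hb.1 _), ?_⟩)
      simp [Fintype.sum_prod_type, ← Finset.mul_sum, ha.2, hb.2]
    nlinarith [htarget (min w (s - 1)) (min_le_left _ _), min_le_right w (s - 1)]
  have hdual := h ((-l)⁻¹ • (f - Function.const ι u)) ((-l)⁻¹ • g) fun i j => by
    simp only [Pi.smul_apply, Pi.sub_apply, Function.const_apply, smul_eq_mul]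
    rw [← mul_add, inv_mul_le_iff₀ (by linarith)]
    linarith [hplan i j]
  have hu : Function.const ι u ⬝ᵥ a = u := by
    simp [dotProduct, ← Finset.mul_sum, ha.2]
  rw [smul_dotProduct, smul_dotProduct, sub_dotProduct, hu, smul_eq_mul, smul_eq_mul, ← mul_add,
    inv_mul_le_iff₀ (by linarith)] at hdual
  linarith [htarget w le_rfl]

end FiniteDuality

theorem exists_lipschitzWith_of_add_le_dist {ι κ α : Type*} [Finite κ] [Nonempty κ]
    [PseudoMetricSpace α] (x : ι → α) (y : κ → α) {f : ι → ℝ} {g : κ → ℝ}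
    (h : ∀ i j, f i + g j ≤ dist (x i) (y j)) :
    ∃ H : α → ℝ, LipschitzWith 1 H ∧ (∀ i, f i ≤ H (x i)) ∧ ∀ j, g j ≤ -H (y j) := by
  have hle : ∀ z j, ⨅ k, (dist z (y k) - g k) ≤ dist z (y j) - g j := fun z j =>
    ciInf_le (finite_range _).bddBelow j
  refine ⟨fun z => ⨅ j, (dist z (y j) - g j), ?_, fun i => ?_, fun j => ?_⟩
  · refine LipschitzWith.of_le_add fun z z' => ?_
    obtain ⟨j, hj⟩ := exists_eq_ciInf_of_finite (f := fun j => dist z' (y j) - g j)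
    rw [← hj]
    exact (hle z j).trans (by linarith [dist_triangle z z' (y j)])
  · exact le_ciInf fun j => by linarith [h i j]
  · have := hle (y j) j
    rw [dist_self] at this
    linarith

section Coupling

open ProbabilityTheory

theorem map_bind {α β γ : Type*} [MeasurableSpace α] [MeasurableSpace β] [MeasurableSpace γ]
    {m : Measure α} {f : α → Measure β} (hf : Measurable f) {g : β → γ} (hg : Measurable g) :
    (m.bind f).map g = m.bind fun a => (f a).map g := by
  simp only [← Measure.bind_dirac_eq_map _ hg]
  exact Measure.bind_bind hf.aemeasurable (Measure.measurable_dirac.comp hg).aemeasurable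

theorem bind_map {α β γ : Type*} [MeasurableSpace α] [MeasurableSpace β] [MeasurableSpace γ]
    (m : Measure α) {f : α → β} (hf : Measurable f) {g : β → Measure γ} (hg : Measurable g) :
    (m.map f).bind g = m.bind (g ∘ f) := by
  rw [Measure.bind, Measure.bind, Measure.map_map hg hf]

variable {α β ι κ : Type*} [MeasurableSpace α] [MeasurableSpace β] [MeasurableSpace ι]
  [MeasurableSpace κ] [MeasurableSingletonClass ι]

theorem map_bind_cond_fiber [Finite ι] (μ : Measure α) [IsFiniteMeasure μ] {q : α → ι}
    (hq : Measurable q) :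
    (μ.map q).bind (fun i => μ[|q ⁻¹' {i}]) = μ := by
  have := Fintype.ofFinite ι
  ext s hs
  rw [Measure.bind_apply hs Measurable.of_discrete.aemeasurable, lintegral_fintype]
  conv_rhs => rw [← sum_meas_smul_cond_fiber hq μ]
  simp [Measure.map_apply hq, mul_comm]

theorem map_cond_fiber (μ : Measure α) [IsFiniteMeasure μ] {q : α → ι} (hq : Measurable q) {i : ι}
    (hi : μ (q ⁻¹' {i}) ≠ 0) : (μ[|q ⁻¹' {i}]).map q = Measure.dirac i := by
  have := cond_isProbabilityMeasure hi
  have hqi : q =ᵐ[μ[|q ⁻¹' {i}]] fun _ => i := ae_cond_mem (hq (measurableSet_singleton i))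
  rw [Measure.map_congr hqi, Measure.map_const, measure_univ, one_smul]

theorem ae_measure_fiber_ne_zero [Countable ι] {μ : Measure α} {q : α → ι} (hq : Measurable q)
    {γ : Measure κ} {f : κ → ι} (hf : Measurable f) (h : γ.map f = μ.map q) :
    ∀ᵐ z ∂γ, μ (q ⁻¹' {f z}) ≠ 0 := by
  have hae : ∀ᵐ i ∂μ.map q, μ (q ⁻¹' {i}) ≠ 0 :=
    ae_iff_of_countable.2 fun i hi => by
      rwa [Measure.map_apply hq (measurableSet_singleton i)] at hi
  rw [← h] at hae
  exact ae_of_ae_map hf.aemeasurable hae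

theorem exists_coupling_map_prodMap_eq [Finite ι] [Finite κ] [MeasurableSingletonClass κ]
    (μ : Measure α) (ν : Measure β) [IsFiniteMeasure μ] [IsFiniteMeasure ν] {q : α → ι} {r : β → κ}
    (hq : Measurable q) (hr : Measurable r) {γ : Measure (ι × κ)}
    (hγq : γ.map Prod.fst = μ.map q) (hγr : γ.map Prod.snd = ν.map r) :
    ∃ π : Measure (α × β), π.map Prod.fst = μ ∧ π.map Prod.snd = ν ∧
      π.map (Prod.map q r) = γ := by
  have hm : Measurable fun z : ι × κ => (μ[|q ⁻¹' {z.1}]).prod (ν[|r ⁻¹' {z.2}]) :=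
    Measurable.of_discrete
  have hμ := ae_measure_fiber_ne_zero hq measurable_fst hγq
  have hν := ae_measure_fiber_ne_zero hr measurable_snd hγr
  refine ⟨γ.bind fun z => (μ[|q ⁻¹' {z.1}]).prod (ν[|r ⁻¹' {z.2}]), ?_, ?_, ?_⟩
  · rw [map_bind hm measurable_fst]
    conv_rhs => rw [← map_bind_cond_fiber μ hq, ← hγq, bind_map _ measurable_fst .of_discrete]
    refine Measure.bind_congr_right (hν.mono fun z hz => ?_)
    have := cond_isProbabilityMeasure hz
    simp
  · rw [map_bind hm measurable_snd]
    conv_rhs => rw [← map_bind_cond_fiber ν hr, ← hγr, bind_map _ measurable_snd .of_discrete]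
    refine Measure.bind_congr_right (hμ.mono fun z hz => ?_)
    have := cond_isProbabilityMeasure hz
    simp
  · rw [map_bind hm (hq.prodMap hr)]
    conv_rhs => rw [← Measure.bind_dirac (m := γ)]
    refine Measure.bind_congr_right ?_
    filter_upwards [hμ, hν] with z hz hz'
    rw [← Measure.map_prod_map _ _ hq hr, map_cond_fiber μ hq hz, map_cond_fiber ν hr hz',
      Measure.dirac_prod_dirac]

end Coupling

section Duality

variable {α : Type*} [MeasurableSpace α]

theorem dotProduct_real_fiber {ι : Type*} [Fintype ι] [MeasurableSpace ι]
    [MeasurableSingletonClass ι] (μ : Measure α) [IsFiniteMeasure μ] {q : α → ι}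
    (hq : Measurable q) (f : ι → ℝ) :
    (f ⬝ᵥ fun i => μ.real (q ⁻¹' {i})) = ∫ x, f (q x) ∂μ := by
  rw [← integral_map (f := f) hq.aemeasurable
    Measurable.of_discrete.aestronglyMeasurable, integral_fintype .of_finite]
  exact Finset.sum_congr rfl fun i _ => by
    rw [map_measureReal_apply hq (measurableSet_singleton i), smul_eq_mul, mul_comm]

theorem real_fiber_mem_stdSimplex {ι : Type*} [Fintype ι] [MeasurableSpace ι]
    [MeasurableSingletonClass ι] (μ : Measure α) [IsProbabilityMeasure μ] {q : α → ι}
    (hq : Measurable q) : (fun i => μ.real (q ⁻¹' {i})) ∈ stdSimplex ℝ ι :=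
  ⟨fun _ => measureReal_nonneg, by simpa [dotProduct] using dotProduct_real_fiber μ hq 1⟩

/-- The measure on a finite type with the given weights, negative weights counting as `0`. -/
noncomputable def weightedSum {ι : Type*} [Fintype ι] [MeasurableSpace ι] (p : ι → ℝ) :
    Measure ι :=
  ∑ i, ENNReal.ofReal (p i) • Measure.dirac i

theorem lintegral_weightedSum {ι : Type*} [Fintype ι] [MeasurableSpace ι]
    [MeasurableSingletonClass ι] (p : ι → ℝ) (f : ι → ℝ≥0∞) :
    ∫⁻ i, f i ∂weightedSum p = ∑ i, ENNReal.ofReal (p i) * f i := by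
  simp [weightedSum, lintegral_finsetSum_measure]

theorem map_weightedSum_eq {ι κ : Type*} [Fintype ι] [Countable κ] [DecidableEq κ]
    [MeasurableSpace ι] [MeasurableSpace κ] [MeasurableSingletonClass ι]
    [MeasurableSingletonClass κ] {p : ι → ℝ} (hp : 0 ≤ p) (f : ι → κ) {m : Measure κ}
    [IsFiniteMeasure m]
    (h : ∀ k, ∑ i with f i = k, p i = m.real {k}) : (weightedSum p).map f = m := by
  refine Measure.ext_of_singleton fun k => ?_
  rw [← ofReal_measureReal (μ := m), ← h, ENNReal.ofReal_sum_of_nonneg fun i _ => hp i,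
    ← lintegral_indicator_one (measurableSet_singleton k),
    lintegral_map Measurable.of_discrete Measurable.of_discrete, lintegral_weightedSum,
    Finset.sum_filter]
  exact Finset.sum_congr rfl fun i _ => by simp [indicator_apply]

theorem dotProduct_real_fiber_add_le {ι : Type*} [Fintype ι] [MeasurableSpace ι]
    [MeasurableSingletonClass ι] [PseudoMetricSpace α] {e : ι → α} {r : α → ι}
    (μ ν : Measure α) [IsProbabilityMeasure μ] [IsProbabilityMeasure ν] (hr : Measurable r)
    {f g : ι → ℝ} (hfg : ∀ i j, f i + g j ≤ dist (e i) (e j)) {w : ℝ}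
    (h : ∀ H : α → ℝ, LipschitzWith 1 H → ∫ x, H (e (r x)) ∂μ - ∫ x, H (e (r x)) ∂ν ≤ w) :
    (f ⬝ᵥ fun i => μ.real (r ⁻¹' {i})) + (g ⬝ᵥ fun j => ν.real (r ⁻¹' {j})) ≤ w := by
  have : Nonempty ι := (nonempty_of_isProbabilityMeasure μ).map r
  obtain ⟨H, hH, hfH, hgH⟩ := exists_lipschitzWith_of_add_le_dist e e hfg
  have hf := dotProduct_le_dotProduct_of_nonneg_right (u := f) (v := fun i => H (e i))
    (w := fun i => μ.real (r ⁻¹' {i})) hfH fun _ => measureReal_nonneg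
  have hg := dotProduct_le_dotProduct_of_nonneg_right (u := g) (v := fun i => -H (e i))
    (w := fun i => ν.real (r ⁻¹' {i})) hgH fun _ => measureReal_nonneg
  rw [dotProduct_real_fiber μ hr fun i => H (e i)] at hf
  rw [dotProduct_real_fiber ν hr fun i => -H (e i), integral_neg] at hg
  linarith [h H hH]

theorem exists_coupling_lintegral_edist_simpleFunc_le [MetricSpace α] [MeasurableSingletonClass α]
    (μ ν : Measure α) [IsProbabilityMeasure μ] [IsProbabilityMeasure ν] (q : SimpleFunc α α) {w : ℝ}
    (h : ∀ f : α → ℝ, LipschitzWith 1 f → ∫ x, f (q x) ∂μ - ∫ x, f (q x) ∂ν ≤ w) :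
    ∃ π : Measure (α × α), π.map Prod.fst = μ ∧ π.map Prod.snd = ν ∧
      ∫⁻ z, edist (q z.1) (q z.2) ∂π ≤ ENNReal.ofReal w := by
  classical
  let r : α → q.range := fun x => ⟨q x, q.mem_range_self x⟩
  have hr : Measurable r := q.measurable.subtype_mk
  have hweak : ∀ f g : q.range → ℝ, (∀ i j, f i + g j ≤ dist (i : α) j) →
      (f ⬝ᵥ fun i => μ.real (r ⁻¹' {i})) + (g ⬝ᵥ fun j => ν.real (r ⁻¹' {j})) ≤ w :=
    fun f g hfg => dotProduct_real_fiber_add_le μ ν hr hfg h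
  obtain ⟨p, hp, hpμ, hpν, hpw⟩ := exists_plan_of_forall_potentials
    (real_fiber_mem_stdSimplex μ hr) (real_fiber_mem_stdSimplex ν hr)
    (fun i j => dist (i : α) j) hweak
  have hγμ : (weightedSum p).map Prod.fst = μ.map r := map_weightedSum_eq hp.1 _ fun i => by
    rw [map_measureReal_apply hr (measurableSet_singleton i), ← hpμ i, Finset.sum_filter,
      Fintype.sum_prod_type, Finset.sum_comm]
    simp
  have hγν : (weightedSum p).map Prod.snd = ν.map r := map_weightedSum_eq hp.1 _ fun j => by
    rw [map_measureReal_apply hr (measurableSet_singleton j), ← hpν j, Finset.sum_filter,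
      Fintype.sum_prod_type]
    simp
  obtain ⟨π, hπμ, hπν, hπ⟩ := exists_coupling_map_prodMap_eq μ ν hr hr hγμ hγν
  refine ⟨π, hπμ, hπν, ?_⟩
  calc ∫⁻ z, edist (q z.1) (q z.2) ∂π
      = ∫⁻ x, edist (x.1 : α) x.2 ∂π.map (Prod.map r r) :=
        (lintegral_map (f := fun x : q.range × q.range => edist (x.1 : α) x.2)
          Measurable.of_discrete (hr.prodMap hr)).symm
    _ = ∑ x, ENNReal.ofReal (p x * dist (x.1 : α) x.2) := by
        rw [hπ, lintegral_weightedSum]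
        simp only [ENNReal.ofReal_mul (hp.1 _), edist_dist]
    _ ≤ ENNReal.ofReal w := by
        rw [← ENNReal.ofReal_sum_of_nonneg fun x _ => mul_nonneg (hp.1 x) dist_nonneg]
        exact ENNReal.ofReal_le_ofReal hpw

theorem exists_simpleFunc_lintegral_edist_lt [MetricSpace α] [TopologicalSpace.SeparableSpace α]
    [OpensMeasurableSpace α] {m : Measure α} {x₀ : α} (hm : ∫⁻ x, edist x₀ x ∂m ≠ ∞) {ε : ℝ≥0∞}
    (hε : 0 < ε) : ∃ q : SimpleFunc α α, ∫⁻ x, edist (q x) x ∂m < ε := by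
  let q := SimpleFunc.approxOn id measurable_id univ x₀ (mem_univ x₀)
  have hq : Tendsto (fun n => ∫⁻ x, edist (q n x) x ∂m) atTop (𝓝 (∫⁻ _, 0 ∂m)) := by
    refine tendsto_lintegral_of_dominated_convergence _ (fun n => ?_)
      (fun n => ae_of_all _ fun x => SimpleFunc.edist_approxOn_le measurable_id _ x n) hm
      (ae_of_all _ fun x => ?_)
    · exact (q n).measurable.edist measurable_id
    · exact tendsto_iff_edist_tendsto_0.1
        (SimpleFunc.tendsto_approxOn measurable_id _ (by simp))
  rw [lintegral_zero] at hq
  obtain ⟨n, hn⟩ := (hq.eventually (gt_mem_nhds hε)).exists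
  exact ⟨q n, hn⟩

theorem integrable_of_lipschitzWith [MetricSpace α] [OpensMeasurableSpace α] {m : Measure α}
    [IsFiniteMeasure m] {x₀ : α} (hm : ∫⁻ x, edist x₀ x ∂m ≠ ∞) {K : NNReal} {f : α → ℝ}
    (hf : LipschitzWith K f) : Integrable f m := by
  have hdist : Integrable (fun x => dist x₀ x) m :=
    ⟨by fun_prop, by
      simpa [HasFiniteIntegral, Real.enorm_of_nonneg, ← edist_dist, lt_top_iff_ne_top] using hm⟩
  refine (integrable_add_const_iff (c := -f x₀)).1 ((hdist.const_mul K).mono'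
    (hf.continuous.sub continuous_const).aestronglyMeasurable (ae_of_all _ fun x => ?_))
  simpa [← Real.dist_eq, ← sub_eq_add_neg, dist_comm] using hf.dist_le_mul x x₀

theorem abs_integral_comp_sub_le {Ω β : Type*} [MeasurableSpace Ω] [PseudoMetricSpace β]
    {m : Measure Ω} {X Y : Ω → β} {K : NNReal} {f : β → ℝ} (hf : LipschitzWith K f)
    (hX : Integrable (fun ω => f (X ω)) m) (hY : Integrable (fun ω => f (Y ω)) m) {r : ℝ}
    (hr : 0 ≤ r) (h : ∫⁻ ω, edist (X ω) (Y ω) ∂m ≤ ENNReal.ofReal r) :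
    |∫ ω, f (X ω) ∂m - ∫ ω, f (Y ω) ∂m| ≤ K * r := by
  rw [← integral_sub hX hY, ← Real.norm_eq_abs, ← toReal_enorm]
  refine ENNReal.toReal_le_of_le_ofReal (by positivity) ?_
  calc ‖∫ ω, (f (X ω) - f (Y ω)) ∂m‖ₑ
      ≤ ∫⁻ ω, K * edist (X ω) (Y ω) ∂m :=
        (enorm_integral_le_lintegral_enorm _).trans (lintegral_mono fun ω => by
          rw [← edist_eq_enorm_sub]; exact hf.edist_le_mul _ _)
    _ = K * ∫⁻ ω, edist (X ω) (Y ω) ∂m := lintegral_const_mul' _ _ ENNReal.coe_ne_top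
    _ ≤ ENNReal.ofReal (K * r) := by
        rw [ENNReal.ofReal_mul K.coe_nonneg, ENNReal.ofReal_coe_nnreal]
        gcongr

theorem exists_coupling_lintegral_edist_le [MetricSpace α] [SecondCountableTopology α]
    [OpensMeasurableSpace α] (μ ν : Measure α) [IsProbabilityMeasure μ] [IsProbabilityMeasure ν]
    {x₀ : α} (hμ : ∫⁻ x, edist x₀ x ∂μ ≠ ∞) (hν : ∫⁻ x, edist x₀ x ∂ν ≠ ∞) {w : ℝ}
    (h : ∀ f : α → ℝ, LipschitzWith 1 f → ∫ x, f x ∂μ - ∫ x, f x ∂ν ≤ w) {ε : ℝ} (hε : 0 < ε) :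
    ∃ π : Measure (α × α), π.map Prod.fst = μ ∧ π.map Prod.snd = ν ∧
      ∫⁻ z, edist z.1 z.2 ∂π ≤ ENNReal.ofReal (w + ε) := by
  have hw : 0 ≤ w := by simpa using h 0 ((LipschitzWith.const 0).weaken zero_le_one)
  obtain ⟨q, hq⟩ := exists_simpleFunc_lintegral_edist_lt (m := μ + ν) (x₀ := x₀)
    (by simp [hμ, hν]) (ENNReal.ofReal_pos.2 (by positivity : 0 < ε / 4))
  rw [lintegral_add_measure] at hq
  have hqμ := (le_self_add.trans_lt hq).le
  have hqν := (le_add_self.trans_lt hq).le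
  have hclose : ∀ m : Measure α, [IsProbabilityMeasure m] → ∫⁻ x, edist x₀ x ∂m ≠ ∞ →
      ∫⁻ x, edist (q x) x ∂m ≤ ENNReal.ofReal (ε / 4) → ∀ f : α → ℝ, LipschitzWith 1 f →
      |∫ x, f (q x) ∂m - ∫ x, f x ∂m| ≤ ε / 4 := fun m _ hm hqm f hf => by
    have hfq : Integrable (fun x => f (q x)) m := (q.map f).integrable_of_isFiniteMeasure
    simpa using abs_integral_comp_sub_le hf hfq (integrable_of_lipschitzWith hm hf)
      (by positivity) hqm
  obtain ⟨π, hπμ, hπν, hπ⟩ := exists_coupling_lintegral_edist_simpleFunc_le μ ν q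
    (w := w + ε / 2) fun f hf => by
      have := abs_le.1 (hclose μ hμ hqμ f hf)
      have := abs_le.1 (hclose ν hν hqν f hf)
      linarith [h f hf]
  refine ⟨π, hπμ, hπν, ?_⟩
  have hqm : Measurable fun x => edist (q x) x := q.measurable.edist measurable_id
  rw [← hπμ, lintegral_map hqm measurable_fst] at hqμ
  rw [← hπν, lintegral_map hqm measurable_snd] at hqν
  calc ∫⁻ z, edist z.1 z.2 ∂π
      ≤ ∫⁻ z, (edist (q z.1) z.1 + edist (q z.1) (q z.2) + edist (q z.2) z.2) ∂π :=
        lintegral_mono fun z => by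
          rw [edist_comm (q z.1) z.1]
          exact edist_triangle4 _ _ _ _
    _ = ∫⁻ z, edist (q z.1) z.1 ∂π + ∫⁻ z, edist (q z.1) (q z.2) ∂π
          + ∫⁻ z, edist (q z.2) z.2 ∂π := by
        rw [lintegral_add_right (g := fun z : α × α => edist (q z.2) z.2) _
            (hqm.comp measurable_snd),
          lintegral_add_left (f := fun z : α × α => edist (q z.1) z.1) (hqm.comp measurable_fst)]
    _ ≤ ENNReal.ofReal (ε / 4) + ENNReal.ofReal (w + ε / 2) + ENNReal.ofReal (ε / 4) := by gcongr
    _ = ENNReal.ofReal (w + ε) := by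
        rw [← ENNReal.ofReal_add, ← ENNReal.ofReal_add]
        · congr 1; ring
        all_goals positivity

end Duality

section Wasserstein

variable {d : ℕ}

theorem P1.lintegral_edist_ne_top (μ : P1 d) : ∫⁻ x, edist 0 x ∂μ.toMeasure ≠ ∞ := by
  simpa only [edist_comm (0 : E d), edist_zero_right] using μ.lintegral_enorm_lt_top.ne

theorem P1.integrable_norm (μ : P1 d) : Integrable (fun x => ‖x‖) μ.toMeasure :=
  integrable_of_lipschitzWith μ.lintegral_edist_ne_top lipschitzWith_one_norm

theorem P1.integrable_of_lipschitz (μ : P1 d) {K : NNReal} {f : E d → ℝ}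
    (hf : LipschitzWith K f) : Integrable f μ.toMeasure :=
  integrable_of_lipschitzWith μ.lintegral_edist_ne_top hf

/-- The underlying probability measure, for which narrow convergence is available. -/
def P1.toProb (μ : P1 d) : ProbabilityMeasure (E d) := ⟨μ.toMeasure, inferInstance⟩

theorem W1_le_of_forall (μ ν : P1 d) {r : ℝ}
    (h : ∀ f : E d → ℝ, LipschitzWith 1 f → ∫ x, f x ∂μ.toMeasure - ∫ x, f x ∂ν.toMeasure ≤ r) :
    W1 μ ν ≤ ENNReal.ofReal r := by
  refine ENNReal.le_of_forall_pos_le_add fun ε hε _ => ?_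
  obtain ⟨π, hπμ, hπν, hπ⟩ := exists_coupling_lintegral_edist_le μ.toMeasure ν.toMeasure
    μ.lintegral_edist_ne_top ν.lintegral_edist_ne_top h (NNReal.coe_pos.2 hε)
  refine (iInf₂_le π ⟨hπμ, hπν⟩).trans (hπ.trans ?_)
  exact ENNReal.ofReal_add_le.trans_eq (by rw [ENNReal.ofReal_coe_nnreal])

theorem W1_ne_top (μ ν : P1 d) : W1 μ ν ≠ ∞ := by
  refine ne_top_of_le_ne_top ?_
    (iInf₂_le (μ.toMeasure.prod ν.toMeasure) ⟨by simp, by simp⟩)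
  refine ne_top_of_le_ne_top ?_ (lintegral_mono fun z => edist_triangle_left z.1 z.2 0)
  rw [lintegral_add_left (by fun_prop),
    measurePreserving_fst.lintegral_comp (f := edist 0) (by fun_prop),
    measurePreserving_snd.lintegral_comp (f := edist 0) (by fun_prop)]
  exact ENNReal.add_ne_top.2 ⟨μ.lintegral_edist_ne_top, ν.lintegral_edist_ne_top⟩

theorem abs_integral_sub_le_W1 (μ ν : P1 d) {K : NNReal} {f : E d → ℝ} (hf : LipschitzWith K f) :
    |∫ x, f x ∂μ.toMeasure - ∫ x, f x ∂ν.toMeasure| ≤ K * (W1 μ ν).toReal := by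
  suffices h : ∀ r > (W1 μ ν).toReal,
      |∫ x, f x ∂μ.toMeasure - ∫ x, f x ∂ν.toMeasure| ≤ K * r from
    ge_of_tendsto ((continuous_const_mul (K : ℝ)).continuousWithinAt (s := Ioi _))
      (eventually_mem_nhdsWithin.mono h)
  intro r hr
  have hlt := (ENNReal.lt_ofReal_iff_toReal_lt (W1_ne_top μ ν)).2 hr
  simp only [W1, iInf_lt_iff] at hlt
  obtain ⟨π, ⟨hπμ, hπν⟩, hπ⟩ := hlt
  have hμ := μ.integrable_of_lipschitz hf
  have hν := ν.integrable_of_lipschitz hf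
  rw [← hπμ] at hμ ⊢
  rw [← hπν] at hν ⊢
  rw [integral_map measurable_fst.aemeasurable hμ.1, integral_map measurable_snd.aemeasurable hν.1]
  exact abs_integral_comp_sub_le hf (hμ.comp_measurable measurable_fst)
    (hν.comp_measurable measurable_snd) (ENNReal.toReal_nonneg.trans hr.le) hπ.le

theorem W1_toReal_le_of_forall (μ ν : P1 d) {r : ℝ}
    (h : ∀ f : E d → ℝ, LipschitzWith 1 f → ∫ x, f x ∂μ.toMeasure - ∫ x, f x ∂ν.toMeasure ≤ r) :
    (W1 μ ν).toReal ≤ r :=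
  ENNReal.toReal_le_of_le_ofReal (by simpa using h 0 ((LipschitzWith.const 0).weaken zero_le_one))
    (W1_le_of_forall μ ν h)

theorem W1_comm_le (μ ν : P1 d) : (W1 μ ν).toReal ≤ (W1 ν μ).toReal :=
  W1_toReal_le_of_forall μ ν fun f hf => by
    simpa using neg_le.1 (abs_le.1 (abs_integral_sub_le_W1 ν μ hf)).1

theorem W1_triangle (μ ν ρ : P1 d) :
    (W1 μ ρ).toReal ≤ (W1 μ ν).toReal + (W1 ν ρ).toReal :=
  W1_toReal_le_of_forall μ ρ fun f hf => by
    have hμν := (abs_le.1 (abs_integral_sub_le_W1 μ ν hf)).2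
    have hνρ := (abs_le.1 (abs_integral_sub_le_W1 ν ρ hf)).2
    rw [NNReal.coe_one, one_mul] at hμν hνρ
    linarith

theorem eq_of_W1_toReal_eq_zero {μ ν : P1 d} (h : (W1 μ ν).toReal = 0) : μ = ν := by
  have hlim : Tendsto (fun _ : ℕ => μ.toProb) atTop (𝓝 (ν.toProb)) := by
    refine tendsto_iff_forall_lipschitz_integral_tendsto.2 fun f _ ⟨K, hf⟩ => ?_
    have hfμν := abs_integral_sub_le_W1 μ ν hf
    rw [h, mul_zero, abs_nonpos_iff, sub_eq_zero] at hfμν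
    exact hfμν ▸ tendsto_const_nhds
  have heq : μ.toProb = ν.toProb := tendsto_nhds_unique tendsto_const_nhds hlim
  exact P1.ext (congrArg Subtype.val heq)

/-- The Wasserstein metric on `𝒫₁(ℝ^d)`, with `edist` definitionally equal to `W1`. -/
noncomputable instance : MetricSpace (P1 d) where
  dist μ ν := (W1 μ ν).toReal
  edist μ ν := W1 μ ν
  edist_dist μ ν := (ENNReal.ofReal_toReal (W1_ne_top μ ν)).symm
  dist_self μ := le_antisymm (W1_toReal_le_of_forall μ μ fun f _ => by simp)
    ENNReal.toReal_nonneg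
  dist_comm μ ν := le_antisymm (W1_comm_le μ ν) (W1_comm_le ν μ)
  dist_triangle := W1_triangle
  eq_of_dist_eq_zero := eq_of_W1_toReal_eq_zero

theorem P1.lipschitzWith_integral {K : NNReal} {f : E d → ℝ} (hf : LipschitzWith K f) :
    LipschitzWith K fun μ : P1 d => ∫ x, f x ∂μ.toMeasure :=
  LipschitzWith.of_dist_le_mul fun μ ν => abs_integral_sub_le_W1 μ ν hf

theorem P1.continuous_moment : Continuous (P1.moment (d := d)) :=
  (P1.lipschitzWith_integral lipschitzWith_one_norm).continuous

theorem Curve.continuous (μ : Curve d) : Continuous fun t => μ t :=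
  continuous_iff_continuousAt.2 fun t => tendsto_iff_edist_tendsto_0.2 (μ.continuous_W1 t)

theorem Curve.exists_moment_le (μ : Curve d) : ∃ M, ∀ t, (μ t).moment ≤ M :=
  let ⟨M, hM⟩ := isCompact_univ.bddAbove_image (P1.continuous_moment.comp μ.continuous).continuousOn
  ⟨M, fun t => hM (mem_image_of_mem _ (mem_univ t))⟩

end Wasserstein

section Weight

variable {V : Type*} [NormedAddCommGroup V]

/-- The Japanese bracket `⟨y⟩ = √(1 + |y|²)`, a smooth substitute for the norm. -/
noncomputable def bracket (y : V) : ℝ := √(1 + ‖y‖ ^ 2)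

/-- The weight `⟨y⟩² / (R + ⟨y⟩)`, whose integral measures the tail of a measure beyond radius
`R`: it is comparable to `|y|` for `|y| ≥ R`, tends to zero as `R → ∞`, and its logarithmic
derivative is at most `2 / ⟨y⟩` uniformly in `R`. -/
noncomputable def weight (R : ℝ) (y : V) : ℝ := bracket y ^ 2 / (R + bracket y)

theorem one_le_bracket (y : V) : 1 ≤ bracket y := Real.one_le_sqrt.2 (by nlinarith [sq_nonneg ‖y‖])

theorem bracket_pos (y : V) : 0 < bracket y := zero_lt_one.trans_le (one_le_bracket y)

theorem norm_le_bracket (y : V) : ‖y‖ ≤ bracket y := Real.le_sqrt_of_sq_le (by linarith)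

theorem weight_zero (y : V) : weight 0 y = bracket y := by
  rw [weight, zero_add, sq, mul_div_assoc, div_self (bracket_pos y).ne', mul_one]

variable {R S : ℝ}

theorem weight_nonneg (hR : 0 ≤ R) (y : V) : 0 ≤ weight R y :=
  div_nonneg (sq_nonneg _) (add_nonneg hR (bracket_pos y).le)

theorem weight_anti (hR : 0 ≤ R) (hRS : R ≤ S) (y : V) : weight S y ≤ weight R y :=
  div_le_div_of_nonneg_left (sq_nonneg _) (add_pos_of_nonneg_of_pos hR (bracket_pos y))
    (add_le_add_left hRS _)

theorem weight_le_bracket (hR : 0 ≤ R) (y : V) : weight R y ≤ bracket y :=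
  (weight_anti le_rfl hR y).trans (weight_zero y).le

theorem norm_le_two_mul_weight (hR : 0 ≤ R) {y : V} (h : R ≤ ‖y‖) : ‖y‖ ≤ 2 * weight R y := by
  have hpos := bracket_pos y
  have hnorm := norm_le_bracket y
  refine hnorm.trans ?_
  rw [weight, mul_div_assoc', le_div_iff₀ (by linarith)]
  nlinarith

variable [InnerProductSpace ℝ V]

theorem contDiff_bracket : ContDiff ℝ (⊤ : ℕ∞) (bracket (V := V)) :=
  (contDiff_const.add (contDiff_norm_sq ℝ)).sqrt fun y => by positivity

theorem norm_fderiv_bracket_le (y : V) : ‖fderiv ℝ bracket y‖ ≤ 1 := by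
  have hderiv : fderiv ℝ bracket y = _ :=
    (((hasStrictFDerivAt_norm_sq y).hasFDerivAt.const_add 1).sqrt (by positivity)).fderiv
  have hpos := bracket_pos y
  have hnorm := norm_le_bracket y
  rw [bracket] at hpos hnorm
  rw [hderiv, ← Nat.cast_smul_eq_nsmul ℝ, norm_smul, norm_smul, innerSL_apply_norm,
    Real.norm_of_nonneg (by positivity), Real.norm_of_nonneg (by positivity),
    div_mul_eq_mul_div, div_le_one (by positivity)]
  push_cast
  linarith

theorem lipschitzWith_bracket : LipschitzWith 1 (bracket (V := V)) :=
  lipschitzWith_of_nnnorm_fderiv_le (contDiff_bracket.differentiable (by simp))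
    norm_fderiv_bracket_le

theorem contDiff_weight (hR : 0 ≤ R) : ContDiff ℝ (⊤ : ℕ∞) (weight (V := V) R) :=
  (contDiff_bracket.pow 2).div (contDiff_const.add contDiff_bracket)
    fun y => (add_pos_of_nonneg_of_pos hR (bracket_pos y)).ne'

theorem norm_fderiv_weight_le (hR : 0 ≤ R) (y : V) :
    ‖fderiv ℝ (weight R) y‖ ≤ 2 * bracket y / (R + bracket y) := by
  have hpos := bracket_pos y
  have hRpos : 0 < R + bracket y := by linarith
  have hprofile : HasDerivAt (fun s : ℝ => s ^ 2 / (R + s))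
      ((2 * bracket y * (R + bracket y) - bracket y ^ 2 * 1) / (R + bracket y) ^ 2)
      (bracket y) := by
    simpa using! (hasDerivAt_pow 2 (bracket y)).fun_div ((hasDerivAt_id' (bracket y)).const_add R)
      hRpos.ne'
  have hderiv : HasFDerivAt (weight R) _ y :=
    hprofile.comp_hasFDerivAt y (contDiff_bracket.differentiable (by simp) y).hasFDerivAt
  have hnonneg :
      0 ≤ (2 * bracket y * (R + bracket y) - bracket y ^ 2 * 1) / (R + bracket y) ^ 2 :=
    div_nonneg (by nlinarith) (by positivity)
  rw [hderiv.fderiv, norm_smul, Real.norm_of_nonneg hnonneg]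
  refine (mul_le_of_le_one_right hnonneg (norm_fderiv_bracket_le y)).trans ?_
  rw [div_le_div_iff₀ (by positivity) hRpos]
  have : 0 ≤ bracket y ^ 2 * (R + bracket y) := by positivity
  nlinarith

theorem bracket_mul_norm_fderiv_weight_le (hR : 0 ≤ R) (y : V) :
    bracket y * ‖fderiv ℝ (weight R) y‖ ≤ 2 * weight R y :=
  (mul_le_mul_of_nonneg_left (norm_fderiv_weight_le hR y) (bracket_pos y).le).trans_eq
    (by rw [weight]; ring)

theorem norm_fderiv_weight_le_mul_bracket (hR : 0 < R) (y : V) :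
    ‖fderiv ℝ (weight R) y‖ ≤ 2 / R * bracket y := by
  have hpos := bracket_pos y
  refine (norm_fderiv_weight_le hR.le y).trans ?_
  rw [div_mul_eq_mul_div]
  gcongr
  linarith

theorem norm_fderiv_weight_le_two (hR : 0 ≤ R) (y : V) : ‖fderiv ℝ (weight R) y‖ ≤ 2 := by
  have hpos := bracket_pos y
  refine (norm_fderiv_weight_le hR y).trans ?_
  rw [div_le_iff₀ (by linarith)]
  linarith

theorem lipschitzWith_weight (hR : 0 ≤ R) : LipschitzWith 2 (weight (V := V) R) :=
  lipschitzWith_of_nnnorm_fderiv_le ((contDiff_weight hR).differentiable (by simp))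
    (norm_fderiv_weight_le_two hR)

end Weight

theorem tendsto_integral_weight {d : ℕ} (μ : P1 d) :
    Tendsto (fun R => ∫ y, weight R y ∂μ.toMeasure) atTop (𝓝 0) := by
  have h := tendsto_integral_filter_of_dominated_convergence (μ := μ.toMeasure) (l := atTop)
    (F := fun R y => weight R y) (f := fun _ => 0) bracket ?_ ?_
    (μ.integrable_of_lipschitz lipschitzWith_bracket) (ae_of_all _ fun y =>
      (tendsto_atTop_add_const_right _ _ tendsto_id).const_div_atTop _)
  · rwa [integral_zero] at h
  · filter_upwards [eventually_ge_atTop 0] with R hR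
    exact (lipschitzWith_weight hR).continuous.aestronglyMeasurable
  · filter_upwards [eventually_ge_atTop 0] with R hR
    refine ae_of_all _ fun y => ?_
    rw [Real.norm_of_nonneg (weight_nonneg hR y)]
    exact weight_le_bracket hR y

open BoundedContinuousFunction in
theorem integral_le_integral_add_of_levyProkhorovEDist_lt {Ω : Type*} [PseudoMetricSpace Ω]
    [MeasurableSpace Ω] [OpensMeasurableSpace Ω] {μ ν : Measure Ω} [IsProbabilityMeasure μ]
    [IsProbabilityMeasure ν] {ε : ℝ} (hε : 0 < ε)
    (h : levyProkhorovEDist μ ν < ENNReal.ofReal ε) {f : Ω →ᵇ ℝ} (hf : LipschitzWith 1 f)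
    (hf₀ : 0 ≤ f) :
    ∫ x, f x ∂μ ≤ ∫ x, f x ∂ν + ε * (1 + ‖f‖) := by
  have hthick (t : ℝ) : Metric.thickening ε {x | t ≤ f x} ⊆ {x | t ≤ f x + ε} := fun x hx => by
    obtain ⟨y, hy, hxy⟩ := Metric.mem_thickening_iff.1 hx
    have hfy : t ≤ f y := hy
    have hdist := (le_abs_self _).trans (hf.dist_le_mul y x)
    rw [NNReal.coe_one, one_mul, dist_comm y] at hdist
    exact show t ≤ f x + ε by linarith
  have hlayer : ∫ x, f x + ε ∂ν = ∫ t in Ioc 0 (‖f‖ + ε), ν.real {x | t ≤ f x + ε} :=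
    ((f.integrable ν).add (integrable_const ε)).integral_eq_integral_Ioc_meas_le
      (ae_of_all _ fun x => add_nonneg (hf₀ x) hε.le)
      (ae_of_all _ fun x => add_le_add_left (f.apply_le_norm x) ε)
  have hInt (r : ℝ) : IntegrableOn (fun t => ν.real {x | t ≤ f x + ε}) (Ioc 0 r) :=
    (AntitoneOn.integrableOn_isCompact isCompact_Icc fun s _ t _ hst =>
      measureReal_mono fun x (hx : t ≤ f x + ε) => hst.trans hx).mono_set Ioc_subset_Icc_self
  have hmono : ∫ t in Ioc 0 ‖f‖, ν.real (Metric.thickening ε {x | t ≤ f x})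
      ≤ ∫ x, f x + ε ∂ν := by
    rw [hlayer]
    refine (integral_mono_of_nonneg (ae_of_all _ fun t => measureReal_nonneg) (hInt _)
      (ae_of_all _ fun t => measureReal_mono (hthick t))).trans ?_
    exact setIntegral_mono_set (hInt _) (ae_of_all _ fun t => measureReal_nonneg)
      (Ioc_subset_Ioc_right (by linarith)).eventuallyLE
  rw [integral_add (f.integrable ν) (integrable_const ε)] at hmono
  simp only [integral_const, probReal_univ, one_smul] at hmono
  linarith [integral_le_of_levyProkhorovEDist_lt μ ν hε h f (ae_of_all _ hf₀)]

section Convergence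

variable {d : ℕ}

theorem abs_sub_clamp_le {a r R w : ℝ} (hR : 0 ≤ R) (ha : |a| ≤ r) (hw₀ : 0 ≤ w)
    (hw : R ≤ r → r ≤ w) : |a - (max 0 (min (a + R) (2 * R)) - R)| ≤ w := by
  grind

theorem dist_le_of_levyProkhorovEDist_lt {μ ν : P1 d} {ε R : ℝ} (hε : 0 < ε) (hR : 0 ≤ R)
    (h : levyProkhorovEDist μ.toMeasure ν.toMeasure < ENNReal.ofReal ε) :
    dist μ ν ≤ ε * (1 + 2 * R) +
      2 * (∫ x, weight R x ∂μ.toMeasure + ∫ x, weight R x ∂ν.toMeasure) := by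
  refine W1_toReal_le_of_forall μ ν fun f hf => ?_
  let g : E d → ℝ := fun x => max 0 (min (f x - f 0 + R) (2 * R))
  have hg : LipschitzWith 1 g := by
    have hshift : LipschitzWith 1 fun x => f x - f 0 + R :=
      LipschitzWith.of_dist_le_mul fun x y => by
        simpa only [Real.dist_eq, add_sub_add_right_eq_sub, sub_sub_sub_cancel_right] using
          hf.dist_le_mul x y
    exact (hshift.min_const _).const_max _
  have hg₀ : ∀ x, 0 ≤ g x := fun x => le_max_left _ _
  have hgR : ∀ x, g x ≤ 2 * R := fun x => max_le (by positivity) (min_le_right _ _)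
  let gb := BoundedContinuousFunction.ofNormedAddCommGroup g hg.continuous (2 * R)
    fun x => (Real.norm_of_nonneg (hg₀ x)).trans_le (hgR x)
  have hgb : ‖gb‖ ≤ 2 * R := BoundedContinuousFunction.norm_ofNormedAddCommGroup_le _
    (by positivity) _
  have hgμν : ∫ x, g x ∂μ.toMeasure ≤ ∫ x, g x ∂ν.toMeasure + ε * (1 + 2 * R) :=
    (integral_le_integral_add_of_levyProkhorovEDist_lt hε h (f := gb) hg hg₀).trans
      (add_le_add_right (by gcongr) _)
  have hfg (x : E d) : ‖f x - f 0 - (g x - R)‖ ≤ 2 * weight R x := by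
    have hfx := hf.dist_le_mul x 0
    rw [NNReal.coe_one, one_mul, dist_zero_right] at hfx
    exact abs_sub_clamp_le hR hfx (mul_nonneg zero_le_two (weight_nonneg hR x))
      (norm_le_two_mul_weight hR)
  have hclip (m : P1 d) : |∫ x, f x ∂m.toMeasure - f 0 - (∫ x, g x ∂m.toMeasure - R)|
      ≤ 2 * ∫ x, weight R x ∂m.toMeasure := by
    have hfm := m.integrable_of_lipschitz hf
    have hgm := m.integrable_of_lipschitz hg
    have hshift {p : E d → ℝ} (hp : Integrable p m.toMeasure) (c : ℝ) :
        ∫ x, p x - c ∂m.toMeasure = ∫ x, p x ∂m.toMeasure - c := by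
      rw [integral_sub hp (integrable_const c), integral_const, probReal_univ, one_smul]
    rw [← hshift hfm, ← hshift hgm, ← integral_const_mul, ← integral_sub
      (hfm.sub' (integrable_const _)) (hgm.sub' (integrable_const _))]
    exact norm_integral_le_of_norm_le
      ((m.integrable_of_lipschitz (lipschitzWith_weight hR)).const_mul 2) (ae_of_all _ hfg)
  have hμ := abs_le.1 (hclip μ)
  have hν := abs_le.1 (hclip ν)
  linarith

end Convergence

section NarrowConvergence

variable {Ω : Type*} [MeasurableSpace Ω]

theorem isTightMeasureSet_of_lintegral_le [TopologicalSpace Ω] {S : Set (Measure Ω)}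
    {f : Ω → ℝ≥0∞} (hf : Measurable f)
    (hcompact : ∀ r ≠ ∞, ∃ K, IsCompact K ∧ {x | f x < r} ⊆ K) {C : ℝ≥0∞} (hC : C ≠ ∞)
    (h : ∀ μ ∈ S, ∫⁻ x, f x ∂μ ≤ C) : IsTightMeasureSet S := by
  rw [isTightMeasureSet_iff_exists_isCompact_measure_compl_le]
  intro ε hε
  rcases eq_or_ne ε ∞ with rfl | hε'
  · exact ⟨∅, isCompact_empty, fun _ _ => le_top⟩
  have hr₀ : (C + 1) / ε ≠ 0 := by simp [hε']
  have hr : (C + 1) / ε ≠ ∞ := ENNReal.div_ne_top (by simp [hC]) hε.ne'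
  obtain ⟨K, hKc, hK⟩ := hcompact _ hr
  refine ⟨K, hKc, fun μ hμ => ?_⟩
  calc μ Kᶜ ≤ μ {x | (C + 1) / ε ≤ f x} :=
        measure_mono (compl_subset_comm.1 fun x hx => hK (mem_ofPred.2 (lt_of_not_ge hx)))
    _ ≤ (∫⁻ x, f x ∂μ) / ((C + 1) / ε) := meas_ge_le_lintegral_div hf.aemeasurable hr₀ hr
    _ ≤ ε := ENNReal.div_le_of_le_mul <| by
        rw [ENNReal.mul_div_cancel hε.ne' hε']
        exact (h μ hμ).trans le_self_add

theorem isTightMeasureSet_of_lintegral_enorm_le {V : Type*} [NormedAddCommGroup V] [ProperSpace V]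
    [MeasurableSpace V] [OpensMeasurableSpace V] {S : Set (Measure V)} {C : ℝ≥0∞} (hC : C ≠ ∞)
    (h : ∀ μ ∈ S, ∫⁻ x, ‖x‖ₑ ∂μ ≤ C) : IsTightMeasureSet S :=
  isTightMeasureSet_of_lintegral_le measurable_enorm (fun r hr =>
    ⟨Metric.closedBall 0 r.toReal, isCompact_closedBall _ _, fun x hx =>
      mem_closedBall_zero_iff.2 ((toReal_enorm x).symm.trans_le
        (ENNReal.toReal_mono hr (le_of_lt hx)))⟩) hC h

theorem exists_subseq_tendsto_of_isTightMeasureSet [MetricSpace Ω] [SecondCountableTopology Ω]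
    [BorelSpace Ω] {p : ℕ → ProbabilityMeasure Ω}
    (hp : IsTightMeasureSet {((q : ProbabilityMeasure Ω) : Measure Ω) | q ∈ range p}) :
    ∃ (q : ProbabilityMeasure Ω) (k : ℕ → ℕ), StrictMono k ∧
      Tendsto (fun n => p (k n)) atTop (𝓝 q) := by
  obtain ⟨q, -, k, hk, hq⟩ := (isCompact_closure_of_isTightMeasureSet hp).tendsto_subseq
    fun n => subset_closure (mem_range_self n)
  exact ⟨q, k, hk, hq⟩

theorem lintegral_eq_lintegral_Ioi_meas_ofReal_lt (μ : Measure Ω) [SFinite μ] {f : Ω → ℝ≥0∞}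
    (hf : Measurable f) :
    ∫⁻ x, f x ∂μ = ∫⁻ t in Ioi (0 : ℝ), μ {x | ENNReal.ofReal t < f x} := by
  have hS : MeasurableSet {z : Ω × ℝ | ENNReal.ofReal z.2 < f z.1} :=
    measurableSet_lt (ENNReal.measurable_ofReal.comp measurable_snd) (hf.comp measurable_fst)
  have hslice (x : Ω) : f x = volume.restrict (Ioi (0 : ℝ)) {t | ENNReal.ofReal t < f x} := by
    rw [Measure.restrict_apply (measurableSet_lt ENNReal.measurable_ofReal measurable_const)]
    rcases eq_or_ne (f x) ∞ with hx | hx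
    · simp [hx]
    · have : {t | ENNReal.ofReal t < f x} ∩ Ioi 0 = Ioo 0 (f x).toReal := by
        ext t
        exact ⟨fun h => ⟨h.2, (ENNReal.ofReal_lt_iff_lt_toReal (le_of_lt h.2) hx).1 h.1⟩,
          fun h => ⟨(ENNReal.ofReal_lt_iff_lt_toReal h.1.le hx).2 h.2, h.1⟩⟩
      rw [this, Real.volume_Ioo, sub_zero, ENNReal.ofReal_toReal hx]
  calc ∫⁻ x, f x ∂μ
      = ∫⁻ x, volume.restrict (Ioi (0 : ℝ)) {t | ENNReal.ofReal t < f x} ∂μ :=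
        lintegral_congr hslice
    _ = _ := (Measure.prod_apply hS).symm.trans (Measure.prod_apply_symm hS)

theorem lintegral_le_liminf_of_lowerSemicontinuous [TopologicalSpace Ω] [OpensMeasurableSpace Ω]
    [HasOuterApproxClosed Ω] {p : ℕ → ProbabilityMeasure Ω} {q : ProbabilityMeasure Ω}
    (h : Tendsto p atTop (𝓝 q)) {f : Ω → ℝ≥0∞} (hf : LowerSemicontinuous f) :
    ∫⁻ x, f x ∂(q : Measure Ω) ≤ liminf (fun n => ∫⁻ x, f x ∂(p n : Measure Ω)) atTop := by
  simp only [lintegral_eq_lintegral_Ioi_meas_ofReal_lt _ hf.measurable]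
  calc _ ≤ ∫⁻ t in Ioi (0 : ℝ),
          liminf (fun n => (p n : Measure Ω) {x | ENNReal.ofReal t < f x}) atTop :=
        lintegral_mono fun t =>
          ProbabilityMeasure.le_liminf_measure_open_of_tendsto h (hf.isOpen_preimage _)
    _ ≤ _ := lintegral_liminf_le fun n => Antitone.measurable fun s t hst =>
        measure_mono fun x hx => (ENNReal.ofReal_le_ofReal hst).trans_lt hx

end NarrowConvergence

section Compactness

variable {d : ℕ}

theorem tendsto_of_tendsto_toProb {μ : ℕ → P1 d} {μ' : P1 d}
    (h : Tendsto (fun n => (μ n).toProb) atTop (𝓝 μ'.toProb))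
    (htail : ∀ ε > 0, ∃ R ≥ 0, ∀ n, ∫ x, weight R x ∂(μ n).toMeasure ≤ ε) :
    Tendsto μ atTop (𝓝 μ') := by
  refine Metric.tendsto_nhds.2 fun ε hε => ?_
  obtain ⟨R₀, hR₀, hμ⟩ := htail (ε / 8) (by positivity)
  obtain ⟨R, hμ', hR₀R⟩ := (((tendsto_integral_weight μ').eventually
    (ge_mem_nhds (by positivity : 0 < ε / 8))).and (eventually_ge_atTop R₀)).exists
  have hR : 0 ≤ R := hR₀.trans hR₀R
  have hLP := EMetric.tendsto_nhds.1
    ((LevyProkhorov.continuous_ofMeasure_probabilityMeasure.tendsto μ'.toProb).comp h)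
    (ENNReal.ofReal (ε / (4 * (1 + 2 * R)))) (ENNReal.ofReal_pos.2 (by positivity))
  filter_upwards [hLP] with n hn
  have hdist := dist_le_of_levyProkhorovEDist_lt (by positivity) hR hn
  have hμn : ∫ x, weight R x ∂(μ n).toMeasure ≤ ε / 8 :=
    (integral_mono ((μ n).integrable_of_lipschitz (lipschitzWith_weight hR))
      ((μ n).integrable_of_lipschitz (lipschitzWith_weight hR₀)) (weight_anti hR₀ hR₀R)).trans
      (hμ n)
  have hδ : ε / (4 * (1 + 2 * R)) * (1 + 2 * R) = ε / 4 := by field_simp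
  linarith

theorem P1.lintegral_enorm_eq (μ : P1 d) :
    ∫⁻ x, ‖x‖ₑ ∂μ.toMeasure = ENNReal.ofReal μ.moment := by
  rw [P1.moment, ofReal_integral_eq_lintegral_ofReal μ.integrable_norm
    (ae_of_all _ fun x => norm_nonneg x)]
  simp only [ofReal_norm]

theorem P1.moment_le_add_integral_weight (μ : P1 d) {R : ℝ} (hR : 0 ≤ R) :
    μ.moment ≤ R + 2 * ∫ x, weight R x ∂μ.toMeasure := by
  have hInt := (μ.integrable_of_lipschitz (lipschitzWith_weight hR)).const_mul 2
  calc μ.moment ≤ ∫ x, (R + 2 * weight R x) ∂μ.toMeasure :=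
        integral_mono μ.integrable_norm ((integrable_const R).add hInt) fun x => by
          have hw := weight_nonneg hR x
          rcases le_total R ‖x‖ with hx | hx
          · linarith [norm_le_two_mul_weight hR hx]
          · linarith
    _ = R + 2 * ∫ x, weight R x ∂μ.toMeasure := by
        rw [integral_add (integrable_const R) hInt, integral_const, probReal_univ, one_smul,
          integral_const_mul]

theorem exists_toProb_eq_of_tendsto {μ : ℕ → P1 d} {q : ProbabilityMeasure (E d)}
    (h : Tendsto (fun n => (μ n).toProb) atTop (𝓝 q)) {M : ℝ} (hM : ∀ n, (μ n).moment ≤ M) :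
    ∃ μ' : P1 d, μ'.toProb = q := by
  refine ⟨⟨q, q.2, ?_⟩, rfl⟩
  calc ∫⁻ x, ‖x‖ₑ ∂(q : Measure (E d))
      ≤ liminf (fun n => ∫⁻ x, ‖x‖ₑ ∂(μ n).toMeasure) atTop :=
        lintegral_le_liminf_of_lowerSemicontinuous h continuous_enorm.lowerSemicontinuous
    _ ≤ liminf (fun _ : ℕ => ENNReal.ofReal M) atTop :=
        liminf_le_liminf (Eventually.of_forall fun n =>
          (μ n).lintegral_enorm_eq.trans_le (ENNReal.ofReal_le_ofReal (hM n)))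
    _ < ∞ := by rw [liminf_const]; exact ENNReal.ofReal_lt_top

theorem isCompact_setOf_integral_weight_le {R : ℝ → ℝ} (hR : ∀ ε > 0, 0 ≤ R ε) :
    IsCompact {μ : P1 d | ∀ ε > 0, ∫ x, weight (R ε) x ∂μ.toMeasure ≤ ε} := by
  refine IsSeqCompact.isCompact fun μ hμ => ?_
  have hmoment (n : ℕ) : (μ n).moment ≤ R 1 + 2 :=
    ((μ n).moment_le_add_integral_weight (hR 1 one_pos)).trans (by linarith [hμ n 1 one_pos])
  have htight : IsTightMeasureSet
      {((p : ProbabilityMeasure (E d)) : Measure (E d)) | p ∈ range fun n => (μ n).toProb} := by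
    refine isTightMeasureSet_of_lintegral_enorm_le (ENNReal.ofReal_ne_top (r := R 1 + 2)) ?_
    rintro _ ⟨_, ⟨n, rfl⟩, rfl⟩
    exact (μ n).lintegral_enorm_eq.trans_le (ENNReal.ofReal_le_ofReal (hmoment n))
  obtain ⟨q, k, hk, hq⟩ := exists_subseq_tendsto_of_isTightMeasureSet htight
  obtain ⟨μ', rfl⟩ := exists_toProb_eq_of_tendsto (μ := μ ∘ k) hq fun n => hmoment (k n)
  have hlim : Tendsto (μ ∘ k) atTop (𝓝 μ') :=
    tendsto_of_tendsto_toProb hq fun ε hε => ⟨R ε, hR ε hε, fun n => hμ (k n) ε hε⟩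
  refine ⟨μ', fun ε hε => ?_, k, hk, hlim⟩
  exact le_of_tendsto' (((P1.lipschitzWith_integral
    (lipschitzWith_weight (hR ε hε))).continuous.tendsto μ').comp hlim) fun n => hμ (k n) ε hε

/-- A curve as an element of the metric space `C([0,1]; 𝒫₁(ℝ^d))`. -/
def Curve.toContinuousMap (μ : Curve d) : C(unitInterval, P1 d) := ⟨μ.toFun, μ.continuous⟩

theorem curveTendsto_iff {μ : ℕ → Curve d} {μ' : Curve d} :
    CurveTendsto μ μ' ↔
      Tendsto (fun n => (μ n).toContinuousMap) atTop (𝓝 μ'.toContinuousMap) := by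
  rw [tendsto_iff_edist_tendsto_0]
  simp only [ContinuousMap.edist_eq_iSup]
  rfl

theorem CurveTendsto.apply {μ : ℕ → Curve d} {μ' : Curve d} (h : CurveTendsto μ μ')
    (t : unitInterval) : Tendsto (fun n => μ n t) atTop (𝓝 (μ' t)) :=
  ((continuous_eval_const t).tendsto _).comp (curveTendsto_iff.1 h)

theorem CurveTendsto.subseq {μ : ℕ → Curve d} {μ' : Curve d} (h : CurveTendsto μ μ') {k : ℕ → ℕ}
    (hk : StrictMono k) : CurveTendsto (fun n => μ (k n)) μ' :=
  curveTendsto_iff.2 ((curveTendsto_iff.1 h).comp hk.tendsto_atTop)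

theorem exists_subseq_curveTendsto (μ : ℕ → Curve d)
    (htail : ∀ ε > 0, ∃ R ≥ 0, ∀ n t, ∫ x, weight R x ∂(μ n t).toMeasure ≤ ε)
    (hequi : ∀ ε > 0, ∃ δ > 0, ∀ s t : unitInterval, dist s t < δ →
      ∀ n, dist (μ n s) (μ n t) < ε) :
    ∃ (μ' : Curve d) (k : ℕ → ℕ), StrictMono k ∧ CurveTendsto (fun n => μ (k n)) μ' := by
  choose! R hR hRμ using htail
  let b (n : ℕ) : BoundedContinuousFunction unitInterval (P1 d) :=
    BoundedContinuousFunction.mkOfCompact (μ n).toContinuousMap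
  have hcompact : IsCompact (closure (range b)) :=
    BoundedContinuousFunction.arzela_ascoli _ (isCompact_setOf_integral_weight_le hR) _
      (fun f t hf => by obtain ⟨n, rfl⟩ := hf; exact fun ε hε => hRμ ε hε n t)
      (Metric.uniformEquicontinuous_iff.2 fun ε hε =>
        let ⟨δ, hδ, hμ⟩ := hequi ε hε
        ⟨δ, hδ, fun s t hst ⟨_, n, hn⟩ => hn ▸ hμ s t hst n⟩).equicontinuous
  obtain ⟨g, -, k, hk, hg⟩ := hcompact.tendsto_subseq fun n => subset_closure (mem_range_self n)
  refine ⟨⟨g, fun t => tendsto_iff_edist_tendsto_0.1 (g.continuous.tendsto t)⟩, k, hk,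
    curveTendsto_iff.2 ?_⟩
  rw [tendsto_iff_dist_tendsto_zero] at hg ⊢
  exact hg

end Compactness

section WeakDerivative

variable {a b : ℝ}

theorem intervalIntegral_eq_integral_of_tsupport_subset {g : ℝ → ℝ} (hg : tsupport g ⊆ Ioo a b) :
    ∫ t in a..b, g t = ∫ t, g t :=
  intervalIntegral.integral_eq_integral_of_support_subset
    ((subset_tsupport g).trans (hg.trans Ioo_subset_Ioc_self))

theorem exists_deriv_eq_of_integral_eq_zero {ψ : ℝ → ℝ} (hψ : ContDiff ℝ (⊤ : ℕ∞) ψ)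
    (hψc : HasCompactSupport ψ) (hψs : tsupport ψ ⊆ Ioo a b) (h : ∫ x, ψ x = 0) :
    ∃ η : ℝ → ℝ, ContDiff ℝ (⊤ : ℕ∞) η ∧ HasCompactSupport η ∧ tsupport η ⊆ Ioo a b ∧
      deriv η = ψ := by
  rcases (tsupport ψ).eq_empty_or_nonempty with hempty | hne
  · have hψ₀ : ψ = 0 := tsupport_eq_empty_iff.1 hempty
    exact ⟨0, contDiff_const, HasCompactSupport.zero, by simp, by simp [hψ₀]⟩
  obtain ⟨c, hc, hleast⟩ := hψc.exists_isLeast hne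
  obtain ⟨d, hd, hgreatest⟩ := hψc.exists_isGreatest hne
  have hac := (hψs hc).1
  have hdb := (hψs hd).2
  have hzero {x : ℝ} (hx : x < c ∨ d < x) : ψ x = 0 := image_eq_zero_of_notMem_tsupport fun hmem =>
    hx.elim (hleast hmem).not_gt (hgreatest hmem).not_gt
  have hInt (x y : ℝ) : IntervalIntegrable ψ volume x y := hψ.continuous.intervalIntegrable x y
  let η : ℝ → ℝ := fun x => ∫ t in a..x, ψ t
  have hderiv (x : ℝ) : HasDerivAt η (ψ x) x := intervalIntegral.integral_hasDerivAt_right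
    (hInt a x) (hψ.continuous.stronglyMeasurableAtFilter _ _) hψ.continuous.continuousAt
  have hηψ : deriv η = ψ := funext fun x => (hderiv x).deriv
  have htotal : ∫ t in a..b, ψ t = 0 :=
    (intervalIntegral_eq_integral_of_tsupport_subset hψs).trans h
  have hsupp : Function.support η ⊆ Icc c d := fun x hx => by
    contrapose! hx
    rw [Function.mem_support, not_not]
    rcases not_and_or.1 hx with hxc | hxd
    · exact intervalIntegral.integral_zero_ae (ae_of_all _ fun t ht =>
        hzero (.inl (ht.2.trans_lt (max_lt hac (not_le.1 hxc)))))
    · refine (intervalIntegral.integral_add_adjacent_intervals (hInt a b) (hInt b x)).symm.trans ?_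
      rw [htotal, zero_add]
      exact intervalIntegral.integral_zero_ae (ae_of_all _ fun t ht =>
        hzero (.inr ((lt_min hdb (not_le.1 hxd)).trans ht.1)))
  exact ⟨η, contDiff_infty_iff_deriv.2 ⟨fun x => (hderiv x).differentiableAt, hηψ ▸ hψ⟩,
    .of_support_subset_isCompact isCompact_Icc hsupp,
    (closure_minimal hsupp isClosed_Icc).trans (Icc_subset_Ioo hac hdb), hηψ⟩

theorem exists_integral_mul_eq_mul_integral_of_integral_deriv_mul_eq_zero {f : ℝ → ℝ}
    (hab : a < b) (hf : ContinuousOn f (Icc a b))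
    (h : ∀ η : ℝ → ℝ, ContDiff ℝ (⊤ : ℕ∞) η → HasCompactSupport η → tsupport η ⊆ Ioo a b →
      ∫ t in a..b, deriv η t * f t = 0) :
    ∃ c, ∀ g : ℝ → ℝ, ContDiff ℝ (⊤ : ℕ∞) g → HasCompactSupport g → tsupport g ⊆ Ioo a b →
      ∫ t in a..b, g t * f t = (∫ t, g t) * c := by
  let bump : ContDiffBump ((a + b) / 2) := ⟨(b - a) / 8, (b - a) / 4, by linarith, by linarith⟩
  let χ : ℝ → ℝ := bump.normed volume
  have hχ : ContDiff ℝ (⊤ : ℕ∞) χ := bump.contDiff_normed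
  have hχs : tsupport χ ⊆ Ioo a b := by
    rw [bump.tsupport_normed_eq, Real.closedBall_eq_Icc]
    exact Icc_subset_Ioo (by dsimp only [bump]; linarith) (by dsimp only [bump]; linarith)
  have hmul {g : ℝ → ℝ} (hg : Continuous g) :
      IntervalIntegrable (fun t => g t * f t) volume a b :=
    (hg.continuousOn.mul (by rwa [uIcc_of_le hab.le])).intervalIntegrable
  refine ⟨∫ t in a..b, χ t * f t, fun g hg hgc hgs => ?_⟩
  obtain ⟨η, hη, hηc, hηs, hderiv⟩ := exists_deriv_eq_of_integral_eq_zero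
    (ψ := fun t => g t - (∫ x, g x) * χ t) (hg.sub (contDiff_const.mul hχ))
    (hgc.sub bump.hasCompactSupport_normed.mul_left)
    ((tsupport_sub _ _).trans (union_subset hgs (tsupport_mul_subset_right.trans hχs)))
    (by rw [integral_sub (hg.continuous.integrable_of_hasCompactSupport hgc)
      (bump.integrable_normed.const_mul _), integral_const_mul, bump.integral_normed, mul_one,
      sub_self])
  have hzero := h η hη hηc hηs
  simp only [hderiv, sub_mul, mul_assoc] at hzero
  rwa [intervalIntegral.integral_sub (hmul hg.continuous) ((hmul hχ.continuous).const_mul _),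
    intervalIntegral.integral_const_mul, sub_eq_zero] at hzero

/-- The du Bois-Reymond lemma. -/
theorem exists_eq_const_of_integral_deriv_mul_eq_zero {f : ℝ → ℝ} (hab : a < b)
    (hf : ContinuousOn f (Icc a b))
    (h : ∀ η : ℝ → ℝ, ContDiff ℝ (⊤ : ℕ∞) η → HasCompactSupport η → tsupport η ⊆ Ioo a b →
      ∫ t in a..b, deriv η t * f t = 0) :
    ∃ c, ∀ t ∈ Icc a b, f t = c := by
  obtain ⟨c, hc⟩ :=
    exists_integral_mul_eq_mul_integral_of_integral_deriv_mul_eq_zero hab hf h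
  have hae : ∀ᵐ t, t ∈ Ioo a b → f t - c = 0 :=
    isOpen_Ioo.ae_eq_zero_of_integral_contDiff_smul_eq_zero
      (((hf.mono Ioo_subset_Icc_self).sub continuousOn_const).locallyIntegrableOn
        measurableSet_Ioo) fun g hg hgc hgs => by
      rw [← intervalIntegral_eq_integral_of_tsupport_subset (g := fun t => g t • (f t - c))
        ((closure_mono (Function.support_smul_subset_left _ _)).trans hgs)]
      have hgf : IntervalIntegrable (fun t => g t * f t) volume a b :=
        (hg.continuous.continuousOn.mul (by rwa [uIcc_of_le hab.le])).intervalIntegrable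
      simp only [smul_eq_mul, mul_sub]
      rw [intervalIntegral.integral_sub hgf ((hg.continuous.intervalIntegrable _ _).mul_const c),
        intervalIntegral.integral_mul_const,
        intervalIntegral_eq_integral_of_tsupport_subset hgs, hc g hg hgc hgs, sub_self]
  have hrestrict : f =ᵐ[volume.restrict (Icc a b)] fun _ => c := by
    rw [← restrict_Ioo_eq_restrict_Icc]
    exact (ae_restrict_iff' measurableSet_Ioo).2 (hae.mono fun t h ht => sub_eq_zero.1 (h ht))
  exact ⟨c, Measure.eqOn_Icc_of_ae_eq volume hab.ne hrestrict hf continuousOn_const⟩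

theorem sub_eq_integral_of_weakDeriv {f k : ℝ → ℝ} (hab : a < b)
    (hf : ContinuousOn f (Icc a b)) (hk : IntervalIntegrable k volume a b)
    (h : ∀ η : ℝ → ℝ, ContDiff ℝ (⊤ : ℕ∞) η → HasCompactSupport η → tsupport η ⊆ Ioo a b →
      ∫ t in a..b, (deriv η t * f t + η t * k t) = 0)
    {s t : ℝ} (hs : s ∈ Icc a b) (ht : t ∈ Icc a b) : f t - f s = ∫ r in s..t, k r := by
  have hIcc := uIcc_of_le hab.le
  let K (x : ℝ) : ℝ := ∫ r in a..x, k r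
  have hK : AbsolutelyContinuousOnInterval K a b :=
    hk.absolutelyContinuousOnInterval_intervalIntegral left_mem_uIcc
  have hKderiv : ∀ᵐ x, x ∈ uIoc a b → deriv K x = k x := by
    filter_upwards [hk.ae_hasDerivAt_integral] with x hx hxab
    exact (hx (uIoc_subset_uIcc hxab) a left_mem_uIcc).deriv
  obtain ⟨c, hc⟩ := exists_eq_const_of_integral_deriv_mul_eq_zero (f := fun x => f x - K x) hab
    (hf.sub (hIcc ▸ hK.continuousOn)) fun η hη hηc hηs => by
      have hη₁ := hη.continuous_deriv (by simp)
      have hvanish {x : ℝ} (hx : x ∉ Ioo a b) : η x = 0 :=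
        image_eq_zero_of_notMem_tsupport fun hmem => hx (hηs hmem)
      have hparts := ((hη.of_le (by simp)).contDiffOn.absolutelyContinuousOnInterval
        ).integral_mul_deriv_eq_deriv_mul hK
      rw [hvanish left_notMem_Ioo, hvanish right_notMem_Ioo, zero_mul, zero_mul, sub_self,
        zero_sub, intervalIntegral.integral_congr_ae (hKderiv.mono fun x hx hxab =>
          congrArg (η x * ·) (hx hxab))] at hparts
      have hweak := h η hη hηc hηs
      have hfint : IntervalIntegrable (fun x => deriv η x * f x) volume a b :=
        (hη₁.continuousOn.mul (hIcc ▸ hf)).intervalIntegrable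
      rw [intervalIntegral.integral_add hfint (hk.continuousOn_mul hη.continuous.continuousOn),
        hparts] at hweak
      simp only [mul_sub]
      rw [intervalIntegral.integral_sub hfint
        (g := fun x => deriv η x * K x) (hη₁.continuousOn.mul hK.continuousOn).intervalIntegrable]
      linarith
  have hsub : K t - K s = ∫ r in s..t, k r := intervalIntegral.integral_interval_sub_left
    (hk.mono_set (uIcc_subset_uIcc_left (hIcc ▸ ht)))
    (hk.mono_set (uIcc_subset_uIcc_left (hIcc ▸ hs)))
  linarith [hc s hs, hc t ht]

end WeakDerivative

section UnitInterval

theorem setIntegral_unitInterval (k : unitInterval → ℝ) {s t : unitInterval} (hst : s ≤ t) :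
    ∫ r in Ioc s t, k r = ∫ r in (s : ℝ)..t, k (projIcc 0 1 zero_le_one r) := by
  rw [intervalIntegral.integral_of_le (show (s : ℝ) ≤ t from hst),
    ← Measure.restrict_restrict_of_subset
      ((Ioc_subset_Icc_self).trans (Icc_subset_Icc s.2.1 t.2.2)),
    ← unitInterval.measurePreserving_coe.setIntegral_preimage_emb
      unitInterval.measurableEmbedding_coe]
  simp only [projIcc_val]
  rfl

theorem integral_unitInterval (k : unitInterval → ℝ) :
    ∫ r, k r = ∫ r in (0 : ℝ)..1, k (projIcc 0 1 zero_le_one r) := by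
  rw [intervalIntegral.integral_of_le zero_le_one, ← integral_Icc_eq_integral_Ioc,
    ← unitInterval.measurePreserving_coe.integral_comp unitInterval.measurableEmbedding_coe]
  simp only [projIcc_val]

theorem intervalIntegrable_unitInterval {k : unitInterval → ℝ} (hk : Integrable k) :
    IntervalIntegrable (fun r => k (projIcc 0 1 zero_le_one r)) volume 0 1 := by
  rw [intervalIntegrable_iff_integrableOn_Icc_of_le zero_le_one, IntegrableOn,
    ← unitInterval.measurePreserving_coe.integrable_comp_emb unitInterval.measurableEmbedding_coe]
  simpa only [Function.comp_def, projIcc_val] using hk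

theorem sub_eq_setIntegral_of_weakDeriv {f k : unitInterval → ℝ} (hf : Continuous f)
    (hk : Integrable k)
    (h : ∀ η : ℝ → ℝ, ContDiff ℝ (⊤ : ℕ∞) η → HasCompactSupport η → tsupport η ⊆ Ioo 0 1 →
      ∫ t : unitInterval, (deriv η t * f t + η t * k t) = 0)
    {s t : unitInterval} (hst : s ≤ t) : f t - f s = ∫ r in Ioc s t, k r := by
  have hFTC := sub_eq_integral_of_weakDeriv zero_lt_one
    (hf.comp (continuous_projIcc (h := zero_le_one))).continuousOn
    (intervalIntegrable_unitInterval hk) (fun η hη hηc hηs => ?_) s.2 t.2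
  · simpa only [setIntegral_unitInterval k hst, Function.comp_apply, projIcc_val] using hFTC
  · refine (Eq.trans ?_ (integral_unitInterval _).symm).trans (h η hη hηc hηs)
    refine intervalIntegral.integral_congr fun t ht => ?_
    rw [uIcc_of_le zero_le_one] at ht
    simp only [Function.comp_apply, projIcc_of_mem zero_le_one ht]

end UnitInterval

section SpaceTime

variable {d : ℕ}

/-- A `W₁`-continuous curve as a Markov kernel from time to space. -/
def Curve.kernel (μ : Curve d) : ProbabilityTheory.Kernel unitInterval (E d) :=
  ⟨fun t => (μ t).toMeasure, μ.measurable_toMeasure⟩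

instance (μ : Curve d) : ProbabilityTheory.IsMarkovKernel μ.kernel :=
  ⟨fun t => (μ t).isProbabilityMeasure⟩

theorem Curve.spaceTime_eq_map_compProd (μ : Curve d) :
    μ.spaceTime = ((volume : Measure unitInterval).compProd μ.kernel).map
      (MeasurableEquiv.prodComm (α := unitInterval) (β := E d)) :=
  Measure.ext_of_lintegral _ fun f hf => by
    rw [μ.lintegral_spaceTime hf, lintegral_map_equiv]
    exact (Measure.lintegral_compProd (κ := μ.kernel)
      (f := fun z : unitInterval × E d => f (z.2, z.1)) (hf.comp measurable_swap)).symm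

instance (μ : Curve d) : IsProbabilityMeasure μ.spaceTime := by
  rw [μ.spaceTime_eq_map_compProd]
  exact Measure.isProbabilityMeasure_map (MeasurableEquiv.measurable _).aemeasurable

variable {H : Type*} [NormedAddCommGroup H] {f : X d → H}

theorem Curve.integrable_spaceTime_iff (μ : Curve d) :
    Integrable f μ.spaceTime ↔ Integrable (fun z : unitInterval × E d => f (z.2, z.1))
      ((volume : Measure unitInterval).compProd μ.kernel) := by
  rw [μ.spaceTime_eq_map_compProd, integrable_map_equiv]
  rfl

theorem Curve.integrable_of_lipschitz (μ : Curve d) {K : NNReal} {f : E d → ℝ}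
    (hf : LipschitzWith K f) : Integrable (fun z : X d => f z.1) μ.spaceTime := by
  have hnorm : Continuous fun ρ : P1 d => ∫ y, ‖f y‖ ∂ρ.toMeasure :=
    (P1.lipschitzWith_integral (lipschitzWith_one_norm.comp hf)).continuous
  rw [μ.integrable_spaceTime_iff]
  exact (Measure.integrable_compProd_iff
    (hf.continuous.comp continuous_snd).aestronglyMeasurable).2
    ⟨ae_of_all _ fun t => (μ t).integrable_of_lipschitz hf,
      (hnorm.comp μ.continuous).integrable_of_hasCompactSupport
        (HasCompactSupport.of_compactSpace _)⟩

theorem Curve.ae_integrable (μ : Curve d) (hf : Integrable f μ.spaceTime) :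
    ∀ᵐ t : unitInterval, Integrable (fun y => f (y, t)) (μ t).toMeasure :=
  ((Measure.integrable_compProd_iff (μ.integrable_spaceTime_iff.1 hf).1).1
    (μ.integrable_spaceTime_iff.1 hf)).1

variable [NormedSpace ℝ H]

theorem Curve.integrable_integral (μ : Curve d) (hf : Integrable f μ.spaceTime) :
    Integrable fun t : unitInterval => ∫ y, f (y, t) ∂(μ t).toMeasure :=
  (μ.integrable_spaceTime_iff.1 hf).integral_compProd

theorem Curve.integral_spaceTime (μ : Curve d) (hf : Integrable f μ.spaceTime) :
    ∫ z, f z ∂μ.spaceTime = ∫ t : unitInterval, ∫ y, f (y, t) ∂(μ t).toMeasure := by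
  rw [μ.spaceTime_eq_map_compProd, integral_map_equiv]
  exact Measure.integral_compProd (μ.integrable_spaceTime_iff.1 hf)

theorem Curve.setIntegral_spaceTime (μ : Curve d) (hf : Integrable f μ.spaceTime)
    {s : Set unitInterval} (hs : MeasurableSet s) :
    ∫ z in Prod.snd ⁻¹' s, f z ∂μ.spaceTime = ∫ t in s, ∫ y, f (y, t) ∂(μ t).toMeasure := by
  have hs' : MeasurableSet (Prod.snd ⁻¹' s : Set (X d)) := measurable_snd hs
  rw [← integral_indicator hs', μ.integral_spaceTime (hf.indicator hs'), ← integral_indicator hs]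
  congr with t
  by_cases ht : t ∈ s <;> simp [indicator, ht]

end SpaceTime

section Density

variable {Ω V W Y : Type*} [MeasurableSpace Ω] [NormedAddCommGroup V] [NormedSpace ℝ V]
  [NormedAddCommGroup W] [NormedSpace ℝ W] [CompleteSpace W] [NormedAddCommGroup Y]
  [NormedSpace ℝ Y] [CompleteSpace Y] {m : Measure Ω} {u : Ω → W} (B : V →L[ℝ] W →L[ℝ] Y)

omit [MeasurableSpace Ω] [CompleteSpace W] [CompleteSpace Y] in
theorem norm_apply_apply_le {f : Ω → V} {C : ℝ} (hC : ∀ z, ‖f z‖ ≤ C) (z : Ω) :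
    ‖B (f z) (u z)‖ ≤ ‖B‖ * C * ‖u z‖ :=
  (B.le_opNorm₂ _ _).trans (by gcongr; exact hC z)

omit [CompleteSpace W] [CompleteSpace Y] in
theorem integrable_apply_apply_of_bound (hu : Integrable u m) {f : Ω → V}
    (hf : AEStronglyMeasurable f m) {C : ℝ} (hC : ∀ z, ‖f z‖ ≤ C) :
    Integrable (fun z => B (f z) (u z)) m :=
  (hu.norm.const_mul (‖B‖ * C)).mono' (B.aestronglyMeasurable_comp₂ hf hu.1)
    (ae_of_all _ (norm_apply_apply_le B hC))

theorem integral_withDensityᵥ_indicator (hu : Integrable u m)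
    [IsFiniteMeasure (m.withDensityᵥ u).variation] {s : Set Ω} (hs : MeasurableSet s) (c : V) :
    (m.withDensityᵥ u).integral (s.indicator fun _ => c) B
      = ∫ z, B (s.indicator (fun _ => c) z) (u z) ∂m := by
  have hind : (fun z => B (s.indicator (fun _ => c) z) (u z)) = s.indicator fun z => B c (u z) := by
    ext z
    by_cases hz : z ∈ s <;> simp [hz]
  rw [hind, integral_indicator hs, ContinuousLinearMap.integral_comp_comm _ hu.integrableOn,
    ← withDensityᵥ_apply hu hs, VectorMeasure.integral_indicator_const _ hs]

theorem integral_withDensityᵥ_simpleFunc (hu : Integrable u m)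
    [IsFiniteMeasure (m.withDensityᵥ u).variation] (g : SimpleFunc Ω V) :
    (m.withDensityᵥ u).integral g B = ∫ z, B (g z) (u z) ∂m := by
  induction g using SimpleFunc.induction with
  | const c hs =>
    simp only [SimpleFunc.coe_piecewise, SimpleFunc.coe_const, Function.const_zero,
      piecewise_eq_indicator]
    exact integral_withDensityᵥ_indicator B hu hs c
  | add _ hf hg =>
    rename_i f g _
    have hInt (g : SimpleFunc Ω V) : Integrable (fun z => B (g z) (u z)) m :=
      integrable_apply_apply_of_bound B hu g.stronglyMeasurable.aestronglyMeasurable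
        g.exists_forall_norm_le.choose_spec
    rw [SimpleFunc.coe_add, VectorMeasure.integral_add f.integrable_of_isFiniteMeasure
      g.integrable_of_isFiniteMeasure, hf, hg, ← integral_add (hInt f) (hInt g)]
    simp only [Pi.add_apply, map_add, add_apply]

theorem integral_withDensityᵥ (hu : Integrable u m) {f : Ω → V} (hf : StronglyMeasurable f)
    {C : ℝ} (hC : ∀ z, ‖f z‖ ≤ C) :
    (m.withDensityᵥ u).integral f B = ∫ z, B (f z) (u z) ∂m := by
  have : IsFiniteMeasure (m.withDensityᵥ u).variation := by
    rw [Measure.variation_withDensityᵥ hu]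
    exact isFiniteMeasure_withDensity hu.2.ne
  let g := hf.approxBounded |C|
  have hg (n : ℕ) (z : Ω) : ‖g n z‖ ≤ |C| := hf.norm_approxBounded_le (abs_nonneg C) n z
  have hlim (z : Ω) : Tendsto (fun n => g n z) atTop (𝓝 (f z)) :=
    hf.tendsto_approxBounded_of_norm_le ((hC z).trans (le_abs_self C))
  have hleft : Tendsto (fun n => (m.withDensityᵥ u).integral (g n) B) atTop
      (𝓝 ((m.withDensityᵥ u).integral f B)) :=
    VectorMeasure.tendsto_integral_of_dominated_convergence (fun _ => |C|)
      (fun n => (g n).stronglyMeasurable.aestronglyMeasurable) (integrable_const _)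
      (fun n => ae_of_all _ (hg n)) (ae_of_all _ hlim)
  have hright : Tendsto (fun n => ∫ z, B (g n z) (u z) ∂m) atTop (𝓝 (∫ z, B (f z) (u z) ∂m)) :=
    tendsto_integral_of_dominated_convergence (fun z => ‖B‖ * |C| * ‖u z‖)
      (fun n => B.aestronglyMeasurable_comp₂ (g n).stronglyMeasurable.aestronglyMeasurable hu.1)
      (hu.norm.const_mul _) (fun n => ae_of_all _ (norm_apply_apply_le B (hg n)))
      (ae_of_all _ fun z => ((B.flip (u z)).continuous.tendsto _).comp (hlim z))
  exact tendsto_nhds_unique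
    (hleft.congr fun n => integral_withDensityᵥ_simpleFunc B hu (g n)) hright

theorem dotIntegral_withDensityᵥ {d : ℕ} {U : Submodule ℝ (E d)} {m : Measure (X d)}
    {u : X d → U} (hu : Integrable u m) {f : X d → E d} (hf : StronglyMeasurable f) {C : ℝ}
    (hC : ∀ z, ‖f z‖ ≤ C) :
    dotIntegral (m.withDensityᵥ u) f = ∫ z, ⟪f z, (u z : E d)⟫ ∂m :=
  integral_withDensityᵥ (pairing U) hu hf hC

end Density

variable {d : ℕ}

section TestFunction

variable {φ : E d × ℝ → ℝ} (hφ : ContDiff ℝ (⊤ : ℕ∞) φ)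
include hφ

theorem deriv_snd_eq_fderiv (y : E d) (t : ℝ) :
    deriv (fun s => φ (y, s)) t = fderiv ℝ φ (y, t) (0, 1) :=
  ((hφ.differentiable (by simp) (y, t)).hasFDerivAt.comp_hasDerivAt t
    ((hasDerivAt_const t y).prodMk (hasDerivAt_id t))).deriv

theorem gradient_fst_eq (y : E d) (t : ℝ) :
    gradient (fun x => φ (x, t)) y = (InnerProductSpace.toDual ℝ (E d)).symm
      ((fderiv ℝ φ (y, t)).comp (ContinuousLinearMap.inl ℝ (E d) ℝ)) :=
  congrArg _ ((hφ.differentiable (by simp) (y, t)).hasFDerivAt.comp y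
    (hasFDerivAt_prodMk_left y t)).fderiv

theorem continuous_deriv_snd :
    Continuous fun z : X d => deriv (fun s => φ (z.1, s)) (z.2 : ℝ) := by
  simp only [deriv_snd_eq_fderiv hφ]
  have := hφ.continuous_fderiv (by simp)
  fun_prop

theorem continuous_gradient_fst :
    Continuous fun z : X d => gradient (fun x => φ (x, (z.2 : ℝ))) z.1 := by
  simp only [gradient_fst_eq hφ]
  have := hφ.continuous_fderiv (by simp)
  exact (LinearIsometryEquiv.continuous _).comp (by fun_prop)

variable (hc : HasCompactSupport φ)
include hc

theorem exists_norm_deriv_snd_le :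
    ∃ C, ∀ z : X d, ‖deriv (fun s => φ (z.1, s)) (z.2 : ℝ)‖ ≤ C := by
  obtain ⟨C, hC⟩ := (hc.fderiv ℝ).exists_bound_of_continuous (hφ.continuous_fderiv (by simp))
  refine ⟨C, fun z => ?_⟩
  rw [deriv_snd_eq_fderiv hφ]
  simpa using (ContinuousLinearMap.le_opNorm _ (0, 1)).trans
    (mul_le_mul_of_nonneg_right (hC (z.1, z.2)) (norm_nonneg ((0 : E d), (1 : ℝ))))

theorem exists_bracket_mul_norm_gradient_fst_le :
    ∃ C, ∀ z : X d, bracket z.1 * ‖gradient (fun x => φ (x, (z.2 : ℝ))) z.1‖ ≤ C := by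
  have hbracket : Continuous fun w : E d × ℝ => bracket w.1 :=
    contDiff_bracket.continuous.comp continuous_fst
  obtain ⟨C, hC⟩ := ((hc.fderiv ℝ).smul_left (f := fun w => bracket w.1)).exists_bound_of_continuous
    (hbracket.smul (hφ.continuous_fderiv (by simp)))
  refine ⟨C, fun z => le_trans ?_ (hC (z.1, z.2))⟩
  rw [gradient_fst_eq hφ, LinearIsometryEquiv.norm_map, Pi.smul_apply', norm_smul,
    Real.norm_of_nonneg (bracket_pos z.1).le]
  exact mul_le_mul_of_nonneg_left ((ContinuousLinearMap.opNorm_comp_le _ _).trans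
    (mul_le_of_le_one_right (norm_nonneg _) (ContinuousLinearMap.norm_inl_le_one ℝ (E d) ℝ)))
    (bracket_pos z.1).le

theorem exists_norm_gradient_fst_le :
    ∃ C, ∀ z : X d, ‖gradient (fun x => φ (x, (z.2 : ℝ))) z.1‖ ≤ C :=
  let ⟨C, hC⟩ := exists_bracket_mul_norm_gradient_fst_le hφ hc
  ⟨C, fun z => (le_mul_of_one_le_left (norm_nonneg _) (one_le_bracket z.1)).trans (hC z)⟩

variable {m : Measure (X d)} [IsFiniteMeasure m]

theorem integrable_deriv_snd :
    Integrable (fun z : X d => deriv (fun s => φ (z.1, s)) (z.2 : ℝ)) m :=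
  let ⟨C, hC⟩ := exists_norm_deriv_snd_le hφ hc
  .of_bound (continuous_deriv_snd hφ).aestronglyMeasurable C (ae_of_all _ hC)

omit [IsFiniteMeasure m] in
theorem integrable_inner_gradient_fst {V : X d → E d} (hV : Integrable V m) :
    Integrable (fun z : X d => ⟪gradient (fun x => φ (x, (z.2 : ℝ))) z.1, V z⟫) m :=
  let ⟨_, hC⟩ := exists_norm_gradient_fst_le hφ hc
  integrable_apply_apply_of_bound (innerSL ℝ) hV (continuous_gradient_fst hφ).aestronglyMeasurable
    hC

theorem integral_deriv_add_inner_add {V W : X d → E d} (hV : Integrable V m)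
    (hW : Integrable W m) :
    ∫ z : X d, (deriv (fun s => φ (z.1, s)) (z.2 : ℝ)
      + ⟪gradient (fun x => φ (x, (z.2 : ℝ))) z.1, V z + W z⟫) ∂m
    = ∫ z : X d, deriv (fun s => φ (z.1, s)) (z.2 : ℝ) ∂m
      + (∫ z : X d, ⟪gradient (fun x => φ (x, (z.2 : ℝ))) z.1, V z⟫ ∂m
      + ∫ z : X d, ⟪gradient (fun x => φ (x, (z.2 : ℝ))) z.1, W z⟫ ∂m) := by
  have hgV := integrable_inner_gradient_fst hφ hc hV
  have hgW := integrable_inner_gradient_fst hφ hc hW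
  rw [← integral_add hgV hgW,
    ← integral_add (integrable_deriv_snd hφ hc) (hgV.fun_add hgW)]
  simp only [inner_add_right]

end TestFunction

section Transport

/-- The curve `μ` solves `∂_t μ_t + ∇ · (V μ_t) = 0` in the sense of distributions, for a
velocity field `V ∈ L¹(dμ_t ⊗ dt)`. -/
structure TransportedBy (μ : Curve d) (V : X d → E d) : Prop where
  integrable : Integrable V μ.spaceTime
  integral_eq_zero : ∀ φ : E d × ℝ → ℝ, ContDiff ℝ (⊤ : ℕ∞) φ → HasCompactSupport φ →
    tsupport φ ⊆ univ ×ˢ Ioo 0 1 →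
    ∫ z, (deriv (fun s : ℝ => φ (z.1, s)) (z.2 : ℝ)
      + ⟪gradient (fun x => φ (x, (z.2 : ℝ))) z.1, V z⟫) ∂μ.spaceTime = 0

variable {F : E d → P1 d → E d} {c : NNReal}

theorem norm_le_mul_bracket (hgrowth : ∀ y ρ, ‖F y ρ‖ ≤ c * (1 + ‖y‖ + ρ.moment)) {M : ℝ}
    {ρ : P1 d} (hM : ρ.moment ≤ M) (y : E d) : ‖F y ρ‖ ≤ c * (2 + M) * bracket y := by
  have hM0 : 0 ≤ M := (integral_nonneg fun _ => norm_nonneg _ : 0 ≤ ρ.moment).trans hM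
  calc ‖F y ρ‖ ≤ c * (1 + ‖y‖ + ρ.moment) := hgrowth y ρ
    _ ≤ c * (bracket y + bracket y + M * bracket y) := by
        gcongr
        exacts [one_le_bracket y, norm_le_bracket y,
          hM.trans (le_mul_of_one_le_right hM0 (one_le_bracket y))]
    _ = c * (2 + M) * bracket y := by ring

theorem continuous_along_curve {H : Type*} [TopologicalSpace H] {f : E d → P1 d → H}
    (hf : Continuous (Function.uncurry f)) (μ : Curve d) :
    Continuous fun z : X d => f z.1 (μ z.2) :=
  hf.comp (continuous_fst.prodMk (μ.continuous.comp continuous_snd))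

theorem integrable_drift (hF : Continuous (Function.uncurry F))
    (hgrowth : ∀ y ρ, ‖F y ρ‖ ≤ c * (1 + ‖y‖ + ρ.moment)) (μ : Curve d) :
    Integrable (fun z : X d => F z.1 (μ z.2)) μ.spaceTime :=
  let ⟨_, hM⟩ := μ.exists_moment_le
  ((μ.integrable_of_lipschitz lipschitzWith_bracket).const_mul _).mono'
    (continuous_along_curve hF μ).aestronglyMeasurable
    (ae_of_all _ fun z => norm_le_mul_bracket hgrowth (hM z.2) z.1)

theorem solvesContinuityEquation_iff (hF : Continuous (Function.uncurry F))
    (hgrowth : ∀ y ρ, ‖F y ρ‖ ≤ c * (1 + ‖y‖ + ρ.moment)) {U : Submodule ℝ (E d)} {μ : Curve d}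
    {ν : VectorMeasure (X d) U} {u : X d → U} (hu : IsDensity ν μ u) :
    SolvesContinuityEquation F μ ν ↔ TransportedBy μ fun z => F z.1 (μ z.2) + (u z : E d) := by
  have hFi := integrable_drift hF hgrowth μ
  have hui : Integrable (fun z => (u z : E d)) μ.spaceTime := U.subtypeL.integrable_comp hu.1
  have heq (φ : E d × ℝ → ℝ) (hφ : ContDiff ℝ (⊤ : ℕ∞) φ) (hc : HasCompactSupport φ) :
      (∫ t : unitInterval, ∫ y, (deriv (fun s : ℝ => φ (y, s)) t
        + ⟪gradient (fun x => φ (x, (t : ℝ))) y, F y (μ t)⟫) ∂(μ t).toMeasure)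
      + dotIntegral ν (fun z => gradient (fun x => φ (x, (z.2 : ℝ))) z.1)
      = ∫ z, (deriv (fun s : ℝ => φ (z.1, s)) (z.2 : ℝ)
      + ⟪gradient (fun x => φ (x, (z.2 : ℝ))) z.1, F z.1 (μ z.2) + u z⟫) ∂μ.spaceTime := by
    obtain ⟨D, hD⟩ := exists_norm_gradient_fst_le hφ hc
    have hderiv := integrable_deriv_snd hφ hc (m := μ.spaceTime)
    have hgrad := integrable_inner_gradient_fst hφ hc hFi
    rw [hu.2, dotIntegral_withDensityᵥ hu.1 (continuous_gradient_fst hφ).stronglyMeasurable hD,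
      integral_deriv_add_inner_add hφ hc hFi hui, ← add_assoc, ← integral_add hderiv hgrad,
      μ.integral_spaceTime (hderiv.fun_add hgrad)]
  exact ⟨fun h => ⟨hFi.add hui, fun φ hφ hc hs => (heq φ hφ hc).symm.trans (h φ hφ hc hs)⟩,
    fun h φ hφ hc hs => (heq φ hφ hc).trans (h.2 φ hφ hc hs)⟩

variable {μ : Curve d} {V : X d → E d}

theorem TransportedBy.integral_mul_eq_zero (hV : TransportedBy μ V) {η : ℝ → ℝ}
    (hη : ContDiff ℝ (⊤ : ℕ∞) η) (hηc : HasCompactSupport η) (hηs : tsupport η ⊆ Ioo 0 1)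
    {ζ : E d → ℝ} (hζ : ContDiff ℝ (⊤ : ℕ∞) ζ) (hζc : HasCompactSupport ζ) :
    ∫ z, (deriv η (z.2 : ℝ) * ζ z.1 + η (z.2 : ℝ) * fderiv ℝ ζ z.1 (V z)) ∂μ.spaceTime = 0 := by
  have hsub : Function.support (fun z : E d × ℝ => η z.2 * ζ z.1) ⊆ tsupport ζ ×ˢ tsupport η :=
    fun z hz =>
      ⟨subset_tsupport _ (right_ne_zero_of_mul hz), subset_tsupport _ (left_ne_zero_of_mul hz)⟩
  have hzero := hV.integral_eq_zero (fun z => η z.2 * ζ z.1)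
    ((hη.comp contDiff_snd).mul (hζ.comp contDiff_fst))
    (HasCompactSupport.of_support_subset_isCompact (hζc.prod hηc) hsub)
    ((closure_minimal hsub ((isClosed_tsupport ζ).prod (isClosed_tsupport η))).trans
      fun z hz => ⟨mem_univ _, hηs hz.2⟩)
  refine (integral_congr_ae (ae_of_all _ fun z => ?_)).trans hzero
  simp only [inner_gradient_left]
  rw [fderiv_const_mul (hζ.differentiable (by simp) z.1),
    deriv_mul_const (hη.differentiable (by simp) _)]
  rfl

theorem TransportedBy.integrable_fderiv_apply (hV : TransportedBy μ V) {ζ : E d → ℝ}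
    (hζ : ContDiff ℝ (⊤ : ℕ∞) ζ) {C : ℝ} (hC : ∀ y, ‖fderiv ℝ ζ y‖ ≤ C) :
    Integrable (fun z => fderiv ℝ ζ z.1 (V z)) μ.spaceTime :=
  integrable_apply_apply_of_bound (.id ℝ (E d →L[ℝ] ℝ)) hV.integrable
    ((hζ.continuous_fderiv (by simp)).comp continuous_fst).aestronglyMeasurable
    fun z : X d => hC z.1

theorem TransportedBy.integral_sub_of_hasCompactSupport (hV : TransportedBy μ V) {ζ : E d → ℝ}
    (hζ : ContDiff ℝ (⊤ : ℕ∞) ζ) (hc : HasCompactSupport ζ) {s t : unitInterval} (hst : s ≤ t) :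
    ∫ y, ζ y ∂(μ t).toMeasure - ∫ y, ζ y ∂(μ s).toMeasure
      = ∫ z in Prod.snd ⁻¹' Ioc s t, fderiv ℝ ζ z.1 (V z) ∂μ.spaceTime := by
  obtain ⟨K, hK⟩ := hζ.lipschitzWith_of_hasCompactSupport hc (by simp)
  have hi := hV.integrable_fderiv_apply hζ fun y => norm_fderiv_le_of_lipschitz ℝ hK
  have hmul {θ : ℝ → ℝ} (hθ : Continuous θ) (hθc : HasCompactSupport θ) {f : X d → ℝ}
      (hf : Integrable f μ.spaceTime) : Integrable (fun z => θ (z.2 : ℝ) * f z) μ.spaceTime :=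
    let ⟨_, hB⟩ := hθc.exists_bound_of_continuous hθ
    hf.bdd_mul (by fun_prop) (ae_of_all _ fun z => hB z.2)
  rw [μ.setIntegral_spaceTime hi measurableSet_Ioc]
  refine sub_eq_setIntegral_of_weakDeriv (f := fun t => ∫ y, ζ y ∂(μ t).toMeasure)
    ((P1.lipschitzWith_integral hK).continuous.comp μ.continuous) (μ.integrable_integral hi)
    (fun η hη hηc hηs => ?_) hst
  have hderiv := hmul (hη.continuous_deriv (by simp)) hηc.deriv (μ.integrable_of_lipschitz hK)
  have hfderiv := hmul hη.continuous hηc hi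
  rw [← hV.integral_mul_eq_zero hη hηc hηs hζ hc, μ.integral_spaceTime (hderiv.fun_add hfderiv)]
  refine integral_congr_ae ?_
  filter_upwards [μ.ae_integrable hfderiv] with t ht
  rw [integral_add (((μ t).integrable_of_lipschitz hK).const_mul _) ht, integral_const_mul,
    integral_const_mul]

end Transport

section Approximation

variable {V : Type*} [NormedAddCommGroup V] [InnerProductSpace ℝ V] [FiniteDimensional ℝ V]

theorem exists_cutoff : ∃ (χ : ℕ → V → ℝ) (B : ℝ), (∀ n, ContDiff ℝ (⊤ : ℕ∞) (χ n)) ∧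
    (∀ n, HasCompactSupport (χ n)) ∧ (∀ n y, |χ n y| ≤ 1) ∧
    (∀ n y, (1 + ‖y‖) * ‖fderiv ℝ (χ n) y‖ ≤ B) ∧ ∀ y, ∀ᶠ n in atTop, χ n =ᶠ[𝓝 y] 1 := by
  let χ : ContDiffBump (0 : V) := ⟨1, 2, one_pos, one_lt_two⟩
  have hχ : ContDiff ℝ (⊤ : ℕ∞) χ := χ.contDiff
  obtain ⟨B, hB⟩ := (χ.hasCompactSupport.fderiv ℝ).exists_bound_of_continuous
    (hχ.continuous_fderiv (by simp))
  have hB0 : 0 ≤ B := (norm_nonneg _).trans (hB 0)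
  let a (n : ℕ) : ℝ := 1 / ((n : ℝ) + 1)
  have ha (n : ℕ) : 0 < a n := Nat.one_div_pos_of_nat
  have ha1 (n : ℕ) : a n ≤ 1 := by simpa [a] using Nat.one_div_le_one_div n.zero_le (α := ℝ)
  refine ⟨fun n y => χ (a n • y), 3 * B, fun n => hχ.comp (contDiff_const_smul _),
    fun n => χ.hasCompactSupport.comp_smul (ha n).ne',
    fun n y => (abs_of_nonneg χ.nonneg).trans_le χ.le_one, fun n y => ?_, fun y => ?_⟩
  · rw [fderiv_comp_smul (f := χ) (a n), norm_smul, Real.norm_of_nonneg (ha n).le, ← mul_assoc]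
    by_cases hy : fderiv ℝ χ (a n • y) = 0
    · rw [hy, norm_zero, mul_zero]
      positivity
    have hsupp : a n * ‖y‖ ≤ 2 := by
      simpa [χ.tsupport_eq, norm_smul, abs_of_pos (ha n)] using support_fderiv_subset ℝ hy
    exact mul_le_mul (by linarith [ha1 n]) (hB _) (norm_nonneg _) (by norm_num)
  · have hlim : Tendsto (fun n => a n • y) atTop (𝓝 0) := by
      simpa only [zero_smul] using (tendsto_one_div_add_atTop_nhds_zero_nat (𝕜 := ℝ)).smul_const y
    filter_upwards [hlim.eventually (χ.eventuallyEq_one.eventually_nhds)] with n hn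
    exact (continuous_const_smul (a n)).continuousAt.eventually hn

theorem exists_hasCompactSupport_approx {ζ : V → ℝ} (hζ : ContDiff ℝ (⊤ : ℕ∞) ζ) {K : NNReal}
    (hK : LipschitzWith K ζ) :
    ∃ (ζn : ℕ → V → ℝ) (C : ℝ), (∀ n, ContDiff ℝ (⊤ : ℕ∞) (ζn n)) ∧
      (∀ n, HasCompactSupport (ζn n)) ∧ (∀ n y, ‖fderiv ℝ (ζn n) y‖ ≤ C) ∧
      (∀ n y, |ζn n y| ≤ |ζ y|) ∧ ∀ y, ∀ᶠ n in atTop, ζn n =ᶠ[𝓝 y] ζ := by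
  obtain ⟨χ, B, hχ, hcompact, hle, hfderiv, hone⟩ := exists_cutoff (V := V)
  have hgrowth (y : V) : |ζ y| ≤ (|ζ 0| + K) * (1 + ‖y‖) := by
    have hlip := hK.norm_sub_le y 0
    rw [sub_zero, Real.norm_eq_abs] at hlip
    nlinarith [abs_sub_abs_le_abs_sub (ζ y) (ζ 0), abs_nonneg (ζ 0), norm_nonneg y, K.2]
  refine ⟨fun n y => χ n y * ζ y, K + (|ζ 0| + K) * B, fun n => (hχ n).mul hζ,
    fun n => (hcompact n).mul_right, fun n y => ?_, fun n y => ?_, fun y => ?_⟩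
  · rw [fderiv_fun_mul ((hχ n).differentiable (by simp) y) (hζ.differentiable (by simp) y)]
    refine (norm_add_le _ _).trans (add_le_add ?_ ?_)
    · rw [norm_smul]
      exact (mul_le_of_le_one_left (norm_nonneg _) (hle n y)).trans
        (norm_fderiv_le_of_lipschitz ℝ hK)
    · rw [norm_smul, Real.norm_eq_abs]
      calc |ζ y| * ‖fderiv ℝ (χ n) y‖ ≤ (|ζ 0| + K) * (1 + ‖y‖) * ‖fderiv ℝ (χ n) y‖ := by
            gcongr; exact hgrowth y
        _ ≤ (|ζ 0| + K) * B := by rw [mul_assoc]; gcongr; exact hfderiv n y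
  · simpa only [abs_mul] using mul_le_of_le_one_left (abs_nonneg (ζ y)) (hle n y)
  · filter_upwards [hone y] with n hn
    filter_upwards [hn] with x hx
    rw [hx, Pi.one_apply, one_mul]

variable [MeasurableSpace V] [BorelSpace V]

theorem exists_contDiff_lipschitzWith_approx {f : V → ℝ} {K : NNReal} (hf : LipschitzWith K f)
    {ε : ℝ} (hε : 0 < ε) : ∃ g : V → ℝ, ContDiff ℝ (⊤ : ℕ∞) g ∧ LipschitzWith K g ∧
      ∀ x, |g x - f x| ≤ K * ε := by
  let φ : ContDiffBump (0 : V) := ⟨ε / 2, ε, half_pos hε, half_lt_self hε⟩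
  have hcont : Continuous (φ.normed volume) := φ.continuous_normed
  have hcc : HasCompactSupport (φ.normed volume) := φ.hasCompactSupport_normed
  have hInt (x : V) : Integrable fun t => φ.normed volume t * f (x - t) :=
    (hcont.mul (hf.continuous.comp (by fun_prop))).integrable_of_hasCompactSupport hcc.mul_right
  refine ⟨convolution (φ.normed volume) f (ContinuousLinearMap.lsmul ℝ ℝ) volume,
    hcc.contDiff_convolution_left _ φ.contDiff_normed hf.continuous.locallyIntegrable,
    LipschitzWith.of_dist_le_mul fun x y => ?_, fun x => ?_⟩
  · simp only [convolution, ContinuousLinearMap.lsmul_apply, smul_eq_mul]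
    rw [dist_eq_norm, ← integral_sub (hInt x) (hInt y)]
    calc ‖∫ t, φ.normed volume t * f (x - t) - φ.normed volume t * f (y - t)‖
        ≤ ∫ t, φ.normed volume t * (K * dist x y) :=
          norm_integral_le_of_norm_le ((hcont.integrable_of_hasCompactSupport hcc).mul_const _)
            (ae_of_all _ fun t => by
              rw [← mul_sub, norm_mul, Real.norm_of_nonneg (φ.nonneg_normed t)]
              refine mul_le_mul_of_nonneg_left ?_ (φ.nonneg_normed t)
              simpa [Real.dist_eq] using hf.dist_le_mul (x - t) (y - t))
      _ = K * dist x y := by rw [integral_mul_const, φ.integral_normed, one_mul]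
  · exact φ.dist_normed_convolution_le hf.continuous.aestronglyMeasurable fun y hy =>
      (hf.dist_le_mul y x).trans (by gcongr; exact (Metric.mem_ball.1 hy).le)

end Approximation

section Transport

variable {d : ℕ} {μ : Curve d} {V : X d → E d}

theorem TransportedBy.integral_sub (hV : TransportedBy μ V) {ζ : E d → ℝ}
    (hζ : ContDiff ℝ (⊤ : ℕ∞) ζ) {K : NNReal} (hK : LipschitzWith K ζ)
    {s t : unitInterval} (hst : s ≤ t) :
    ∫ y, ζ y ∂(μ t).toMeasure - ∫ y, ζ y ∂(μ s).toMeasure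
      = ∫ z in Prod.snd ⁻¹' Ioc s t, fderiv ℝ ζ z.1 (V z) ∂μ.spaceTime := by
  obtain ⟨ζn, C, hsmooth, hcompact, hfderiv, hle, heq⟩ := exists_hasCompactSupport_approx hζ hK
  have hleft (r : unitInterval) : Tendsto (fun n => ∫ y, ζn n y ∂(μ r).toMeasure) atTop
      (𝓝 (∫ y, ζ y ∂(μ r).toMeasure)) :=
    tendsto_integral_of_dominated_convergence (fun y => |ζ y|)
      (fun n => (hsmooth n).continuous.aestronglyMeasurable) ((μ r).integrable_of_lipschitz hK).abs
      (fun n => ae_of_all _ (hle n)) (ae_of_all _ fun y =>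
        tendsto_const_nhds.congr' ((heq y).mono fun n hn => hn.self_of_nhds.symm))
  have hright : Tendsto
      (fun n => ∫ z in Prod.snd ⁻¹' Ioc s t, fderiv ℝ (ζn n) z.1 (V z) ∂μ.spaceTime)
      atTop (𝓝 (∫ z in Prod.snd ⁻¹' Ioc s t, fderiv ℝ ζ z.1 (V z) ∂μ.spaceTime)) :=
    tendsto_integral_of_dominated_convergence (fun z => C * ‖V z‖)
      (fun n => (hV.integrable_fderiv_apply (hsmooth n) (hfderiv n)).integrableOn.1)
      (hV.integrable.norm.const_mul C).integrableOn
      (fun n => ae_of_all _ fun z => ContinuousLinearMap.le_of_opNorm_le _ (hfderiv n z.1) _)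
      (ae_of_all _ fun z => tendsto_const_nhds.congr' ((heq z.1).mono fun n hn => by
        simp only [hn.fderiv_eq]))
  exact tendsto_nhds_unique (((hleft t).sub (hleft s)).congr fun n =>
    hV.integral_sub_of_hasCompactSupport (hsmooth n) (hcompact n) hst) hright

theorem TransportedBy.W1_le (hV : TransportedBy μ V) {s t : unitInterval} (hst : s ≤ t) :
    W1 (μ s) (μ t) ≤ ENNReal.ofReal (∫ z in Prod.snd ⁻¹' Ioc s t, ‖V z‖ ∂μ.spaceTime) := by
  refine W1_le_of_forall _ _ fun f hf => le_of_forall_pos_le_add fun ε hε => ?_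
  obtain ⟨g, hg, hgl, hgf⟩ := exists_contDiff_lipschitzWith_approx hf (half_pos hε)
  have happrox (ρ : P1 d) : |∫ y, g y ∂ρ.toMeasure - ∫ y, f y ∂ρ.toMeasure| ≤ ε / 2 := by
    rw [← MeasureTheory.integral_sub (ρ.integrable_of_lipschitz hgl)
      (ρ.integrable_of_lipschitz hf), ← Real.norm_eq_abs]
    simpa using norm_integral_le_of_norm_le_const (μ := ρ.toMeasure)
      (f := fun y => g y - f y) (ae_of_all _ hgf)
  have htransport : |∫ z in Prod.snd ⁻¹' Ioc s t, fderiv ℝ g z.1 (V z) ∂μ.spaceTime|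
      ≤ ∫ z in Prod.snd ⁻¹' Ioc s t, ‖V z‖ ∂μ.spaceTime :=
    norm_integral_le_of_norm_le (f := fun z => fderiv ℝ g z.1 (V z))
      hV.integrable.norm.integrableOn (ae_of_all _ fun z => by
        simpa using ContinuousLinearMap.le_of_opNorm_le _ (norm_fderiv_le_of_lipschitz ℝ hgl) (V z))
  rw [← hV.integral_sub hg hgl hst] at htransport
  linarith [abs_le.1 (happrox (μ s)), abs_le.1 (happrox (μ t)), abs_le.1 htransport]

theorem TransportedBy.isAC (hV : TransportedBy μ V) : μ.IsAC := by
  refine ⟨_, intervalIntegrable_unitInterval (μ.integrable_integral hV.integrable.norm),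
    fun s t hst => ?_⟩
  rw [← setIntegral_unitInterval (fun t => ∫ y, ‖V (y, t)‖ ∂(μ t).toMeasure) hst,
    ← μ.setIntegral_spaceTime hV.integrable.norm measurableSet_Ioc]
  exact hV.W1_le hst

end Transport

theorem le_mul_exp_of_le_add_integral {A : unitInterval → ℝ} (hA : Continuous A) {b c : ℝ}
    (hc : 0 ≤ c) (hb : 0 ≤ b) (h : ∀ t, A t ≤ b + c * ∫ r in Ioc 0 t, A r) (t : unitInterval) :
    A t ≤ b * Real.exp c := by
  let a : ℝ → ℝ := IccExtend zero_le_one A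
  have ha : Continuous a := hA.Icc_extend'
  let f (x : ℝ) : ℝ := b + c * ∫ r in (0 : ℝ)..x, a r
  have hderiv (x : ℝ) : HasDerivAt f (c * a x) x :=
    ((ha.integral_hasStrictDerivAt 0 x).hasDerivAt.const_mul c).const_add b
  have hle (t : unitInterval) : A t ≤ f t := by
    have := h t
    rwa [setIntegral_unitInterval A t.2.1] at this
  have hgronwall : f t ≤ gronwallBound b c 0 (t - 0) := by
    refine le_gronwallBound_of_liminf_deriv_right_le (f' := fun x => c * a x)
      (fun x _ => (hderiv x).continuousAt.continuousWithinAt)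
      (fun x _ r hr => (hderiv x).hasDerivWithinAt.liminf_right_slope_le hr) (by simp [f])
      (fun x hx => ?_) t t.2
    have := hle ⟨x, hx.1, hx.2.le⟩
    rw [add_zero, show a x = A ⟨x, hx.1, hx.2.le⟩ from IccExtend_of_mem _ _ _]
    exact mul_le_mul_of_nonneg_left this hc
  rw [gronwallBound_ε0] at hgronwall
  refine (hle t).trans (hgronwall.trans ?_)
  gcongr
  exact mul_le_of_le_one_right hc (by simpa using t.2.2)

section Bracket

variable {d : ℕ}

theorem P1.moment_le_integral_bracket (ρ : P1 d) : ρ.moment ≤ ∫ y, bracket y ∂ρ.toMeasure :=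
  integral_mono ρ.integrable_norm (ρ.integrable_of_lipschitz lipschitzWith_bracket) norm_le_bracket

theorem P1.one_le_integral_bracket (ρ : P1 d) : 1 ≤ ∫ y, bracket y ∂ρ.toMeasure := by
  simpa using integral_mono (integrable_const 1) (ρ.integrable_of_lipschitz lipschitzWith_bracket)
    one_le_bracket

theorem P1.integral_norm_drift_le {F : E d → P1 d → E d} {c : NNReal}
    (hgrowth : ∀ y ρ, ‖F y ρ‖ ≤ c * (1 + ‖y‖ + ρ.moment)) (ρ : P1 d) :
    ∫ y, ‖F y ρ‖ ∂ρ.toMeasure ≤ 3 * c * ∫ y, bracket y ∂ρ.toMeasure := by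
  have hi : Integrable (fun y => 1 + ‖y‖ + ρ.moment) ρ.toMeasure :=
    ((integrable_const 1).add ρ.integrable_norm).add (integrable_const _)
  calc ∫ y, ‖F y ρ‖ ∂ρ.toMeasure ≤ ∫ y, c * (1 + ‖y‖ + ρ.moment) ∂ρ.toMeasure :=
        integral_mono_of_nonneg (ae_of_all _ fun _ => norm_nonneg _) (hi.const_mul _)
          (ae_of_all _ fun y => hgrowth y ρ)
    _ = c * (1 + ρ.moment + ρ.moment) := by
        rw [integral_const_mul, integral_add ((integrable_const 1).fun_add ρ.integrable_norm)
          (integrable_const _), integral_add (integrable_const 1) ρ.integrable_norm]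
        simp [P1.moment]
    _ ≤ 3 * c * ∫ y, bracket y ∂ρ.toMeasure := by
        nlinarith [ρ.moment_le_integral_bracket, ρ.one_le_integral_bracket, c.2]

theorem Curve.measureReal_slab (μ : Curve d) {s t : unitInterval} (hst : s ≤ t) :
    μ.spaceTime.real (Prod.snd ⁻¹' Ioc s t) = t - s := by
  have hslab := μ.setIntegral_spaceTime (integrable_const (1 : ℝ))
    (measurableSet_Ioc (a := s) (b := t))
  simpa only [integral_const (μ := (μ _).toMeasure), probReal_univ, one_smul,
    setIntegral_unitInterval (fun _ => (1 : ℝ)) hst, intervalIntegral.integral_const,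
    integral_const, smul_eq_mul, mul_one, measureReal_restrict_apply_univ] using hslab

theorem Curve.setIntegral_bracket_le (μ : Curve d) {M : ℝ}
    (hM : ∀ t, ∫ y, bracket y ∂(μ t).toMeasure ≤ M) {s t : unitInterval} (hst : s ≤ t) :
    ∫ z in Prod.snd ⁻¹' Ioc s t, bracket z.1 ∂μ.spaceTime ≤ M * (t - s) := by
  have hi : Integrable (fun z : X d => bracket z.1) μ.spaceTime :=
    μ.integrable_of_lipschitz lipschitzWith_bracket
  calc ∫ z in Prod.snd ⁻¹' Ioc s t, bracket z.1 ∂μ.spaceTime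
      = ∫ r in Ioc s t, ∫ y, bracket y ∂(μ r).toMeasure :=
        μ.setIntegral_spaceTime hi measurableSet_Ioc
    _ ≤ ∫ _ in Ioc s t, M :=
        integral_mono (μ.integrable_integral hi).integrableOn (integrable_const M) hM
    _ = M * (t - s) := by
        rw [setIntegral_unitInterval (fun _ => M) hst, intervalIntegral.integral_const, smul_eq_mul,
          mul_comm]

theorem Curve.setIntegral_norm_drift_le {F : E d → P1 d → E d} {c : NNReal}
    (hF : Continuous (Function.uncurry F))
    (hgrowth : ∀ y ρ, ‖F y ρ‖ ≤ c * (1 + ‖y‖ + ρ.moment)) (μ : Curve d) (t : unitInterval) :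
    ∫ z in Prod.snd ⁻¹' Ioc 0 t, ‖F z.1 (μ z.2)‖ ∂μ.spaceTime
      ≤ 3 * c * ∫ r in Ioc 0 t, ∫ y, bracket y ∂(μ r).toMeasure := by
  have hFi := (integrable_drift hF hgrowth μ).norm
  rw [μ.setIntegral_spaceTime hFi measurableSet_Ioc, ← integral_const_mul]
  exact integral_mono (μ.integrable_integral hFi).integrableOn
    ((μ.integrable_integral (μ.integrable_of_lipschitz lipschitzWith_bracket)).const_mul
      _).integrableOn fun r => (μ r).integral_norm_drift_le hgrowth

theorem continuous_norm_fderiv_weight {R : ℝ} (hR : 0 ≤ R) :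
    Continuous fun z : X d => ‖fderiv ℝ (weight R) z.1‖ :=
  (((contDiff_weight hR).continuous_fderiv (by simp)).comp continuous_fst).norm

theorem Curve.setIntegral_norm_fderiv_weight_le (μ : Curve d) {M : ℝ}
    (hM : ∀ t, ∫ y, bracket y ∂(μ t).toMeasure ≤ M) {R : ℝ} (hR : 0 < R) (t : unitInterval) :
    ∫ z in Prod.snd ⁻¹' Ioc 0 t, ‖fderiv ℝ (weight R) z.1‖ ∂μ.spaceTime ≤ 2 * M / R := by
  have hM0 : 0 ≤ M := zero_le_one.trans ((μ 0).one_le_integral_bracket.trans (hM 0))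
  calc ∫ z in Prod.snd ⁻¹' Ioc 0 t, ‖fderiv ℝ (weight R) z.1‖ ∂μ.spaceTime
      ≤ ∫ z in Prod.snd ⁻¹' Ioc 0 t, 2 / R * bracket z.1 ∂μ.spaceTime :=
        integral_mono_of_nonneg (ae_of_all _ fun _ => norm_nonneg _)
          ((μ.integrable_of_lipschitz lipschitzWith_bracket).const_mul _).integrableOn
          (ae_of_all _ fun z => norm_fderiv_weight_le_mul_bracket hR z.1)
    _ ≤ 2 / R * (M * (t - 0)) := by
        rw [integral_const_mul]
        gcongr
        exact μ.setIntegral_bracket_le hM t.2.1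
    _ ≤ 2 / R * (M * 1) := by
        gcongr
        linarith [t.2.2]
    _ = 2 * M / R := by ring

end Bracket

section Controlled

variable {d : ℕ} {U : Submodule ℝ (E d)}

/-- Superlinear growth of a nonnegative function, in the form in which it bounds a control by its
cost. -/
def Superlinear {V : Type*} [Norm V] (ψ : V → ℝ) : Prop :=
  ∀ ε > 0, ∃ C : NNReal, ∀ x, ‖x‖ ≤ C + ε * ψ x

theorem IsControlCost.superlinear {ψ : U → ℝ} (hψ : IsControlCost U ψ) : Superlinear ψ := by
  obtain ⟨φ, -, -, -, -, -, hlim, -, C, -, hb⟩ := hψ.exists_moderating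
  intro ε hε
  obtain ⟨r, hr⟩ := eventually_atTop.1 (hlim.eventually_ge_atTop ε⁻¹)
  refine ⟨.mk (ε + max r 1) (by positivity), fun x => ?_⟩
  rw [NNReal.coe_mk]
  rcases le_total ‖x‖ (max r 1) with hx | hx
  · linarith [mul_nonneg hε.le (hψ.nonneg x)]
  · have hφx := hr ‖x‖ ((le_max_left _ _).trans hx)
    rw [le_div_iff₀ (one_pos.trans_le ((le_max_right _ _).trans hx)), inv_mul_le_iff₀ hε] at hφx
    have := mul_le_mul_of_nonneg_left (hb x).1 hε.le
    linarith [le_max_right r 1]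

/-- The curve `μ` starts at `m₀` and solves the continuity equation with control `u`, whose cost
is at most `B`. -/
structure Controlled (F : E d → P1 d → E d) (ψ : U → ℝ) (m₀ : P1 d) (B : NNReal) (μ : Curve d)
    (u : X d → U) : Prop where
  integrable : Integrable u μ.spaceTime
  transportedBy : TransportedBy μ fun z => F z.1 (μ z.2) + (u z : E d)
  initial : μ 0 = m₀
  integrable_cost : Integrable (fun z => ψ (u z)) μ.spaceTime
  cost_le : ∫ z, ψ (u z) ∂μ.spaceTime ≤ B

variable {F : E d → P1 d → E d} {c : NNReal} {ψ : U → ℝ}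

namespace Controlled

variable {m₀ : P1 d} {B : NNReal} {μ : Curve d} {u : X d → U} (h : Controlled F ψ m₀ B μ u)
include h

theorem lintegral_cost_le (hψ0 : ∀ x, 0 ≤ ψ x) :
    ∫⁻ z, ENNReal.ofReal (ψ (u z)) ∂μ.spaceTime ≤ B := by
  rw [← ofReal_integral_eq_lintegral_ofReal h.integrable_cost (ae_of_all _ fun _ => hψ0 _),
    ← ENNReal.ofReal_coe_nnreal]
  exact ENNReal.ofReal_le_ofReal h.cost_le

theorem setIntegral_mul_norm_le (hψ0 : ∀ x, 0 ≤ ψ x) {C ε : ℝ} (hε : 0 ≤ ε)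
    (hC : ∀ x, ‖x‖ ≤ C + ε * ψ x) {q : X d → ℝ} (hq : Continuous q) (hq0 : ∀ z, 0 ≤ q z) {a : ℝ}
    (hqa : ∀ z, q z ≤ a) (s : Set (X d)) :
    ∫ z in s, q z * ‖u z‖ ∂μ.spaceTime ≤ C * ∫ z in s, q z ∂μ.spaceTime + a * ε * B := by
  have ha : 0 ≤ a := (hq0 (0, 0)).trans (hqa _)
  have hqi : Integrable q μ.spaceTime := .of_bound hq.aestronglyMeasurable a
    (ae_of_all _ fun z => by simpa [abs_of_nonneg (hq0 z)] using hqa z)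
  calc ∫ z in s, q z * ‖u z‖ ∂μ.spaceTime
      ≤ ∫ z in s, (C * q z + a * ε * ψ (u z)) ∂μ.spaceTime := by
        refine integral_mono_of_nonneg (ae_of_all _ fun z => mul_nonneg (hq0 z) (norm_nonneg _))
          ((hqi.const_mul C).add (h.integrable_cost.const_mul _)).integrableOn
          (ae_of_all _ fun z => ?_)
        calc q z * ‖u z‖ ≤ q z * (C + ε * ψ (u z)) := mul_le_mul_of_nonneg_left (hC _) (hq0 z)
          _ = C * q z + q z * (ε * ψ (u z)) := by ring
          _ ≤ C * q z + a * (ε * ψ (u z)) := by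
              gcongr
              exacts [mul_nonneg hε (hψ0 _), hqa z]
          _ = C * q z + a * ε * ψ (u z) := by ring
    _ = C * ∫ z in s, q z ∂μ.spaceTime + a * ε * ∫ z in s, ψ (u z) ∂μ.spaceTime := by
        rw [integral_add (hqi.const_mul C).integrableOn
          (h.integrable_cost.const_mul _).integrableOn, integral_const_mul, integral_const_mul]
    _ ≤ C * ∫ z in s, q z ∂μ.spaceTime + a * ε * B := by
        gcongr
        exact (setIntegral_le_integral h.integrable_cost (ae_of_all _ fun _ => hψ0 _)).trans
          h.cost_le

theorem integral_weight_le (hF : Continuous (Function.uncurry F))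
    (hgrowth : ∀ y ρ, ‖F y ρ‖ ≤ c * (1 + ‖y‖ + ρ.moment)) {R : ℝ} (hR : 0 ≤ R)
    (t : unitInterval) :
    ∫ y, weight R y ∂(μ t).toMeasure ≤ ∫ y, weight R y ∂m₀.toMeasure +
      ∫ z in Prod.snd ⁻¹' Ioc 0 t, ‖fderiv ℝ (weight R) z.1‖ * ‖F z.1 (μ z.2)‖ ∂μ.spaceTime +
      ∫ z in Prod.snd ⁻¹' Ioc 0 t, ‖fderiv ℝ (weight R) z.1‖ * ‖u z‖ ∂μ.spaceTime := by
  have htransport := h.transportedBy.integral_sub (contDiff_weight hR) (lipschitzWith_weight hR)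
    (s := 0) (t := t) t.2.1
  have hmul {H : Type} [NormedAddCommGroup H] {f : X d → H} (hf : Integrable f μ.spaceTime) :
      Integrable (fun z => ‖fderiv ℝ (weight R) z.1‖ * ‖f z‖) μ.spaceTime :=
    hf.norm.bdd_mul (c := 2) (continuous_norm_fderiv_weight hR).aestronglyMeasurable
      (ae_of_all _ fun z => by simpa using norm_fderiv_weight_le_two hR z.1)
  have hFi := hmul (integrable_drift hF hgrowth μ)
  rw [h.initial, sub_eq_iff_eq_add'] at htransport
  rw [add_assoc, ← integral_add hFi.integrableOn (hmul h.integrable).integrableOn, htransport]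
  refine add_le_add le_rfl (integral_mono
    (h.transportedBy.integrable_fderiv_apply (contDiff_weight hR)
      (norm_fderiv_weight_le_two hR)).integrableOn
    (hFi.add (hmul h.integrable)).integrableOn fun z => ?_)
  refine (Real.le_norm_self _).trans ((ContinuousLinearMap.le_opNorm _ _).trans ?_)
  rw [← mul_add]
  exact mul_le_mul_of_nonneg_left (norm_add_le _ _) (norm_nonneg _)

theorem integral_weight_le_add (hF : Continuous (Function.uncurry F))
    (hgrowth : ∀ y ρ, ‖F y ρ‖ ≤ c * (1 + ‖y‖ + ρ.moment)) (hψ0 : ∀ x, 0 ≤ ψ x) {M : ℝ}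
    (hM : ∀ t, ∫ y, bracket y ∂(μ t).toMeasure ≤ M) {C : NNReal}
    {ε : ℝ} (hε : 0 ≤ ε) (hC : ∀ x, ‖x‖ ≤ C + ε * ψ x) {R : ℝ} (hR : 0 < R) (t : unitInterval) :
    ∫ y, weight R y ∂(μ t).toMeasure ≤ (∫ y, weight R y ∂m₀.toMeasure + C * (2 * M / R) + 2 * ε * B)
      + 2 * (c * (2 + M)) * ∫ r in Ioc 0 t, ∫ y, weight R y ∂(μ r).toMeasure := by
  have hM0 : 0 ≤ M := zero_le_one.trans ((μ 0).one_le_integral_bracket.trans (hM 0))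
  have hwi : Integrable (fun z : X d => weight R z.1) μ.spaceTime :=
    μ.integrable_of_lipschitz (lipschitzWith_weight hR.le)
  have hdrift : ∫ z in Prod.snd ⁻¹' Ioc 0 t,
      ‖fderiv ℝ (weight R) z.1‖ * ‖F z.1 (μ z.2)‖ ∂μ.spaceTime
      ≤ 2 * (c * (2 + M)) * ∫ r in Ioc 0 t, ∫ y, weight R y ∂(μ r).toMeasure := by
    rw [← μ.setIntegral_spaceTime (f := fun z => weight R z.1) hwi measurableSet_Ioc,
      ← integral_const_mul]
    refine integral_mono_of_nonneg (ae_of_all _ fun z : X d => by positivity)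
      (hwi.const_mul _).integrableOn (ae_of_all _ fun z => ?_)
    calc ‖fderiv ℝ (weight R) z.1‖ * ‖F z.1 (μ z.2)‖
        ≤ ‖fderiv ℝ (weight R) z.1‖ * (c * (2 + M) * bracket z.1) := by
          gcongr
          exact norm_le_mul_bracket hgrowth ((μ z.2).moment_le_integral_bracket.trans (hM _)) _
      _ = c * (2 + M) * (bracket z.1 * ‖fderiv ℝ (weight R) z.1‖) := by ring
      _ ≤ c * (2 + M) * (2 * weight R z.1) :=
          mul_le_mul_of_nonneg_left (bracket_mul_norm_fderiv_weight_le hR.le z.1) (by positivity)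
      _ = 2 * (c * (2 + M)) * weight R z.1 := by ring
  have hcontrol := h.setIntegral_mul_norm_le hψ0 hε hC (continuous_norm_fderiv_weight hR.le)
    (fun _ => norm_nonneg _) (fun z => norm_fderiv_weight_le_two hR.le z.1) (Prod.snd ⁻¹' Ioc 0 t)
  have := mul_le_mul_of_nonneg_left (μ.setIntegral_norm_fderiv_weight_le hM hR t) C.coe_nonneg
  linarith [h.integral_weight_le hF hgrowth hR.le t]

theorem setIntegral_norm_velocity_le (hgrowth : ∀ y ρ, ‖F y ρ‖ ≤ c * (1 + ‖y‖ + ρ.moment))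
    (hψ0 : ∀ x, 0 ≤ ψ x) {M : ℝ} (hM : ∀ t, ∫ y, bracket y ∂(μ t).toMeasure ≤ M) {C : NNReal}
    {ε : ℝ} (hε : 0 ≤ ε) (hC : ∀ x, ‖x‖ ≤ C + ε * ψ x) {s t : unitInterval} (hst : s ≤ t) :
    ∫ z in Prod.snd ⁻¹' Ioc s t, ‖F z.1 (μ z.2) + (u z : E d)‖ ∂μ.spaceTime
      ≤ (c * (2 + M) * M + C) * (t - s) + ε * B := by
  have hM0 : 0 ≤ M := zero_le_one.trans ((μ 0).one_le_integral_bracket.trans (hM 0))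
  have hbi : Integrable (fun z : X d => c * (2 + M) * bracket z.1) μ.spaceTime :=
    (μ.integrable_of_lipschitz lipschitzWith_bracket).const_mul _
  have hcontrol : ∫ z in Prod.snd ⁻¹' Ioc s t, ‖u z‖ ∂μ.spaceTime ≤ C * (t - s) + ε * B := by
    simpa [μ.measureReal_slab hst] using h.setIntegral_mul_norm_le hψ0 hε hC (q := fun _ => 1)
      continuous_const (fun _ => zero_le_one) (fun _ => le_rfl) (Prod.snd ⁻¹' Ioc s t)
  have hdrift : ∫ z in Prod.snd ⁻¹' Ioc s t, c * (2 + M) * bracket z.1 ∂μ.spaceTime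
      ≤ c * (2 + M) * (M * (t - s)) := by
    rw [integral_const_mul]
    gcongr
    exact μ.setIntegral_bracket_le hM hst
  calc ∫ z in Prod.snd ⁻¹' Ioc s t, ‖F z.1 (μ z.2) + (u z : E d)‖ ∂μ.spaceTime
      ≤ ∫ z in Prod.snd ⁻¹' Ioc s t, (c * (2 + M) * bracket z.1 + ‖u z‖) ∂μ.spaceTime := by
        refine integral_mono h.transportedBy.integrable.norm.integrableOn
          (hbi.add h.integrable.norm).integrableOn fun z => (norm_add_le _ _).trans
          (add_le_add_left (norm_le_mul_bracket hgrowth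
            ((μ z.2).moment_le_integral_bracket.trans (hM _)) _) _)
    _ = ∫ z in Prod.snd ⁻¹' Ioc s t, c * (2 + M) * bracket z.1 ∂μ.spaceTime
        + ∫ z in Prod.snd ⁻¹' Ioc s t, ‖u z‖ ∂μ.spaceTime :=
      integral_add hbi.integrableOn h.integrable.norm.integrableOn
    _ ≤ (c * (2 + M) * M + C) * (t - s) + ε * B := by linarith

end Controlled

variable (hF : Continuous (Function.uncurry F))
  (hgrowth : ∀ y ρ, ‖F y ρ‖ ≤ c * (1 + ‖y‖ + ρ.moment))
  (hψ0 : ∀ x, 0 ≤ ψ x) (hψ : Superlinear ψ) (m₀ : P1 d) (B : NNReal)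
include hF hgrowth hψ0 hψ

theorem exists_moment_bound : ∃ M, 0 ≤ M ∧ ∀ μ u, Controlled F ψ m₀ B μ u →
    ∀ t, ∫ y, bracket y ∂(μ t).toMeasure ≤ M := by
  obtain ⟨C, hC⟩ := hψ 1 one_pos
  have hb : 0 ≤ ∫ y, bracket y ∂m₀.toMeasure + (C * 2 + 2 * 1 * B) := by
    have := m₀.one_le_integral_bracket
    positivity
  refine ⟨(∫ y, bracket y ∂m₀.toMeasure + (C * 2 + 2 * 1 * B)) * Real.exp (2 * (3 * c)),
    by positivity, fun μ u h t => ?_⟩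
  refine le_mul_exp_of_le_add_integral (A := fun t => ∫ y, bracket y ∂(μ t).toMeasure)
    ((P1.lipschitzWith_integral lipschitzWith_bracket).continuous.comp μ.continuous)
    (by positivity) hb (fun t => ?_) t
  have hw (z : X d) : ‖fderiv ℝ (weight 0) z.1‖ ≤ 2 := norm_fderiv_weight_le_two le_rfl z.1
  have hwc := continuous_norm_fderiv_weight (d := d) le_rfl
  have hwt : ∫ z in Prod.snd ⁻¹' Ioc 0 t, ‖fderiv ℝ (weight 0) z.1‖ ∂μ.spaceTime ≤ 2 :=
    (Real.le_norm_self _).trans ((norm_setIntegral_le_of_norm_le_const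
      (measure_lt_top _ _) fun z _ => by simpa using hw z).trans
      (mul_le_of_le_one_right zero_le_two measureReal_le_one))
  have hcontrol := h.setIntegral_mul_norm_le hψ0 zero_le_one hC hwc (fun _ => norm_nonneg _) hw
    (Prod.snd ⁻¹' Ioc 0 t)
  have hdrift : ∫ z in Prod.snd ⁻¹' Ioc 0 t,
      ‖fderiv ℝ (weight 0) z.1‖ * ‖F z.1 (μ z.2)‖ ∂μ.spaceTime
      ≤ 2 * ∫ z in Prod.snd ⁻¹' Ioc 0 t, ‖F z.1 (μ z.2)‖ ∂μ.spaceTime := by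
    rw [← integral_const_mul]
    exact integral_mono_of_nonneg (ae_of_all _ fun z => by positivity)
      ((integrable_drift hF hgrowth μ).norm.const_mul 2).integrableOn
      (ae_of_all _ fun z => mul_le_mul_of_nonneg_right (hw z) (norm_nonneg _))
  have hweight := h.integral_weight_le hF hgrowth le_rfl t
  simp only [weight_zero] at hweight
  linarith [μ.setIntegral_norm_drift_le hF hgrowth t, mul_le_mul_of_nonneg_left hwt C.coe_nonneg]

theorem exists_tail_bound {δ : ℝ} (hδ : 0 < δ) : ∃ R ≥ 0, ∀ μ u, Controlled F ψ m₀ B μ u →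
    ∀ t, ∫ y, weight R y ∂(μ t).toMeasure ≤ δ := by
  obtain ⟨M, hM0, hM⟩ := exists_moment_bound hF hgrowth hψ0 hψ m₀ B
  let e := Real.exp (2 * (c * (2 + M)))
  have he : 0 < e := Real.exp_pos _
  obtain ⟨C, hC⟩ := hψ (δ / e / (4 * (B + 1))) (by positivity)
  have hcost : 2 * (δ / e / (4 * (B + 1))) * B ≤ δ / e / 2 := by
    have : (B : ℝ) / (B + 1) ≤ 1 := div_le_one_of_le₀ (by linarith) (by positivity)
    calc 2 * (δ / e / (4 * (B + 1))) * B = δ / e / 2 * (B / (B + 1)) := by field_simp; norm_num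
      _ ≤ δ / e / 2 := mul_le_of_le_one_right (by positivity) this
  have hlim : Tendsto (fun R => ∫ y, weight R y ∂m₀.toMeasure + C * (2 * M / R)) atTop (𝓝 0) := by
    simpa using (tendsto_integral_weight m₀).add
      ((tendsto_id.const_div_atTop (2 * M)).const_mul (C : ℝ))
  obtain ⟨R, hR, hR0⟩ := ((hlim.eventually (gt_mem_nhds (by positivity : 0 < δ / e / 2))).and
    (eventually_gt_atTop 0)).exists
  refine ⟨R, hR0.le, fun μ u h t => ?_⟩
  have hinit : 0 ≤ ∫ y, weight R y ∂m₀.toMeasure :=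
    integral_nonneg fun y => weight_nonneg hR0.le y
  refine (le_mul_exp_of_le_add_integral (A := fun t => ∫ y, weight R y ∂(μ t).toMeasure)
    ((P1.lipschitzWith_integral (lipschitzWith_weight hR0.le)).continuous.comp μ.continuous)
    (by positivity) (by positivity) (h.integral_weight_le_add hF hgrowth hψ0 (hM μ u h)
      (by positivity) hC hR0) t).trans ?_
  rw [← le_div_iff₀ he]
  linarith

theorem exists_modulus {ε : ℝ} (hε : 0 < ε) : ∃ δ > 0, ∀ μ u, Controlled F ψ m₀ B μ u →
    ∀ s t : unitInterval, dist s t < δ → dist (μ s) (μ t) < ε := by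
  obtain ⟨M, hM0, hM⟩ := exists_moment_bound hF hgrowth hψ0 hψ m₀ B
  obtain ⟨C, hC⟩ := hψ (ε / (2 * (B + 1))) (by positivity)
  refine ⟨ε / (2 * (c * (2 + M) * M + C + 1)), by positivity, fun μ u h s t hst => ?_⟩
  wlog hle : s ≤ t generalizing s t
  · rw [dist_comm]
    exact this t s (by rwa [dist_comm]) (le_of_not_ge hle)
  have hvelocity := h.setIntegral_norm_velocity_le hgrowth hψ0 (hM μ u h) (by positivity) hC hle
  have hcost : ε / (2 * (B + 1)) * B ≤ ε / 2 := by
    rw [div_mul_eq_mul_div, div_le_div_iff₀ (by positivity) two_pos]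
    nlinarith [B.coe_nonneg]
  have hts : (0 : ℝ) ≤ t - s := sub_nonneg.2 hle
  have htime : (c * (2 + M) * M + C) * ((t : ℝ) - s) < ε / 2 := by
    rw [Subtype.dist_eq, dist_comm, Real.dist_eq, abs_of_nonneg hts,
      lt_div_iff₀ (by positivity)] at hst
    linarith
  refine (ENNReal.toReal_le_of_le_ofReal (integral_nonneg fun _ => norm_nonneg _)
    (h.transportedBy.W1_le hle)).trans_lt ?_
  linarith

end Controlled

section UniformTail

variable {Ω : Type*} [MeasurableSpace Ω]

theorem integrable_of_lintegral_tail_ne_top {m : Measure Ω} [IsFiniteMeasure m] {f : Ω → ℝ}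
    (hf : AEStronglyMeasurable f m) {D : NNReal}
    (h : ∫⁻ x, ENNReal.ofReal (|f x| - D) ∂m ≠ ∞) : Integrable f m := by
  refine ⟨hf, ?_⟩
  calc ∫⁻ x, ‖f x‖ₑ ∂m ≤ ∫⁻ x, (ENNReal.ofReal (|f x| - D) + D) ∂m := lintegral_mono fun x => by
        rw [← ofReal_norm, Real.norm_eq_abs, ← ENNReal.ofReal_coe_nnreal]
        exact (ENNReal.ofReal_le_ofReal (sub_add_cancel _ _).ge).trans ENNReal.ofReal_add_le
    _ < ∞ := by
        rw [lintegral_add_right _ measurable_const, lintegral_const]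
        exact ENNReal.add_lt_top.2
          ⟨h.lt_top, ENNReal.mul_lt_top ENNReal.coe_lt_top (measure_lt_top _ _)⟩

theorem abs_clamp_le (D : NNReal) (a : ℝ) : |max (-D : ℝ) (min a D)| ≤ D :=
  abs_le.2 ⟨le_max_left _ _, max_le (by linarith [D.coe_nonneg]) (min_le_right _ _)⟩

theorem abs_integral_sub_integral_clamp_le {m : Measure Ω} [IsFiniteMeasure m] {f : Ω → ℝ}
    (hf : AEStronglyMeasurable f m) {D : NNReal} {ε : ℝ} (hε : 0 ≤ ε)
    (h : ∫⁻ x, ENNReal.ofReal (|f x| - D) ∂m ≤ ENNReal.ofReal ε) :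
    |∫ x, f x ∂m - ∫ x, max (-D : ℝ) (min (f x) D) ∂m| ≤ ε := by
  have hclamp : Integrable (fun x => max (-D : ℝ) (min (f x) D)) m :=
    .of_bound (aestronglyMeasurable_const.sup (hf.inf aestronglyMeasurable_const)) D
      (ae_of_all _ fun x => abs_clamp_le D (f x))
  rw [← integral_sub (integrable_of_lintegral_tail_ne_top hf (ne_top_of_le_ne_top
    ENNReal.ofReal_ne_top h)) hclamp, ← Real.norm_eq_abs, ← toReal_enorm]
  refine ENNReal.toReal_le_of_le_ofReal hε ((enorm_integral_le_lintegral_enorm _).trans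
    ((lintegral_mono fun x => ?_).trans h))
  rw [← ofReal_norm, Real.norm_eq_abs]
  refine ENNReal.ofReal_le_ofReal_iff'.2 ?_
  have := D.coe_nonneg
  grind

theorem tendsto_integral_of_abs_le [TopologicalSpace Ω] [OpensMeasurableSpace Ω]
    {p : ℕ → ProbabilityMeasure Ω} {q : ProbabilityMeasure Ω} (h : Tendsto p atTop (𝓝 q))
    {f : Ω → ℝ} (hf : Continuous f) {C : ℝ} (hC : ∀ x, |f x| ≤ C) :
    Tendsto (fun n => ∫ x, f x ∂(p n : Measure Ω)) atTop (𝓝 (∫ x, f x ∂(q : Measure Ω))) :=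
  ProbabilityMeasure.tendsto_iff_forall_integral_tendsto.1 h
    (BoundedContinuousFunction.ofNormedAddCommGroup f hf C hC)

theorem tendsto_integral_of_lintegral_tail_le [TopologicalSpace Ω] [OpensMeasurableSpace Ω]
    [HasOuterApproxClosed Ω] {p : ℕ → ProbabilityMeasure Ω} {q : ProbabilityMeasure Ω}
    (h : Tendsto p atTop (𝓝 q)) {f : Ω → ℝ} (hf : Continuous f)
    (htail : ∀ ε > 0, ∃ D : NNReal, ∀ n,
      ∫⁻ x, ENNReal.ofReal (|f x| - D) ∂(p n : Measure Ω) ≤ ENNReal.ofReal ε) :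
    Tendsto (fun n => ∫ x, f x ∂(p n : Measure Ω)) atTop (𝓝 (∫ x, f x ∂(q : Measure Ω))) := by
  refine Metric.tendsto_nhds.2 fun ε hε => ?_
  obtain ⟨D, hp⟩ := htail (ε / 3) (by positivity)
  have hq : ∫⁻ x, ENNReal.ofReal (|f x| - D) ∂(q : Measure Ω) ≤ ENNReal.ofReal (ε / 3) := by
    refine (lintegral_le_liminf_of_lowerSemicontinuous h
      (ENNReal.continuous_ofReal.comp (hf.abs.sub continuous_const)).lowerSemicontinuous).trans ?_
    exact (liminf_le_liminf (Eventually.of_forall hp)).trans_eq (liminf_const _)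
  have hclamp : Tendsto (fun n => ∫ x, max (-D : ℝ) (min (f x) D) ∂(p n : Measure Ω)) atTop
      (𝓝 (∫ x, max (-D : ℝ) (min (f x) D) ∂(q : Measure Ω))) :=
    tendsto_integral_of_abs_le h (by fun_prop) fun x => abs_clamp_le D (f x)
  filter_upwards [Metric.tendsto_nhds.1 hclamp (ε / 3) (by positivity)] with n hn
  have hpn := abs_le.1
    (abs_integral_sub_integral_clamp_le hf.aestronglyMeasurable (by positivity) (hp n))
  have hq' := abs_le.1
    (abs_integral_sub_integral_clamp_le hf.aestronglyMeasurable (by positivity) hq)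
  rw [Real.dist_eq, abs_lt] at hn ⊢
  constructor <;> linarith

end UniformTail

section Lift

variable {d : ℕ}

noncomputable instance : MeasurableSpace (P1 d) := borel (P1 d)

instance : BorelSpace (P1 d) := ⟨rfl⟩

theorem Curve.continuous_graph (μ : Curve d) : Continuous fun z : X d => (z, μ z.2) :=
  continuous_id.prodMk (μ.continuous.comp continuous_snd)

/-- The probability measure `dμ_t ⊗ dt`, bundled for the topology of weak convergence. -/
noncomputable def Curve.toProb (μ : Curve d) : ProbabilityMeasure (X d) :=
  ⟨μ.spaceTime, inferInstance⟩

/-- The image of `dμ_t ⊗ dt` under `(y, t) ↦ (y, t, μ_t)`. Functionals of the curve that depend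
on `μ_t` through their integrand are linear in the lift. -/
noncomputable def Curve.lift (μ : Curve d) : ProbabilityMeasure (X d × P1 d) :=
  μ.toProb.map (f := fun z => (z, μ z.2)) μ.continuous_graph.aemeasurable

theorem Curve.lintegral_lift (μ : Curve d) {f : X d × P1 d → ℝ≥0∞} (hf : Measurable f) :
    ∫⁻ w, f w ∂(μ.lift : Measure (X d × P1 d)) = ∫⁻ z, f (z, μ z.2) ∂μ.spaceTime :=
  lintegral_map hf μ.continuous_graph.measurable

theorem Curve.integral_lift (μ : Curve d) {f : X d × P1 d → ℝ} (hf : Continuous f) :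
    ∫ w, f w ∂(μ.lift : Measure (X d × P1 d)) = ∫ z, f (z, μ z.2) ∂μ.spaceTime :=
  integral_map μ.continuous_graph.aemeasurable hf.aestronglyMeasurable

theorem abs_integral_lift_sub_le (μ μ' : Curve d) {K : NNReal} {f : X d × P1 d → ℝ}
    (hf : LipschitzWith K f) {C : ℝ} (hC : ∀ v w, dist (f v) (f w) ≤ C) :
    |∫ w, f w ∂(μ.lift : Measure (X d × P1 d)) - ∫ w, f w ∂(μ'.lift : Measure (X d × P1 d))|
      ≤ 2 * K * dist μ.toContinuousMap μ'.toContinuousMap := by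
  have hInt (m : Curve d) : Integrable (fun z : X d => f (z, m z.2)) m.spaceTime := by
    refine .of_bound (hf.continuous.comp m.continuous_graph).aestronglyMeasurable
      (C + ‖f (0, m 0)‖) (ae_of_all _ fun z => ?_)
    rw [← dist_zero_right, ← dist_zero_right]
    exact (dist_triangle _ _ _).trans (add_le_add_left (hC _ _) _)
  have hslice (t : unitInterval) (ρ : P1 d) : LipschitzWith K fun y : E d => f ((y, t), ρ) :=
    (hf.comp ((LipschitzWith.prodMk_right t).prodMk (.const ρ))).weaken (by simp)
  have hdist (t : unitInterval) : dist (μ t) (μ' t) ≤ dist μ.toContinuousMap μ'.toContinuousMap :=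
    ContinuousMap.dist_apply_le_dist (f := μ.toContinuousMap) (g := μ'.toContinuousMap) t
  rw [μ.integral_lift hf.continuous, μ'.integral_lift hf.continuous,
    μ.integral_spaceTime (hInt μ), μ'.integral_spaceTime (hInt μ'),
    ← integral_sub (μ.integrable_integral (hInt μ)) (μ'.integrable_integral (hInt μ'))]
  suffices h : ∀ t,
      ‖∫ y, f ((y, t), μ t) ∂(μ t).toMeasure - ∫ y, f ((y, t), μ' t) ∂(μ' t).toMeasure‖ ≤
        2 * K * dist μ.toContinuousMap μ'.toContinuousMap by
    simpa using norm_integral_le_of_norm_le_const (ae_of_all volume h)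
  intro t
  have hintegrand : ‖∫ y, (f ((y, t), μ t) - f ((y, t), μ' t)) ∂(μ t).toMeasure‖
      ≤ K * dist (μ t) (μ' t) := by
    refine (norm_integral_le_of_norm_le_const (C := K * dist (μ t) (μ' t))
      (ae_of_all _ fun y => ?_)).trans_eq (by rw [probReal_univ, mul_one])
    simpa [Prod.dist_eq, dist_eq_norm (f _)] using hf.dist_le_mul ((y, t), μ t) ((y, t), μ' t)
  have hmeasure := abs_integral_sub_le_W1 (μ t) (μ' t) (hslice t (μ' t))
  rw [integral_sub ((μ t).integrable_of_lipschitz (hslice t _))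
    ((μ t).integrable_of_lipschitz (hslice t _)), Real.norm_eq_abs] at hintegrand
  calc ‖∫ y, f ((y, t), μ t) ∂(μ t).toMeasure - ∫ y, f ((y, t), μ' t) ∂(μ' t).toMeasure‖
      ≤ K * dist (μ t) (μ' t) + K * dist (μ t) (μ' t) :=
        (abs_sub_le _ _ _).trans (add_le_add hintegrand hmeasure)
    _ ≤ 2 * K * dist μ.toContinuousMap μ'.toContinuousMap := by
        linarith [mul_le_mul_of_nonneg_left (hdist t) K.coe_nonneg]

theorem tendsto_lift {μ : ℕ → Curve d} {μ' : Curve d} (h : CurveTendsto μ μ') :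
    Tendsto (fun n => (μ n).lift) atTop (𝓝 μ'.lift) := by
  refine tendsto_iff_forall_lipschitz_integral_tendsto.2 fun f ⟨C, hC⟩ ⟨K, hf⟩ => ?_
  refine tendsto_iff_dist_tendsto_zero.2 (squeeze_zero (fun _ => dist_nonneg)
    (fun n => abs_integral_lift_sub_le (μ n) μ' hf hC) ?_)
  simpa using (tendsto_iff_dist_tendsto_zero.1 (curveTendsto_iff.1 h)).const_mul (2 * (K : ℝ))

theorem tendsto_toProb {μ : ℕ → Curve d} {μ' : Curve d} (h : CurveTendsto μ μ') :
    Tendsto (fun n => (μ n).toProb) atTop (𝓝 μ'.toProb) := by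
  have hfst (m : Curve d) : m.lift.map continuous_fst.aemeasurable = m.toProb :=
    Subtype.ext ((Measure.map_map measurable_fst m.continuous_graph.measurable).trans
      Measure.map_id)
  simpa only [hfst] using
    ProbabilityMeasure.tendsto_map_of_tendsto_of_continuous _ _ (tendsto_lift h) continuous_fst

end Lift

section LimitControl

variable {V : Type*} [NormedAddCommGroup V] {ψ : V → ℝ}

theorem Superlinear.exists_lintegral_enorm_le (hψ : Superlinear ψ) {Ω : Type*} [MeasurableSpace Ω] :
    ∃ C : NNReal, ∀ (m : Measure Ω) [IsProbabilityMeasure m] (v : Ω → V),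
      ∫⁻ x, ‖v x‖ₑ ∂m ≤ C + ∫⁻ x, ENNReal.ofReal (ψ (v x)) ∂m := by
  obtain ⟨C, hC⟩ := hψ 1 one_pos
  refine ⟨C, fun m _ v => ?_⟩
  calc ∫⁻ x, ‖v x‖ₑ ∂m ≤ ∫⁻ x, (C + ENNReal.ofReal (ψ (v x))) ∂m := lintegral_mono fun x => by
        rw [← ofReal_norm, ← ENNReal.ofReal_coe_nnreal]
        exact (ENNReal.ofReal_le_ofReal (by simpa using hC (v x))).trans ENNReal.ofReal_add_le
    _ = C + ∫⁻ x, ENNReal.ofReal (ψ (v x)) ∂m := by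
        rw [lintegral_add_left measurable_const, lintegral_const, measure_univ, mul_one]

theorem Superlinear.exists_lintegral_tail_le (hψ : Superlinear ψ) {Ω : Type*} [MeasurableSpace Ω]
    (K B : NNReal) {ε : ℝ} (hε : 0 < ε) :
    ∃ D : NNReal, ∀ (m : Measure Ω) (f : Ω → ℝ) (v : Ω → V), (∀ x, |f x| ≤ K * ‖v x‖) →
      ∫⁻ x, ENNReal.ofReal (ψ (v x)) ∂m ≤ B →
      ∫⁻ x, ENNReal.ofReal (|f x| - D) ∂m ≤ ENNReal.ofReal ε := by
  obtain ⟨C, hC⟩ := hψ (ε / ((K + 1) * (B + 1))) (by positivity)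
  refine ⟨K * C, fun m f v hf hB => ?_⟩
  have hpoint (x : Ω) : |f x| - K * C ≤ K * (ε / ((K + 1) * (B + 1))) * ψ (v x) := by
    linarith [hf x, mul_le_mul_of_nonneg_left (hC (v x)) K.coe_nonneg]
  calc ∫⁻ x, ENNReal.ofReal (|f x| - (K * C : NNReal)) ∂m
      ≤ ∫⁻ x, ENNReal.ofReal (K * (ε / ((K + 1) * (B + 1)))) * ENNReal.ofReal (ψ (v x)) ∂m :=
        lintegral_mono fun x => by
          rw [← ENNReal.ofReal_mul (by positivity)]
          exact ENNReal.ofReal_le_ofReal (by simpa using hpoint x)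
    _ ≤ ENNReal.ofReal (K * (ε / ((K + 1) * (B + 1)))) * ENNReal.ofReal B := by
        rw [lintegral_const_mul' _ _ ENNReal.ofReal_ne_top, ENNReal.ofReal_coe_nnreal]
        gcongr
    _ = ENNReal.ofReal (K / (K + 1) * (B / (B + 1)) * ε) := by
        rw [← ENNReal.ofReal_mul (by positivity)]
        congr 1
        field_simp
    _ ≤ ENNReal.ofReal ε := by
        refine ENNReal.ofReal_le_ofReal (mul_le_of_le_one_left hε.le (mul_le_one₀ ?_ ?_ ?_))
        exacts [div_le_one_of_le₀ (by linarith) (by positivity), by positivity,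
          div_le_one_of_le₀ (by linarith) (by positivity)]

variable [NormedSpace ℝ V] [FiniteDimensional ℝ V] [MeasurableSpace V] [BorelSpace V]

theorem ofReal_map_integral_le_lintegral (hψ0 : ∀ x, 0 ≤ ψ x) (hψ : ConvexOn ℝ univ ψ)
    {κ : Measure V} [IsProbabilityMeasure κ] (hκ : Integrable id κ) :
    ENNReal.ofReal (ψ (∫ v, v ∂κ)) ≤ ∫⁻ v, ENNReal.ofReal (ψ v) ∂κ := by
  have hcont : Continuous ψ := hψ.locallyLipschitz.continuous
  by_cases hcost : ∫⁻ v, ENNReal.ofReal (ψ v) ∂κ = ∞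
  · exact hcost ▸ le_top
  have hInt : Integrable ψ κ := ⟨hcont.aestronglyMeasurable,
    (hasFiniteIntegral_iff_ofReal (ae_of_all _ hψ0)).2 (lt_top_iff_ne_top.2 hcost)⟩
  rw [← ofReal_integral_eq_lintegral_ofReal hInt (ae_of_all _ hψ0)]
  exact ENNReal.ofReal_le_ofReal (hψ.map_integral_le hcont.continuousOn isClosed_univ
    (ae_of_all _ fun _ => mem_univ _) hκ hInt)

section Barycentre

variable {Y : Type*} [MeasurableSpace Y]

/-- The mean of the conditional law of the second coordinate given the first: the feedback control
obtained by averaging a relaxed, that is, measure-valued control. -/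
noncomputable def barycentre (γ : Measure (Y × V)) [IsFiniteMeasure γ] (y : Y) : V :=
  ∫ v, v ∂γ.condKernel y

variable {γ : Measure (Y × V)} [IsFiniteMeasure γ] (hγ : Integrable Prod.snd γ)
include hγ

theorem ae_integrable_condKernel : ∀ᵐ y ∂γ.fst, Integrable id (γ.condKernel y) := by
  rw [← γ.disintegrate γ.condKernel] at hγ
  exact ((Measure.integrable_compProd_iff hγ.1).1 hγ).1

theorem integrable_barycentre : Integrable (barycentre γ) γ.fst := by
  rw [← γ.disintegrate γ.condKernel] at hγ
  exact hγ.integral_compProd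

theorem lintegral_barycentre_le (hψ0 : ∀ x, 0 ≤ ψ x) (hψ : ConvexOn ℝ univ ψ) :
    ∫⁻ y, ENNReal.ofReal (ψ (barycentre γ y)) ∂γ.fst ≤ ∫⁻ w, ENNReal.ofReal (ψ w.2) ∂γ := by
  have hmeas : Measurable fun w : Y × V => ENNReal.ofReal (ψ w.2) :=
    (hψ.locallyLipschitz.continuous.measurable.comp measurable_snd).ennreal_ofReal
  conv_rhs => rw [← γ.disintegrate γ.condKernel, Measure.lintegral_compProd hmeas]
  refine lintegral_mono_ae ?_
  filter_upwards [ae_integrable_condKernel hγ] with y hy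
  exact ofReal_map_integral_le_lintegral hψ0 hψ hy

theorem integral_apply_barycentre {ℓ : Y → V →L[ℝ] ℝ} (hℓ : Integrable (fun w => ℓ w.1 w.2) γ) :
    ∫ y, ℓ y (barycentre γ y) ∂γ.fst = ∫ w, ℓ w.1 w.2 ∂γ := by
  conv_rhs => rw [← γ.disintegrate γ.condKernel]
  rw [← γ.disintegrate γ.condKernel] at hℓ
  rw [Measure.integral_compProd hℓ]
  refine integral_congr_ae ?_
  filter_upwards [ae_integrable_condKernel hγ] with y hy
  exact ((ℓ y).integral_comp_comm hy).symm

end Barycentre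

variable {Y : Type*} [MetricSpace Y] [CompleteSpace Y] [SecondCountableTopology Y]
  [MeasurableSpace Y] [BorelSpace Y]

theorem isTightMeasureSet_of_fst_of_cost (hψ : Superlinear ψ)
    {γ : ℕ → ProbabilityMeasure (Y × V)} {m : ProbabilityMeasure Y}
    (hm : Tendsto (fun n => (γ n).map continuous_fst.aemeasurable) atTop (𝓝 m)) {B : NNReal}
    (hB : ∀ n, ∫⁻ w, ENNReal.ofReal (ψ w.2) ∂(γ n : Measure (Y × V)) ≤ B) :
    IsTightMeasureSet {((p : ProbabilityMeasure (Y × V)) : Measure (Y × V)) | p ∈ range γ} := by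
  refine IsTightMeasureSet.prodMk ?_ ?_
  · have hcompact : IsCompact (closure (range fun n => (γ n).map continuous_fst.aemeasurable)) :=
      hm.isCompact_insert_range.of_isClosed_subset isClosed_closure
        (closure_minimal (subset_insert _ _) hm.isCompact_insert_range.isClosed)
    refine (isTightMeasureSet_of_isCompact_closure hcompact).subset ?_
    rintro _ ⟨_, ⟨_, ⟨n, rfl⟩, rfl⟩, rfl⟩
    exact ⟨_, mem_range_self n, rfl⟩
  · obtain ⟨C, hC⟩ := hψ.exists_lintegral_enorm_le (Ω := Y × V)
    refine isTightMeasureSet_of_lintegral_enorm_le (C := C + B)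
      (ENNReal.add_ne_top.2 ⟨ENNReal.coe_ne_top, ENNReal.coe_ne_top⟩) ?_
    rintro _ ⟨_, ⟨_, ⟨n, rfl⟩, rfl⟩, rfl⟩
    rw [Measure.snd, lintegral_map measurable_enorm measurable_snd]
    exact (hC (γ n) Prod.snd).trans (add_le_add le_rfl (hB n))

theorem exists_subseq_tendsto_relaxedControl (hψ0 : ∀ x, 0 ≤ ψ x) (hψ : ConvexOn ℝ univ ψ)
    (hsuper : Superlinear ψ)
    {γ : ℕ → ProbabilityMeasure (Y × V)} {m : ProbabilityMeasure Y}
    (hm : Tendsto (fun n => (γ n).map continuous_fst.aemeasurable) atTop (𝓝 m)) {B : NNReal}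
    (hB : ∀ n, ∫⁻ w, ENNReal.ofReal (ψ w.2) ∂(γ n : Measure (Y × V)) ≤ B) :
    ∃ (u : Y → V) (k : ℕ → ℕ), StrictMono k ∧ Integrable u (m : Measure Y) ∧
      (∫⁻ y, ENNReal.ofReal (ψ (u y)) ∂(m : Measure Y) ≤
        liminf (fun n => ∫⁻ w, ENNReal.ofReal (ψ w.2) ∂(γ (k n) : Measure (Y × V))) atTop) ∧
      ∀ (ℓ : Y → V →L[ℝ] ℝ) (K : NNReal), Continuous ℓ → (∀ y, ‖ℓ y‖ ≤ K) →
        Tendsto (fun n => ∫ w, ℓ w.1 w.2 ∂(γ (k n) : Measure (Y × V))) atTop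
          (𝓝 (∫ y, ℓ y (u y) ∂(m : Measure Y))) := by
  have hψc : Continuous ψ := hψ.locallyLipschitz.continuous
  have htight := isTightMeasureSet_of_fst_of_cost hsuper hm hB
  obtain ⟨p, k, hk, hp⟩ := exists_subseq_tendsto_of_isTightMeasureSet htight
  have hmap : p.map continuous_fst.aemeasurable = m := tendsto_nhds_unique
    (ProbabilityMeasure.tendsto_map_of_tendsto_of_continuous _ _ hp continuous_fst)
    (hm.comp hk.tendsto_atTop)
  have hfst : (p : Measure (Y × V)).fst = m := congrArg Subtype.val hmap
  have hlsc : ∫⁻ w, ENNReal.ofReal (ψ w.2) ∂(p : Measure (Y × V)) ≤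
      liminf (fun n => ∫⁻ w, ENNReal.ofReal (ψ w.2) ∂(γ (k n) : Measure (Y × V))) atTop :=
    lintegral_le_liminf_of_lowerSemicontinuous hp
      (ENNReal.continuous_ofReal.comp (hψc.comp continuous_snd)).lowerSemicontinuous
  have hcost : ∫⁻ w, ENNReal.ofReal (ψ w.2) ∂(p : Measure (Y × V)) ≤ B := hlsc.trans <|
    (liminf_le_liminf (Eventually.of_forall fun n => hB (k n))).trans_eq (liminf_const _)
  have hInt : Integrable Prod.snd (p : Measure (Y × V)) := by
    obtain ⟨C, hC⟩ := hsuper.exists_lintegral_enorm_le (Ω := Y × V)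
    exact ⟨continuous_snd.aestronglyMeasurable, (hC p Prod.snd).trans_lt
      (ENNReal.add_lt_top.2 ⟨ENNReal.coe_lt_top, hcost.trans_lt ENNReal.coe_lt_top⟩)⟩
  refine ⟨barycentre (p : Measure (Y × V)), k, hk, hfst ▸ integrable_barycentre hInt,
    (hfst ▸ lintegral_barycentre_le hInt hψ0 hψ).trans hlsc, fun ℓ K hℓ hK => ?_⟩
  have hℓint : Integrable (fun w => ℓ w.1 w.2) (p : Measure (Y × V)) :=
    integrable_apply_apply_of_bound (.id ℝ (V →L[ℝ] ℝ)) hInt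
      (hℓ.comp continuous_fst).aestronglyMeasurable fun w => hK w.1
  rw [← hfst, integral_apply_barycentre hInt hℓint]
  refine tendsto_integral_of_lintegral_tail_le hp
    ((hℓ.comp continuous_fst).clm_apply continuous_snd) fun ε hε => ?_
  obtain ⟨D, hD⟩ := hsuper.exists_lintegral_tail_le (Ω := Y × V) K B hε
  exact ⟨D, fun n => hD _ _ Prod.snd (fun w => (ℓ w.1).le_of_opNorm_le (hK w.1) w.2) (hB (k n))⟩

theorem exists_subseq_tendsto_control (hψ0 : ∀ x, 0 ≤ ψ x) (hψ : ConvexOn ℝ univ ψ)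
    (hsuper : Superlinear ψ) {m : ℕ → ProbabilityMeasure Y} {m' : ProbabilityMeasure Y}
    (hm : Tendsto m atTop (𝓝 m')) {u : ℕ → Y → V} (hu : ∀ n, AEMeasurable (u n) (m n : Measure Y))
    {B : NNReal} (hB : ∀ n, ∫⁻ y, ENNReal.ofReal (ψ (u n y)) ∂(m n : Measure Y) ≤ B) :
    ∃ (u' : Y → V) (k : ℕ → ℕ), StrictMono k ∧ Integrable u' (m' : Measure Y) ∧
      (∫⁻ y, ENNReal.ofReal (ψ (u' y)) ∂(m' : Measure Y) ≤
        liminf (fun n => ∫⁻ y, ENNReal.ofReal (ψ (u (k n) y)) ∂(m (k n) : Measure Y)) atTop) ∧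
      ∀ (ℓ : Y → V →L[ℝ] ℝ) (K : NNReal), Continuous ℓ → (∀ y, ‖ℓ y‖ ≤ K) →
        Tendsto (fun n => ∫ y, ℓ y (u (k n) y) ∂(m (k n) : Measure Y)) atTop
          (𝓝 (∫ y, ℓ y (u' y) ∂(m' : Measure Y))) := by
  have hgraph (n : ℕ) : AEMeasurable (fun y => (y, u n y)) (m n : Measure Y) :=
    aemeasurable_id.prodMk (hu n)
  have hcost (n : ℕ) : ∫⁻ w, ENNReal.ofReal (ψ w.2) ∂((m n).map (hgraph n) : Measure (Y × V))
      = ∫⁻ y, ENNReal.ofReal (ψ (u n y)) ∂(m n : Measure Y) :=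
    lintegral_map' (hψ.locallyLipschitz.continuous.measurable.comp
      measurable_snd).ennreal_ofReal.aemeasurable (hgraph n)
  have hfst (n : ℕ) : ((m n).map (hgraph n)).map continuous_fst.aemeasurable = m n :=
    Subtype.ext ((AEMeasurable.map_map_of_aemeasurable measurable_fst.aemeasurable
      (hgraph n)).trans Measure.map_id)
  obtain ⟨u', k, hk, hu', hlsc, hlim⟩ := exists_subseq_tendsto_relaxedControl hψ0 hψ hsuper
    (γ := fun n => (m n).map (hgraph n)) (by simpa only [hfst] using hm)
    fun n => (hcost n).trans_le (hB n)
  refine ⟨u', k, hk, hu', by simpa only [hcost] using hlsc, fun ℓ K hℓ hK => ?_⟩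
  refine (hlim ℓ K hℓ hK).congr fun n => ?_
  exact integral_map (hgraph (k n))
    ((hℓ.comp continuous_fst).clm_apply continuous_snd).aestronglyMeasurable

end LimitControl

section Hypotheses

variable {d : ℕ}

theorem continuous_uncurry_of_modulus {Y : Type*} [PseudoMetricSpace Y] {f : E d → P1 d → Y}
    (h : ∀ ε > 0, ∃ δ > 0, ∀ y y' μ μ', dist y y' < δ → W1 μ μ' < ENNReal.ofReal δ →
      dist (f y μ) (f y' μ') < ε) : Continuous (Function.uncurry f) := by
  refine continuous_iff_continuousAt.2 fun ⟨y, μ⟩ => Metric.tendsto_nhds.2 fun ε hε => ?_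
  obtain ⟨δ, hδ, hf⟩ := h ε hε
  filter_upwards [prod_mem_nhds (Metric.ball_mem_nhds y hδ)
    (Metric.eball_mem_nhds μ (ENNReal.ofReal_pos.2 hδ))] with w hw using hf _ _ _ _ hw.1 hw.2

theorem lowerSemicontinuous_of_isOpen_of_continuousOn {Y : Type*} [TopologicalSpace Y]
    {f : Y → ℝ≥0∞} (ho : IsOpen {y | f y = ∞}) (hf : ContinuousOn f {y | f y < ∞}) :
    LowerSemicontinuous f := by
  intro y r hr
  by_cases hy : f y = ∞
  · filter_upwards [ho.mem_nhds hy] with x hx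
    exact hr.trans_eq (hy.trans hx.symm)
  · filter_upwards [eventually_nhdsWithin_iff.1
      ((hf y (lt_top_iff_ne_top.2 hy)).eventually (lt_mem_nhds hr))] with x hx
    by_cases hx' : f x < ∞
    · exact hx hx'
    · exact hr.trans_le (le_top.trans_eq (not_lt_top_iff.1 hx').symm)

theorem IsStateCost.lowerSemicontinuous {L : E d → P1 d → ℝ≥0∞} (hL : IsStateCost L) :
    LowerSemicontinuous (Function.uncurry L) := by
  rcases hL with ⟨hfin, huc⟩ | ⟨hind, hcont⟩
  · have hreal : Continuous (Function.uncurry fun y μ => (L y μ).toReal) :=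
      continuous_uncurry_of_modulus huc
    exact ((ENNReal.continuous_ofReal.comp hreal).congr fun w =>
      ENNReal.ofReal_toReal (hfin _ _)).lowerSemicontinuous
  · rintro ⟨y, μ⟩ r hr
    have hlsc := lowerSemicontinuous_of_isOpen_of_continuousOn (hcont μ).1 (hcont μ).2
    filter_upwards [continuous_fst.continuousAt.eventually (hlsc y r hr)] with w hw
    exact hw.trans_eq (hind _ _ _)

theorem IsDrift.continuous {F : E d → P1 d → E d} (hF : IsDrift F) :
    Continuous (Function.uncurry F) :=
  continuous_uncurry_of_modulus hF.uniformContinuous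

theorem IsDrift.exists_growth {F : E d → P1 d → E d} (hF : IsDrift F) :
    ∃ c : NNReal, ∀ y ρ, ‖F y ρ‖ ≤ c * (1 + ‖y‖ + ρ.moment) := by
  obtain ⟨C, C', hC, hC', hgrowth⟩ := hF.growth
  refine ⟨.mk (C + C') (by positivity), fun y ρ => (hgrowth y ρ).trans ?_⟩
  have hmoment : 0 ≤ ρ.moment := integral_nonneg fun _ => norm_nonneg _
  rw [NNReal.coe_mk]
  nlinarith [mul_nonneg hC (add_nonneg (norm_nonneg y) hmoment)]

end Hypotheses

section Limit

variable {d : ℕ} {μ : ℕ → Curve d} {μ' : Curve d}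

theorem lintegral_stateCost_le_liminf {L : E d → P1 d → ℝ≥0∞}
    (hL : LowerSemicontinuous (Function.uncurry L)) (h : CurveTendsto μ μ') :
    ∫⁻ t, ∫⁻ y, L y (μ' t) ∂(μ' t).toMeasure ≤
      liminf (fun n => ∫⁻ t, ∫⁻ y, L y (μ n t) ∂(μ n t).toMeasure) atTop := by
  have hlsc : LowerSemicontinuous fun w : X d × P1 d => L w.1.1 w.2 :=
    hL.comp (g := fun w : X d × P1 d => (w.1.1, w.2)) (by fun_prop)
  have hlift (m : Curve d) : ∫⁻ t, ∫⁻ y, L y (m t) ∂(m t).toMeasure =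
      ∫⁻ w, L w.1.1 w.2 ∂(m.lift : Measure (X d × P1 d)) := by
    rw [m.lintegral_lift hlsc.measurable, m.lintegral_spaceTime
      (f := fun z => L z.1 (m z.2)) (hlsc.measurable.comp m.continuous_graph.measurable)]
  simpa only [hlift] using lintegral_le_liminf_of_lowerSemicontinuous (tendsto_lift h) hlsc

variable {F : E d → P1 d → E d} {c : NNReal} (hF : Continuous (Function.uncurry F))
  (hgrowth : ∀ y ρ, ‖F y ρ‖ ≤ c * (1 + ‖y‖ + ρ.moment))
include hF hgrowth

theorem tendsto_integral_inner_drift (h : CurveTendsto μ μ') {M : ℝ}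
    (hM : ∀ n t, (μ n t).moment ≤ M) {g : X d → E d} (hg : Continuous g) {C : ℝ}
    (hC : ∀ z, bracket z.1 * ‖g z‖ ≤ C) :
    Tendsto (fun n => ∫ z, ⟪g z, F z.1 (μ n z.2)⟫ ∂(μ n).spaceTime) atTop
      (𝓝 (∫ z, ⟪g z, F z.1 (μ' z.2)⟫ ∂μ'.spaceTime)) := by
  have hM0 : 0 ≤ M := (integral_nonneg fun _ => norm_nonneg _ : 0 ≤ (μ 0 0).moment).trans (hM 0 0)
  have hC0 : 0 ≤ C := (mul_nonneg (bracket_pos _).le (norm_nonneg _)).trans (hC (0, 0))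
  have hcont : Continuous fun w : X d × P1 d => ⟪g w.1, F w.1.1 w.2⟫ :=
    (hg.comp continuous_fst).inner
      (hF.comp (g := Function.uncurry F) (f := fun w : X d × P1 d => (w.1.1, w.2)) (by fun_prop))
  have hbound (n : ℕ) (z : X d) : |⟪g z, F z.1 (μ n z.2)⟫| ≤ c * (2 + M) * C := by
    calc |⟪g z, F z.1 (μ n z.2)⟫| ≤ ‖g z‖ * ‖F z.1 (μ n z.2)‖ := abs_real_inner_le_norm _ _
      _ ≤ ‖g z‖ * (c * (2 + M) * bracket z.1) := by
          gcongr
          exact norm_le_mul_bracket hgrowth (hM n z.2) z.1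
      _ = c * (2 + M) * (bracket z.1 * ‖g z‖) := by ring
      _ ≤ c * (2 + M) * C := mul_le_mul_of_nonneg_left (hC z) (by positivity)
  have htendsto := tendsto_integral_of_lintegral_tail_le (tendsto_lift h) hcont fun ε _ =>
    ⟨.mk (c * (2 + M) * C) (by positivity), fun n => by
      rw [(μ n).lintegral_lift (by fun_prop)]
      refine (lintegral_mono fun z => ?_).trans (lintegral_zero.trans_le zero_le)
      exact (ENNReal.ofReal_of_nonpos (sub_nonpos.2 (hbound n z))).le⟩
  simpa only [Curve.integral_lift _ hcont] using htendsto

variable {U : Submodule ℝ (E d)}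

theorem TransportedBy.of_curveTendsto (h : CurveTendsto μ μ') {M : ℝ}
    (hM : ∀ n t, (μ n t).moment ≤ M) {u : ℕ → X d → U} {u' : X d → U}
    (hu : ∀ n, Integrable (u n) (μ n).spaceTime) (hu' : Integrable u' μ'.spaceTime)
    (hlim : ∀ (g : X d → E d) (C : ℝ), Continuous g → (∀ z, ‖g z‖ ≤ C) →
      Tendsto (fun n => ∫ z, ⟪g z, (u n z : E d)⟫ ∂(μ n).spaceTime) atTop
        (𝓝 (∫ z, ⟪g z, (u' z : E d)⟫ ∂μ'.spaceTime)))
    (ht : ∀ n, TransportedBy (μ n) fun z => F z.1 (μ n z.2) + (u n z : E d)) :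
    TransportedBy μ' fun z => F z.1 (μ' z.2) + (u' z : E d) := by
  have hcoe {m : Measure (X d)} {v : X d → U} (hv : Integrable v m) :
      Integrable (fun z => (v z : E d)) m := U.subtypeL.integrable_comp hv
  refine ⟨(integrable_drift hF hgrowth μ').add (hcoe hu'), fun φ hφ hc hs => ?_⟩
  obtain ⟨C, hC⟩ := exists_norm_deriv_snd_le hφ hc
  obtain ⟨D, hD⟩ := exists_norm_gradient_fst_le hφ hc
  obtain ⟨D', hD'⟩ := exists_bracket_mul_norm_gradient_fst_le hφ hc
  have htime := tendsto_integral_of_abs_le (tendsto_toProb h) (continuous_deriv_snd hφ) hC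
  have hdrift := tendsto_integral_inner_drift hF hgrowth h hM (continuous_gradient_fst hφ) hD'
  have hcontrol := hlim _ D (continuous_gradient_fst hφ) hD
  rw [integral_deriv_add_inner_add hφ hc (integrable_drift hF hgrowth μ') (hcoe hu')]
  refine tendsto_nhds_unique (htime.add (hdrift.add hcontrol))
    (tendsto_const_nhds.congr fun n => ?_)
  exact ((ht n).2 φ hφ hc hs).symm.trans (integral_deriv_add_inner_add hφ hc
    (integrable_drift hF hgrowth (μ n)) (hcoe (hu n)))

end Limit

section Compactness

theorem liminf_add_liminf_le {u v : ℕ → ℝ≥0∞} {c : ℝ≥0∞} (h : ∀ n, u n + v n ≤ c) :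
    liminf u atTop + liminf v atTop ≤ c := by
  rw [liminf_eq_iSup_iInf_of_nat, liminf_eq_iSup_iInf_of_nat]
  exact ENNReal.iSup_add_iSup_le fun i j => (add_le_add (iInf₂_le (max i j) (le_max_left i j))
    (iInf₂_le (max i j) (le_max_right i j))).trans (h _)

variable {d : ℕ} {U : Submodule ℝ (E d)} {F : E d → P1 d → E d} {c : NNReal} {ψ : U → ℝ}
  (hF : Continuous (Function.uncurry F))
  (hgrowth : ∀ y ρ, ‖F y ρ‖ ≤ c * (1 + ‖y‖ + ρ.moment))
  (hψ0 : ∀ x, 0 ≤ ψ x) (hψ : ConvexOn ℝ univ ψ)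
include hF hgrowth hψ0 hψ

theorem exists_controlled_of_Psi_le {m₀ : P1 d} {μ : Curve d} {ν : VectorMeasure (X d) U}
    (hν : SolvesContinuityEquation F μ ν) (h0 : μ 0 = m₀) {B : NNReal} (hB : Psi ψ ν μ ≤ B) :
    ∃ u, IsDensity ν μ u ∧ Controlled F ψ m₀ B μ u := by
  obtain ⟨u, hu⟩ : ∃ u, IsDensity ν μ u := by
    by_contra hu
    exact ENNReal.coe_ne_top (top_le_iff.1 ((Psi_eq_top ψ ν μ hu).symm.trans_le hB))
  rw [Psi_eq ψ ν μ u hu] at hB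
  have hmeas : AEStronglyMeasurable (fun z => ψ (u z)) μ.spaceTime :=
    hψ.locallyLipschitz.continuous.comp_aestronglyMeasurable hu.1.1
  have hnonneg : ∀ᵐ z ∂μ.spaceTime, 0 ≤ ψ (u z) := ae_of_all _ fun z => hψ0 (u z)
  refine ⟨u, hu, hu.1, (solvesContinuityEquation_iff hF hgrowth hu).1 hν, h0, ⟨hmeas, ?_⟩, ?_⟩
  · exact (hasFiniteIntegral_iff_ofReal hnonneg).2 (hB.trans_lt ENNReal.coe_lt_top)
  · rw [integral_eq_lintegral_of_nonneg_ae hnonneg hmeas]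
    exact ENNReal.toReal_mono ENNReal.coe_ne_top hB

theorem exists_subseq_tendsto_of_controlled (hsuper : Superlinear ψ) {m₀ : P1 d} {B : NNReal}
    {μ : ℕ → Curve d} {u : ℕ → X d → U} (h : ∀ n, Controlled F ψ m₀ B (μ n) (u n)) :
    ∃ (μ' : Curve d) (u' : X d → U) (k : ℕ → ℕ), StrictMono k ∧
      CurveTendsto (fun n => μ (k n)) μ' ∧ Integrable u' μ'.spaceTime ∧
      TransportedBy μ' (fun z => F z.1 (μ' z.2) + (u' z : E d)) ∧
      (∫⁻ z, ENNReal.ofReal (ψ (u' z)) ∂μ'.spaceTime ≤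
        liminf (fun n => ∫⁻ z, ENNReal.ofReal (ψ (u (k n) z)) ∂(μ (k n)).spaceTime) atTop) ∧
      ∀ (g : X d → E d) (C : ℝ), Continuous g → (∀ z, ‖g z‖ ≤ C) →
        Tendsto (fun n => ∫ z, ⟪g z, (u (k n) z : E d)⟫ ∂(μ (k n)).spaceTime) atTop
          (𝓝 (∫ z, ⟪g z, (u' z : E d)⟫ ∂μ'.spaceTime)) := by
  obtain ⟨M, -, hM⟩ := exists_moment_bound hF hgrowth hψ0 hsuper m₀ B
  obtain ⟨μ', k₁, hk₁, hμ⟩ := exists_subseq_curveTendsto μ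
    (fun ε hε =>
      let ⟨R, hR, hμ⟩ := exists_tail_bound hF hgrowth hψ0 hsuper m₀ B hε
      ⟨R, hR, fun n => hμ _ _ (h n)⟩)
    (fun ε hε =>
      let ⟨δ, hδ, hμ⟩ := exists_modulus hF hgrowth hψ0 hsuper m₀ B hε
      ⟨δ, hδ, fun s t hst n => hμ _ _ (h n) s t hst⟩)
  obtain ⟨u', k₂, hk₂, hu', hcost, hlim⟩ := exists_subseq_tendsto_control hψ0 hψ hsuper
    (tendsto_toProb hμ) (fun n => (h (k₁ n)).integrable.aemeasurable)
    fun n => (h (k₁ n)).lintegral_cost_le hψ0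
  have hμ' : CurveTendsto (fun n => μ (k₁ (k₂ n))) μ' := hμ.subseq hk₂
  have hlim' (g : X d → E d) (C : ℝ) (hg : Continuous g) (hC : ∀ z, ‖g z‖ ≤ C) :=
    hlim (fun z => (innerSL ℝ (g z)).comp U.subtypeL) C.toNNReal (by fun_prop) fun z =>
      (ContinuousLinearMap.opNorm_comp_le _ _).trans <| by
        grw [innerSL_apply_norm, U.norm_subtypeL_le, mul_one]
        exact (hC z).trans (Real.le_coe_toNNReal C)
  refine ⟨μ', u', k₁ ∘ k₂, hk₁.comp hk₂, hμ', hu', ?_, hcost, hlim'⟩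
  exact .of_curveTendsto hF hgrowth hμ'
    (fun n t => ((μ _ t).moment_le_integral_bracket.trans (hM _ _ (h _) t)))
    (fun n => (h _).integrable) hu' hlim' fun n => (h _).transportedBy

omit hF hgrowth hψ0 hψ in
theorem narrowTendsto_of_isDensity {μ : ℕ → Curve d} {μ' : Curve d} {ν : ℕ → VectorMeasure (X d) U}
    {ν' : VectorMeasure (X d) U} {u : ℕ → X d → U} {u' : X d → U}
    (hu : ∀ n, IsDensity (ν n) (μ n) (u n)) (hu' : IsDensity ν' μ' u')
    (hlim : ∀ (g : X d → E d) (C : ℝ), Continuous g → (∀ z, ‖g z‖ ≤ C) →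
      Tendsto (fun n => ∫ z, ⟪g z, (u n z : E d)⟫ ∂(μ n).spaceTime) atTop
        (𝓝 (∫ z, ⟪g z, (u' z : E d)⟫ ∂μ'.spaceTime))) : NarrowTendsto ν ν' := by
  rintro f hf ⟨C, hC⟩
  have hcont : Continuous fun z => (f z : E d) := continuous_subtype_val.comp hf
  have hdot {m : Curve d} {η : VectorMeasure (X d) U} {v : X d → U} (hv : IsDensity η m v) :
      dotIntegral η (fun z => (f z : E d)) = ∫ z, ⟪(f z : E d), (v z : E d)⟫ ∂m.spaceTime := by
    rw [hv.2, dotIntegral_withDensityᵥ hv.1 hcont.stronglyMeasurable hC]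
  simpa only [hdot hu', hdot (hu _)] using hlim _ C hcont hC

end Compactness

end MFC

theorem lemma3p2_general {d : ℕ} {m₀ : MFC.P1 d} {U : Submodule ℝ (MFC.E d)}
    {L : MFC.E d → MFC.P1 d → ℝ≥0∞} (hL : LowerSemicontinuous (Function.uncurry L))
    {ψ : U → ℝ} (hψ0 : ∀ x, 0 ≤ ψ x) (hψ : ConvexOn ℝ univ ψ) (hsuper : MFC.Superlinear ψ)
    {F : MFC.E d → MFC.P1 d → MFC.E d} (hF : Continuous (Function.uncurry F))
    {c : NNReal} (hgrowth : ∀ y ρ, ‖F y ρ‖ ≤ c * (1 + ‖y‖ + ρ.moment))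
    {μ : ℕ → MFC.Curve d} {ν : ℕ → VectorMeasure (MFC.X d) U} (hμ₀ : ∀ n, μ n 0 = m₀)
    (hν : ∀ n, MFC.SolvesContinuityEquation F (μ n) (ν n))
    (hG : ⨆ n, MFC.G ψ L (μ n) (ν n) < ∞) :
    ∃ (μ' : MFC.Curve d) (ν' : VectorMeasure (MFC.X d) U) (k : ℕ → ℕ),
      StrictMono k ∧
      MFC.Admissible F m₀ μ' ν' ∧
      MFC.CurveTendsto (fun n => μ (k n)) μ' ∧
      MFC.NarrowTendsto (fun n => ν (k n)) ν' ∧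
      MFC.G ψ L μ' ν' ≤ ⨆ n, MFC.G ψ L (μ n) (ν n) := by
  have hGB (n : ℕ) : MFC.G ψ L (μ n) (ν n) ≤ (⨆ n, MFC.G ψ L (μ n) (ν n)).toNNReal :=
    (le_iSup (fun n => MFC.G ψ L (μ n) (ν n)) n).trans_eq (ENNReal.coe_toNNReal hG.ne).symm
  choose u hu hcontrolled using fun n => MFC.exists_controlled_of_Psi_le hF hgrowth hψ0 hψ
    (hν n) (hμ₀ n) (le_self_add.trans (hGB n))
  obtain ⟨μ', u', k, hk, hμ', hu', htransport, hcost, hlim⟩ :=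
    MFC.exists_subseq_tendsto_of_controlled hF hgrowth hψ0 hψ hsuper hcontrolled
  have hν' : MFC.IsDensity (μ'.spaceTime.withDensityᵥ u') μ' u' := ⟨hu', rfl⟩
  refine ⟨μ', μ'.spaceTime.withDensityᵥ u', k, hk, ⟨htransport.isAC,
    (MFC.solvesContinuityEquation_iff hF hgrowth hν').2 htransport, ?_⟩, hμ',
    MFC.narrowTendsto_of_isDensity (fun n => hu (k n)) hν' hlim, ?_⟩
  · exact tendsto_nhds_unique (hμ'.apply 0) (by simp only [hμ₀]; exact tendsto_const_nhds)
  · rw [MFC.G, MFC.Psi_eq ψ _ _ u' hν']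
    refine (add_le_add hcost (MFC.lintegral_stateCost_le_liminf hL hμ')).trans
      (MFC.liminf_add_liminf_le fun n => ?_)
    rw [← MFC.Psi_eq ψ _ _ _ (hu (k n))]
    exact le_iSup (fun n => MFC.G ψ L (μ n) (ν n)) (k n)

theorem lemma3p2 {d : ℕ} (m₀ : MFC.P1 d) (U : Submodule ℝ (MFC.E d))
    (L : MFC.E d → MFC.P1 d → ℝ≥0∞) (hL : MFC.IsStateCost L)
    (ψ : U → ℝ) (hψ : MFC.IsControlCost U ψ)
    (F : MFC.E d → MFC.P1 d → MFC.E d) (hF : MFC.IsDrift F)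
    (μ : ℕ → MFC.Curve d) (ν : ℕ → VectorMeasure (MFC.X d) U)
    (hC : ∀ n, MFC.Admissible F m₀ (μ n) (ν n))
    (hG : ⨆ n, MFC.G ψ L (μ n) (ν n) < ∞) :
    ∃ (μ' : MFC.Curve d) (ν' : VectorMeasure (MFC.X d) U) (k : ℕ → ℕ),
      StrictMono k ∧
      MFC.Admissible F m₀ μ' ν' ∧
      MFC.CurveTendsto (fun n => μ (k n)) μ' ∧
      MFC.NarrowTendsto (fun n => ν (k n)) ν' ∧
      MFC.G ψ L μ' ν' ≤ ⨆ n, MFC.G ψ L (μ n) (ν n) :=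
  let ⟨_, hgrowth⟩ := hF.exists_growth
  lemma3p2_general hL.lowerSemicontinuous hψ.nonneg hψ.convex hψ.superlinear hF.continuous hgrowth
    (fun n => (hC n).initial) (fun n => (hC n).solves) hG
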